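/- Let $\eta_3\in(-2,2)$ and consider the system $$x_1'=x_2,\quad x_2'=x_3,\quad x_3'=x_4,\quad x_4'=-x_1+\eta_3x_3+x_1^2$$ on $\mathbb R^4$, with (local) flow $\varphi$, bifocal equilibrium $\mathcal O=0$ and first integral $H=\frac12x_1^2-\frac13x_1^3-\frac{\eta_3}2x_2^2+x_2x_4-\frac12x_3^2$. Let $W^u_{loc}$ be a local unstable manifold of $\mathcal O$, that is, the set of points whose backward orbit exists for all negative times, stays in a given open neighbourhood $U$ of $\mathcal O$ and tends to $\mathcal O$; suppose that it is the graph $x_3=a(x_1,x_2)$, $x_4=b(x_1,x_2)$ of two analytic functions on an open set $V\subset\mathbb R^2$. Let $W^u(\mathcal O)=\bigcup_{T\ge0}\varphi(T,W^u_{loc})$. Fix $r^*>0$ such that the closed disc of radius $r^*$ centred at $0$ is contained in $V$, put $\sigma(\theta)=(x_1,x_2,a(x_1,x_2),b(x_1,x_2))$ with $x_1=r^*\cos\theta$, $x_2=r^*\sin\theta$, and let $D^{u,+}=\sigma((0,\pi])$, $D^{u,-}=\sigma((\pi,2\pi])$, $D^u=D^{u,+}\cup D^{u,-}$. Let $S=\{x_2=0\}$,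 $C=S\cap\{H=0\}$, $C_2=\{x\in C:x_1>0,\,x_3>0\}$, $C_3=\{x\in C:x_1>0,\,x_3<0\}$, $v_1=\{x_1=x_2=x_3=0\}$ and $v_2=\{x_1=\frac32,\ x_2=x_3=0\}$. Let $\Pi$ be the partially defined map that sends $p$ to the first point $\varphi(t,p)$, $t>0$, of its forward orbit in $S$. Put $\Sigma^{u,\pm}_1=\Pi(D^{u,\pm})$, $\Sigma^{u,\pm}_{k+1}=\Pi(\Sigma^{u,\pm}_k)$ and $\Sigma^u_k=\Sigma^{u,+}_k\cup\Sigma^{u,-}_k$. Let $k\ge1$ and let $q=(\frac32,0,0,q_4)\in\Sigma^u_k\cap v_2$ with $q_4<0$. Assume that $W^u(\mathcal O)$ intersects $v_2$ transversely at $q$ within $\{H=0\}$, i.e. $T_qW^u(\mathcal O)+T_qv_2=T_q\{H=0\}$. Assume also that the orbit of $q$ meets $D^u$ in exactly one point $p$, that $p\notin S$, and that between $p$ and $q$ this orbit meets $S$ only transversally, i.e. outside $v_1\cup v_2$. Then $q$ has arbitrarily small open neighbourhoods $\mathcal W$ for which: 1. $\Sigma^{u,2}_k:=(\Sigma^u_k\setminus\{q\})\cap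 \mathcal W$ is an open arc contained in $C_2$ and having $q$ as an end point; 2. $\Pi$ is defined on all of $\Sigma^{u,2}_k$, and $\Sigma^{u,3}_{k+1}:=\Pi(\Sigma^{u,2}_k)$ is an open arc contained in $\Sigma^u_{k+1}\cap C_3$ and having $q$ as an end point. In particular, $q$ is a common end point of $\Sigma^{u,2}_k$ and $\Sigma^{u,3}_{k+1}$. Here an open arc with end point $q$ is a set $f((0,1))$ with $f:[0,1]\to\mathbb R^4$ continuous and injective and $f(0)=q$. -/

import Mathlib

namespace Bifocal

open Set Filter Topology

/-- The phase space; the coordinates `x₁, x₂, x₃, x₄` are `x 0, x 1, x 2, x 3`. -/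
abbrev Phase : Type := Fin 4 → ℝ

/-- The vector field `(x₂, x₃, x₄, -x₁ + η x₃ + x₁²)`. -/
def field (η : ℝ) (x : Phase) : Phase :=
  ![x 1, x 2, x 3, -x 0 + η * x 2 + x 0 ^ 2]

/-- The first integral `H`. -/
noncomputable def H (η : ℝ) (x : Phase) : ℝ :=
  (1 / 2) * x 0 ^ 2 - (1 / 3) * x 0 ^ 3 - (η / 2) * x 1 ^ 2 + x 1 * x 3 - (1 / 2) * x 2 ^ 2

/-- `Flow η t x y`, for `t ≥ 0`: the solution starting at `x` exists on `[0, t]`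
and is at `y` at time `t`, that is, `φ(t, x) = y`. -/
def Flow (η t : ℝ) (x y : Phase) : Prop :=
  0 ≤ t ∧ ∃ γ : ℝ → Phase, IsIntegralCurveOn γ (fun _ => field η) (Icc 0 t) ∧ γ 0 = x ∧ γ t = y

/-- `x` and `y` lie on the same orbit. -/
def SameOrbit (η : ℝ) (x y : Phase) : Prop :=
  ∃ t : ℝ, Flow η t x y ∨ Flow η t y x

/-- The local unstable manifold of the origin relative to a neighbourhood `U` of it: the points
whose backward orbit exists for all negative times, stays in `U` and tends to the origin. -/
def localUnstable (η : ℝ) (U : Set Phase) : Set Phase :=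
  {x | ∃ γ : ℝ → Phase, IsIntegralCurveOn γ (fun _ => field η) (Iic 0) ∧ γ 0 = x ∧
    (∀ t ≤ 0, γ t ∈ U) ∧ Tendsto γ atBot (𝓝 0)}

/-- The local unstable manifold relative to the open neighbourhood `U` of the origin is the graph
`x₃ = a(x₁, x₂)`, `x₄ = b(x₁, x₂)` of two analytic functions over the open set `V`. -/
structure IsLocalUnstableGraph (η : ℝ) (U : Set Phase) (V : Set (ℝ × ℝ)) (a b : ℝ × ℝ → ℝ) :
    Prop where
  isOpen_nhd : IsOpen U
  zero_mem_nhd : (0 : Phase) ∈ U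
  isOpen_base : IsOpen V
  analytic_a : AnalyticOnNhd ℝ a V
  analytic_b : AnalyticOnNhd ℝ b V
  eq_graph : localUnstable η U =
    {x : Phase | (x 0, x 1) ∈ V ∧ x 2 = a (x 0, x 1) ∧ x 3 = b (x 0, x 1)}

/-- The point `σ(θ)` of the local unstable manifold over the point of the circle of radius `r`
with angle `θ`. -/
noncomputable def sigma (r : ℝ) (a b : ℝ × ℝ → ℝ) (θ : ℝ) : Phase :=
  ![r * Real.cos θ, r * Real.sin θ,
    a (r * Real.cos θ, r * Real.sin θ), b (r * Real.cos θ, r * Real.sin θ)]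

/-- The half `D^{u,+}` of the curve of initial points. -/
def Dplus (r : ℝ) (a b : ℝ × ℝ → ℝ) : Set Phase := sigma r a b '' Ioc 0 Real.pi

/-- The half `D^{u,-}` of the curve of initial points. -/
def Dminus (r : ℝ) (a b : ℝ × ℝ → ℝ) : Set Phase := sigma r a b '' Ioc Real.pi (2 * Real.pi)

/-- The closed curve `D^u` of initial points. -/
def Du (r : ℝ) (a b : ℝ × ℝ → ℝ) : Set Phase := Dplus r a b ∪ Dminus r a b

/-- The cross section `S = {x₂ = 0}`. -/
def S : Set Phase := {x | x 1 = 0}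

/-- The loop cylinder `C = S ∩ {H = 0}`. -/
def C : Set Phase :=
  {x | x 1 = 0 ∧ (1 / 2) * x 0 ^ 2 - (1 / 3) * x 0 ^ 3 - (1 / 2) * x 2 ^ 2 = 0}

/-- The region `C₂` of the loop cylinder. -/
def C2 : Set Phase := {x | x ∈ C ∧ 0 < x 0 ∧ 0 < x 2}

/-- The region `C₃` of the loop cylinder. -/
def C3 : Set Phase := {x | x ∈ C ∧ 0 < x 0 ∧ x 2 < 0}

/-- The vertical line `v₁`. -/
def v1 : Set Phase := {x | x 0 = 0 ∧ x 1 = 0 ∧ x 2 = 0}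

/-- The vertical line `v₂`. -/
def v2 : Set Phase := {x | x 0 = 3 / 2 ∧ x 1 = 0 ∧ x 2 = 0}

/-- The (partially defined) Poincaré map `Π`, as a relation: `y` is the first point of `S` on the
forward orbit of `x`, at a positive time. -/
def Poincare (η : ℝ) (x y : Phase) : Prop :=
  ∃ t : ℝ, 0 < t ∧ ∃ γ : ℝ → Phase, IsIntegralCurveOn γ (fun _ => field η) (Icc 0 t) ∧
    γ 0 = x ∧ γ t = y ∧ y ∈ S ∧ ∀ s ∈ Ioo 0 t, γ s ∉ S

/-- The image of a set under the Poincaré map. -/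
def poincareImage (η : ℝ) (A : Set Phase) : Set Phase := {y | ∃ x ∈ A, Poincare η x y}

/-- The `k`-th intersections with `S` of the forward orbits starting in `D` (for `k ≥ 1`). -/
def iterHits (η : ℝ) (D : Set Phase) : ℕ → Set Phase
  | 0 => D
  | k + 1 => poincareImage η (iterHits η D k)

/-- `Σ^u_k = Σ^{u,+}_k ∪ Σ^{u,-}_k` (for `k ≥ 1`). -/
def SigmaU (η r : ℝ) (a b : ℝ × ℝ → ℝ) (k : ℕ) : Set Phase :=
  iterHits η (Dplus r a b) k ∪ iterHits η (Dminus r a b) k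

/-- The tangent vectors at `q` to the global unstable manifold `⋃_{T ≥ 0} φ(T, W)`, where `W` is
the local unstable manifold relative to `U`: the velocities of the curves `s ↦ φ(T, w(s))` through
`q`, with `w` a curve in `W`. -/
def tangentUnstable (η : ℝ) (U : Set Phase) (q : Phase) : Set Phase :=
  {v | ∃ (T : ℝ) (w c : ℝ → Phase),
    (∀ᶠ s in 𝓝 (0 : ℝ), w s ∈ localUnstable η U ∧ Flow η T (w s) (c s)) ∧
    c 0 = q ∧ HasDerivAt c v 0}

/-- The unstable manifold is transverse at `q` to the vertical line through `q`, within the level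
set of `H`: the tangent space of the level set is the sum of that of the unstable manifold and of
the line spanned by `(0, 0, 0, 1)`. -/
def TransverseToVertical (η : ℝ) (U : Set Phase) (q : Phase) : Prop :=
  ∀ u : Phase, fderiv ℝ (H η) q u = 0 →
    ∃ v ∈ tangentUnstable η U q, ∃ c : ℝ, u = v + c • (![0, 0, 0, 1] : Phase)

/-- The orbit of `q` meets `D` in exactly one point, which is not in `S`, and between that point
and `q` it meets `S` only transversally, that is, off `v₁ ∪ v₂`. -/
def ReachedCleanly (η : ℝ) (D : Set Phase) (q : Phase) : Prop :=
  ∃ p ∈ D, p ∉ S ∧ (∀ p' ∈ D, SameOrbit η p' q → p' = p) ∧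
    ∃ T : ℝ, Flow η T p q ∧
      ∀ t ∈ Ioo 0 T, ∀ y ∈ S, Flow η t p y → y ∉ v1 ∪ v2

/-- `A` is an open arc with `q` as an end point (which does not belong to it). -/
def IsOpenArcFrom (q : Phase) (A : Set Phase) : Prop :=
  ∃ f : ℝ → Phase, ContinuousOn f (Icc 0 1) ∧ InjOn f (Icc 0 1) ∧ f 0 = q ∧ A = f '' Ioo 0 1

end Bifocal

/-! At `q` the field is tangent to `S`: there x₂ = x₃ = 0, while x₂'' = x₄ = q₄ < 0, so along every
orbit near `q` the coordinate x₂ is a strictly concave function of time. A point of `S` near `q`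
with x₃ > 0 has no hit of `S` shortly before it and exactly one shortly after, at which x₃ < 0. A
point with x₃ < 0 on an orbit close to that of `q` has an additional hit shortly before it.
Transversality to the vertical line lets the inverse function theorem describe W^u ∩ S near `q` as a
curve `f y` with x₃ = y (`exists_local_curve`). The half y > 0 is the arc in `C2`; its image under
the return time, which is continuous and vanishes at y = 0, is the arc in `C3`.

The substance is that near `q` the set Σ^u_k is exactly the half y > 0. By `mem_iterHits_iff`,
membership means counting zeros of x₂ along an orbit segment that starts on the circle D^u, so three
facts are needed for points z near `q`. Flight times are controlled (`eventually_of_mem_SigmaU`):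
the backward orbit of `q` spirals into the focus and changes the sign of x₂ infinitely often, hence
nearby backward orbits have more than k zeros within a bounded time. A segment with only k hits is
therefore short, and since the orbit of `q` meets D^u only once, its duration is close to `T`.
Nearby orbits on W^u do cross D^u (`eventually_cross`): the orbit of `q` need not be transverse to
the circle, but it is inside before `-T` and outside at times arbitrarily soon after. Otherwise it
would remain in a compact part of the local unstable manifold, which expansion forbids
(`not_trapped`, `exists_rho_gt`). The count is locally constant apart from hits within a short time
of `q` (`eventually_count`): the intermediate hits are transverse and persist, and none occur near
D^u because the starting point is off `S`. The sign of x₃ decides whether an additional hit occurs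
near `q`.

Since solutions may blow up, all perturbation arguments use the complete flow of a cut-off field
that agrees with the original one on a large ball. -/

namespace Bifocal

open Set Filter Topology
open scoped NNReal

/-! ### Complete flows of bounded Lipschitz fields and their differentiability in the initial point.
-/

section GeneralFlow

variable {E : Type*} [NormedAddCommGroup E] [NormedSpace ℝ E]

/-- `Φ` is the global flow of the vector field `F`. -/
structure IsFlow (F : E → E) (Φ : ℝ → E → E) : Prop where
  zero : ∀ x, Φ 0 x = x
  deriv : ∀ x t, HasDerivAt (fun s => Φ s x) (F (Φ t x)) t

theorem IsFlow.neg {F : E → E} {Φ : ℝ → E → E} (h : IsFlow F Φ) :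
    IsFlow (fun x => -F x) (fun t => Φ (-t)) where
  zero x := by simpa using h.zero x
  deriv x t := by
    have := (h.deriv x (-t)).scomp t (hasDerivAt_neg t)
    simpa [Function.comp_def] using this

theorem IsFlow.continuous_time {F : E → E} {Φ : ℝ → E → E} (h : IsFlow F Φ) (x : E) :
    Continuous fun t => Φ t x :=
  continuous_iff_continuousAt.2 fun t => (h.deriv x t).continuousAt

theorem IsFlow.eq_of_hasDerivAt {F : E → E} {Φ : ℝ → E → E} (h : IsFlow F Φ) {K : ℝ≥0}
    (hK : LipschitzWith K F) {γ : ℝ → E} (hγ : ∀ t, HasDerivAt γ (F (γ t)) t) (t : ℝ) :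
    γ t = Φ t (γ 0) := by
  have := ODE_solution_unique_univ (v := fun _ => F) (s := fun _ => univ) (K := K) (t₀ := 0)
    (f := γ) (g := fun s => Φ s (γ 0)) (fun _ => hK.lipschitzOnWith)
    (fun t => ⟨hγ t, trivial⟩) (fun t => ⟨h.deriv _ t, trivial⟩) (h.zero _).symm
  exact congrFun this t

theorem IsFlow.add {F : E → E} {Φ : ℝ → E → E} (h : IsFlow F Φ) {K : ℝ≥0}
    (hK : LipschitzWith K F) (s t : ℝ) (x : E) : Φ (s + t) x = Φ s (Φ t x) := by
  have := h.eq_of_hasDerivAt hK (γ := fun u => Φ (u + t) x)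
    (fun u => by simpa using (h.deriv x (u + t)).comp_add_const u t) s
  simpa using this

theorem IsFlow.dist_le {F : E → E} {Φ : ℝ → E → E} (h : IsFlow F Φ) {K : ℝ≥0}
    (hK : LipschitzWith K F) (t : ℝ) (x y : E) :
    dist (Φ t x) (Φ t y) ≤ dist x y * Real.exp (K * |t|) := by
  have key : ∀ {F : E → E} {Φ : ℝ → E → E}, IsFlow F Φ → LipschitzWith K F → ∀ t, 0 ≤ t →
      dist (Φ t x) (Φ t y) ≤ dist x y * Real.exp (K * t) := by
    intro F Φ h hK t ht
    have := dist_le_of_trajectories_ODE (v := fun _ => F) (K := K) (a := 0) (b := t)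
      (f := fun s => Φ s x) (g := fun s => Φ s y) (δ := dist x y) (fun _ => hK)
      (h.continuous_time x).continuousOn (fun s _ => (h.deriv x s).hasDerivWithinAt)
      (h.continuous_time y).continuousOn (fun s _ => (h.deriv y s).hasDerivWithinAt)
      (by simp [h.zero]) t ⟨ht, le_rfl⟩
    simpa using this
  rcases le_total 0 t with ht | ht
  · simpa [abs_of_nonneg ht] using key h hK t ht
  · have := key h.neg hK.neg (-t) (by linarith)
    simpa [abs_of_nonpos ht] using this

theorem IsFlow.continuous {F : E → E} {Φ : ℝ → E → E} (h : IsFlow F Φ) {K : ℝ≥0}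
    (hK : LipschitzWith K F) : Continuous fun z : ℝ × E => Φ z.1 z.2 := by
  refine continuous_iff_continuousAt.2 fun ⟨t, x⟩ => ?_
  have h1 : Tendsto (fun z : ℝ × E => dist z.2 x * Real.exp (K * |z.1|) + dist (Φ z.1 x) (Φ t x))
      (𝓝 (t, x)) (𝓝 (dist x x * Real.exp (K * |t|) + dist (Φ t x) (Φ t x))) := by
    have hc : Continuous fun z : ℝ × E =>
        dist z.2 x * Real.exp (K * |z.1|) + dist (Φ z.1 x) (Φ t x) := by
      have := (h.continuous_time x).comp (continuous_fst (X := ℝ) (Y := E))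
      exact ((continuous_snd.dist continuous_const).mul
        (Real.continuous_exp.comp (continuous_const.mul continuous_fst.abs))).add
        (this.dist continuous_const)
    exact hc.tendsto _
  simp only [dist_self, zero_mul, add_zero] at h1
  refine tendsto_iff_dist_tendsto_zero.2 (squeeze_zero (fun _ => dist_nonneg) (fun z => ?_) h1)
  exact (dist_triangle _ (Φ z.1 x) _).trans (add_le_add (h.dist_le hK _ _ _) le_rfl)

theorem exists_isFlow [CompleteSpace E] {F : E → E} {K M : ℝ≥0} (hK : LipschitzWith K F)
    (hM : ∀ x, ‖F x‖ ≤ M) : ∃ Φ, IsFlow F Φ := by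
  have hloc : ∀ (x : E) (n : ℕ), ∃ α : ℝ → E, α 0 = x ∧ ∀ t ∈ Icc (-(n + 1 : ℝ)) (n + 1),
      HasDerivWithinAt α (F (α t)) (Icc (-(n + 1 : ℝ)) (n + 1)) t := by
    intro x n
    have hn : (0 : ℝ) ∈ Icc (-(n + 1 : ℝ)) (n + 1) := ⟨by linarith [n.cast_nonneg (α := ℝ)],
      by positivity⟩
    -- Speed at most `M` for a time `n + 1` keeps the solution in a ball of radius `M * (n + 1)`,
    -- where the same bounds hold.
    have : IsPicardLindelof (fun _ : ℝ => F) (tmin := -(n + 1 : ℝ)) (tmax := n + 1) ⟨0, hn⟩ x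
        (M * (n + 1)) 0 M K :=
      IsPicardLindelof.of_time_independent (fun y _ => hM y) hK.lipschitzOnWith (by simp)
    exact this.exists_eq_forall_mem_Icc_hasDerivWithinAt₀
  choose α hα0 hα using hloc
  have hd : ∀ x, ∀ n : ℕ, ∀ t, t ∈ Ioo (-(n + 1 : ℝ)) (n + 1) → HasDerivAt (α x n) (F (α x n t)) t :=
    fun x n t ht => (hα x n t (Ioo_subset_Icc_self ht)).hasDerivAt (Icc_mem_nhds ht.1 ht.2)
  have heq : ∀ x, ∀ m n : ℕ, m ≤ n → EqOn (α x m) (α x n) (Ioo (-(m + 1 : ℝ)) (m + 1)) := by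
    intro x m n hmn
    have hmn' : (m : ℝ) ≤ n := by exact_mod_cast hmn
    exact ODE_solution_unique_of_mem_Ioo (v := fun _ => F) (s := fun _ => univ) (t₀ := 0)
      (fun _ _ => hK.lipschitzOnWith) ⟨by linarith [m.cast_nonneg (α := ℝ)], by positivity⟩
      (fun t ht => ⟨hd x m t ht, trivial⟩)
      (fun t ht => ⟨hd x n t ⟨by linarith [ht.1], by linarith [ht.2]⟩, trivial⟩)
      ((hα0 x m).trans (hα0 x n).symm)
  refine ⟨fun t x => α x ⌈|t|⌉₊ t, ⟨fun x => hα0 _ _, fun x t => ?_⟩⟩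
  -- The solution with index `n` lives on [-(n+1), n+1]; the extra 1 puts `s` in the interior for
  -- the index ⌈|s|⌉, so two-sided derivatives are available.
  have hlt : ∀ s : ℝ, s ∈ Ioo (-((⌈|s|⌉₊ : ℝ) + 1)) (⌈|s|⌉₊ + 1) := fun s => by
    have := Nat.le_ceil |s|
    have := abs_le.1 this
    exact ⟨by linarith [this.1], by linarith [this.2]⟩
  refine (hd x _ t (hlt t)).congr_of_eventuallyEq ?_
  filter_upwards [Ioo_mem_nhds (hlt t).1 (hlt t).2] with s hs
  rcases le_total ⌈|s|⌉₊ ⌈|t|⌉₊ with h | h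
  · exact heq x _ _ h (hlt s)
  · exact (heq x _ _ h hs).symm

/-- The variational equation over a short time. -/
theorem exists_variational [CompleteSpace E] {B : ℝ → E →L[ℝ] E} (hB : Continuous B) {K : ℝ≥0}
    (hBK : ∀ t, ‖B t‖ ≤ K) {τ : ℝ} (hτ : 0 ≤ τ) (hKτ : 2 * K * τ ≤ 1) :
    ∃ A : ℝ → E →L[ℝ] E, A 0 = ContinuousLinearMap.id ℝ E ∧
      ∀ t ∈ Icc 0 τ, HasDerivWithinAt A ((B t).comp (A t)) (Icc 0 τ) t := by
  have hlip : ∀ t, LipschitzWith K fun A : E →L[ℝ] E => (B t).comp A := fun t => by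
    refine LipschitzWith.of_dist_le_mul fun A A' => ?_
    rw [dist_eq_norm, dist_eq_norm, ← ContinuousLinearMap.comp_sub]
    exact (ContinuousLinearMap.opNorm_comp_le _ _).trans (by gcongr; exact hBK t)
  -- In the ball of radius 1 about the identity the norm is at most 2, so the speed is at most `2 *
  -- K`; the solution cannot leave the ball while `2 * K * τ ≤ 1`.
  have : IsPicardLindelof (fun t (A : E →L[ℝ] E) => (B t).comp A) (tmin := 0) (tmax := τ)
      ⟨0, left_mem_Icc.2 hτ⟩ (ContinuousLinearMap.id ℝ E) 1 0 (2 * K) K :=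
    { lipschitzOnWith := fun t _ => (hlip t).lipschitzOnWith
      continuousOn := fun A _ => (hB.clm_comp continuous_const).continuousOn
      norm_le := fun t _ A hA => by
        have hA' : ‖A‖ ≤ 2 := by
          have h1 := mem_closedBall_iff_norm.1 hA
          have h2 := ContinuousLinearMap.norm_id_le (𝕜 := ℝ) (E := E)
          have h3 := norm_add_le (A - ContinuousLinearMap.id ℝ E) (ContinuousLinearMap.id ℝ E)
          rw [sub_add_cancel] at h3
          simp only [NNReal.coe_one] at h1
          linarith
        calc ‖(B t).comp A‖ ≤ ‖B t‖ * ‖A‖ := ContinuousLinearMap.opNorm_comp_le _ _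
          _ ≤ K * 2 := by gcongr; exact hBK t
          _ = ((2 * K : ℝ≥0) : ℝ) := by push_cast; ring
      mul_max_le := by simpa [hτ] using hKτ }
  exact this.exists_eq_forall_mem_Icc_hasDerivWithinAt₀

/-- The derivative is the solution of the variational equation along the orbit of `x`. For `y`, `z`
near `x` the difference of their orbits solves this linear equation up to an error small compared
with ‖y - z‖, by uniform continuity of the derivative of `F`, and Grönwall's inequality carries the
estimate to time `τ`. Letting both points vary gives strict differentiability, which the inverse
function theorem requires. -/
theorem IsFlow.exists_hasStrictFDerivAt_short [CompleteSpace E] {F : E → E} {Φ : ℝ → E → E}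
    (h : IsFlow F Φ) (hF : ContDiff ℝ 1 F) {K : ℝ≥0} (hK : LipschitzWith K F)
    (hu : UniformContinuous (fderiv ℝ F)) {τ : ℝ} (hτ : 0 ≤ τ) (hKτ : 2 * K * τ ≤ 1) (x : E) :
    ∃ A : E →L[ℝ] E, HasStrictFDerivAt (Φ τ) A x := by
  have hdF : ∀ y, ‖fderiv ℝ F y‖ ≤ K := fun y => norm_fderiv_le_of_lipschitz ℝ hK
  obtain ⟨A, hA0, hA⟩ := exists_variational (B := fun t => fderiv ℝ F (Φ t x))
    ((hF.continuous_fderiv one_ne_zero).comp (h.continuous_time x)) (fun t => hdF _) hτ hKτ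
  refine ⟨A τ, .of_isLittleO <| Asymptotics.isLittleO_iff.2 fun ε hε => ?_⟩
  set C : ℝ := Real.exp (K * τ) with hC
  have hC1 : 0 < C := Real.exp_pos _
  -- Grönwall's bound with zero initial gap is linear in the error; `K = 0` is separate because the
  -- closed formula divides by `K`.
  obtain ⟨G, hG, hGb⟩ : ∃ G : ℝ, 0 < G ∧ ∀ e, 0 ≤ e → gronwallBound 0 K e τ ≤ G * e := by
    by_cases hK0 : (K : ℝ) = 0
    · refine ⟨τ + 1, by positivity, fun e he => ?_⟩
      rw [hK0, gronwallBound_K0]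
      simp only [zero_add]
      nlinarith
    · refine ⟨(C - 1) / K + 1, ?_, fun e he => ?_⟩
      · have : (1 : ℝ) ≤ C := Real.one_le_exp (by positivity)
        have : 0 ≤ (C - 1) / K := div_nonneg (by linarith) K.2
        linarith
      · rw [gronwallBound_of_K_ne_0 hK0]
        simp only [zero_mul, zero_add, ← hC]
        have : e / K * (C - 1) = (C - 1) / K * e := by ring
        nlinarith
  set e₀ : ℝ := ε / (G * C) with he₀
  have he₀p : 0 < e₀ := by positivity
  obtain ⟨δ, hδ, hδu⟩ := Metric.uniformContinuous_iff.1 hu e₀ he₀p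
  have hnear : ∀ y ∈ Metric.ball x (δ / C), ∀ t ∈ Icc 0 τ, Φ t y ∈ Metric.ball (Φ t x) δ := by
    intro y hy t ht
    have h1 := h.dist_le hK t y x
    rw [abs_of_nonneg ht.1] at h1
    have h2 : Real.exp (K * t) ≤ C := Real.exp_le_exp.2 (by gcongr; exact ht.2)
    have h3 : dist y x < δ / C := hy
    rw [lt_div_iff₀ hC1] at h3
    exact lt_of_le_of_lt (h1.trans (by gcongr)) h3
  have hball : Metric.ball x (δ / C) ∈ 𝓝 x := Metric.ball_mem_nhds _ (by positivity)
  filter_upwards [prod_mem_nhds hball hball] with ⟨y, z⟩ ⟨hy, hz⟩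
  simp only at hy hz ⊢
  have herr : ∀ t ∈ Ico 0 τ, dist (F (Φ t y) - F (Φ t z))
      (fderiv ℝ F (Φ t x) (Φ t y - Φ t z)) ≤ e₀ * (‖y - z‖ * C) := by
    intro t ht
    have hy' := hnear y hy t ⟨ht.1, ht.2.le⟩
    have hz' := hnear z hz t ⟨ht.1, ht.2.le⟩
    have hm := (convex_ball (Φ t x) δ).norm_image_sub_le_of_norm_hasFDerivWithin_le'
      (f := F) (f' := fderiv ℝ F) (φ := fderiv ℝ F (Φ t x)) (C := e₀)
      (fun w _ => ((hF.differentiable one_ne_zero) w).hasFDerivAt.hasFDerivWithinAt)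
      (fun w hw => by rw [← dist_eq_norm]; exact (hδu hw).le) hz' hy'
    rw [dist_eq_norm]
    refine hm.trans ?_
    have h1 := h.dist_le hK t y z
    rw [abs_of_nonneg ht.1, dist_eq_norm, dist_eq_norm] at h1
    have h2 : Real.exp (K * t) ≤ C := Real.exp_le_exp.2 (by gcongr; exact ht.2.le)
    gcongr
    exact h1.trans (by gcongr)
  have hgr := dist_le_of_approx_trajectories_ODE (v := fun t u => fderiv ℝ F (Φ t x) u) (K := K)
    (a := 0) (b := τ) (f := fun t => Φ t y - Φ t z) (g := fun t => A t (y - z)) (δ := 0)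
    (f' := fun t => F (Φ t y) - F (Φ t z)) (g' := fun t => fderiv ℝ F (Φ t x) (A t (y - z)))
    (εf := e₀ * (‖y - z‖ * C)) (εg := 0)
    (fun t => ContinuousLinearMap.lipschitzWith_of_opNorm_le (hdF _))
    ((h.continuous_time y).sub (h.continuous_time z)).continuousOn
    (fun t _ => ((h.deriv y t).sub (h.deriv z t)).hasDerivWithinAt) herr
    (fun t ht => ((hA t ht).continuousWithinAt).clm_apply continuousWithinAt_const)
    (fun t ht => by
      have h1 := (hA t ⟨ht.1, ht.2.le⟩).mono_of_mem_nhdsWithin (Icc_mem_nhdsGE_of_mem ht)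
      simpa using h1.clm_apply (hasDerivWithinAt_const t _ (y - z)))
    (fun t _ => by simp) (by simp [h.zero, hA0]) τ ⟨hτ, le_rfl⟩
  rw [dist_eq_norm, sub_zero, add_zero] at hgr
  refine hgr.trans ((hGb _ (by positivity)).trans (le_of_eq ?_))
  rw [he₀]
  field_simp

theorem IsFlow.exists_hasStrictFDerivAt [CompleteSpace E] {F : E → E} {Φ : ℝ → E → E}
    (h : IsFlow F Φ) (hF : ContDiff ℝ 1 F) {K : ℝ≥0} (hK : LipschitzWith K F)
    (hu : UniformContinuous (fderiv ℝ F)) (t : ℝ) (x : E) :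
    ∃ A : E →L[ℝ] E, HasStrictFDerivAt (Φ t) A x := by
  have key : ∀ {F : E → E} {Φ : ℝ → E → E}, IsFlow F Φ → ContDiff ℝ 1 F → LipschitzWith K F →
      UniformContinuous (fderiv ℝ F) → ∀ t, 0 ≤ t →
      ∃ A : E →L[ℝ] E, HasStrictFDerivAt (Φ t) A x := by
    intro F Φ h hF hK hu t ht
    -- Cutting `t` into `n > 2Kt` equal steps makes each one short enough for the previous result;
    -- the chain rule composes them.
    obtain ⟨n, hn⟩ := exists_nat_gt (2 * K * t)
    have hn0 : (0 : ℝ) < n := lt_of_le_of_lt (by positivity) hn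
    have hstep := h.exists_hasStrictFDerivAt_short hF hK hu (τ := t / n) (by positivity)
      (by rw [← mul_div_assoc, div_le_one hn0]; exact hn.le)
    have hind : ∀ m : ℕ, ∃ A : E →L[ℝ] E, HasStrictFDerivAt (Φ (m * (t / n))) A x := by
      intro m
      induction m with
      | zero =>
        refine ⟨ContinuousLinearMap.id ℝ E, ?_⟩
        have : Φ (((0 : ℕ) : ℝ) * (t / n)) = id := by ext y; simp [h.zero]
        rw [this]
        exact hasStrictFDerivAt_id x
      | succ m ih =>
        obtain ⟨A, hA⟩ := ih
        obtain ⟨A', hA'⟩ := hstep (Φ (m * (t / n)) x)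
        refine ⟨A'.comp A, ?_⟩
        have : Φ (((m + 1 : ℕ) : ℝ) * (t / n)) = Φ (t / n) ∘ Φ (m * (t / n)) := by
          ext y
          rw [Function.comp_apply, ← h.add hK]
          congr 1
          push_cast
          ring
        rw [this]
        exact hA'.comp x hA
    obtain ⟨A, hA⟩ := hind n
    refine ⟨A, ?_⟩
    rwa [mul_div_cancel₀ _ hn0.ne'] at hA
  rcases le_total 0 t with ht | ht
  · exact key h hF hK hu t ht
  · have hfd : fderiv ℝ (fun x => -F x) = fun x => -fderiv ℝ F x := by
      ext1 y; exact fderiv_neg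
    have := key h.neg hF.neg hK.neg (by rw [hfd]; exact hu.neg) (-t)
      (by linarith)
    simpa using this

end GeneralFlow

/-! ### Integral curves of the system, conservation of `H`, and the cut-off flow. -/

section Curves

theorem isIntegralCurveOn_glue {γ γ' : ℝ → Phase} {v : Phase → Phase} {s : Set ℝ} {c : ℝ}
    (h : IsIntegralCurveOn γ (fun _ => v) (s ∩ Iic c))
    (h' : IsIntegralCurveOn γ' (fun _ => v) (s ∩ Ici c)) (hc : γ c = γ' c) :
    IsIntegralCurveOn (fun t => if t ≤ c then γ t else γ' t) (fun _ => v) s := by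
  intro t ht
  have hs : s = (s ∩ Iic c) ∪ (s ∩ Ici c) := by
    rw [← inter_union_distrib_left, Iic_union_Ici, inter_univ]
  have e1 : EqOn (fun t => if t ≤ c then γ t else γ' t) γ (s ∩ Iic c) := fun u hu => if_pos hu.2
  have e2 : EqOn (fun t => if t ≤ c then γ t else γ' t) γ' (s ∩ Ici c) := by
    intro u hu
    rcases (show c ≤ u from hu.2).eq_or_lt with rfl | hlt
    · simp [hc]
    · simp [not_le.2 hlt]
  rcases lt_trichotomy t c with htc | htc | htc
  · have hn : s ∩ Iic c ∈ 𝓝[s] t := inter_mem_nhdsWithin s (Iic_mem_nhds htc)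
    have h1 := (h t ⟨ht, htc.le⟩).congr_of_mem e1 ⟨ht, htc.le⟩
    simpa [htc.le] using h1.mono_of_mem_nhdsWithin hn
  · subst htc
    have h1 := (h t ⟨ht, self_mem_Iic⟩).congr_of_mem e1 ⟨ht, self_mem_Iic⟩
    have h2 := (h' t ⟨ht, self_mem_Ici⟩).congr_of_mem e2 ⟨ht, self_mem_Ici⟩
    rw [← hc] at h2
    have h3 := h1.union h2
    rw [← hs] at h3
    simpa using h3
  · have hn : s ∩ Ici c ∈ 𝓝[s] t := inter_mem_nhdsWithin s (Ici_mem_nhds htc)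
    have h1 := (h' t ⟨ht, htc.le⟩).congr_of_mem e2 ⟨ht, htc.le⟩
    simpa [not_le.2 htc] using h1.mono_of_mem_nhdsWithin hn

theorem isIntegralCurveOn_shift {γ : ℝ → Phase} {v : Phase → Phase} {s s' : Set ℝ} (c : ℝ)
    (h : IsIntegralCurveOn γ (fun _ => v) s) (hs : ∀ t ∈ s', t + c ∈ s) :
    IsIntegralCurveOn (fun t => γ (t + c)) (fun _ => v) s' := by
  have := (h.comp_add c).mono (s' := s') 
    (fun t ht => by simpa [mem_vadd_set_iff_neg_vadd_mem, add_comm] using hs t ht)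
  exact this

theorem field_contDiff (η : ℝ) {n : WithTop ℕ∞} : ContDiff ℝ n (field η) := by
  rw [contDiff_pi]
  intro i
  fin_cases i <;> simp [field] <;> fun_prop

/-- Both curves have compact image on the interval, and a locally Lipschitz field is Lipschitz on a
compact set, so the standard uniqueness theorem applies on each side of `t₀`. -/
theorem curve_unique {v : Phase → Phase} (hv : LocallyLipschitz v) {γ γ' : ℝ → Phase} {α β t₀ : ℝ}
    (h : IsIntegralCurveOn γ (fun _ => v) (Icc α β))
    (h' : IsIntegralCurveOn γ' (fun _ => v) (Icc α β)) (ht₀ : t₀ ∈ Icc α β)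
    (he : γ t₀ = γ' t₀) : EqOn γ γ' (Icc α β) := by
  have hK : IsCompact (γ '' Icc α β ∪ γ' '' Icc α β) :=
    (isCompact_Icc.image_of_continuousOn h.continuousOn).union
      (isCompact_Icc.image_of_continuousOn h'.continuousOn)
  obtain ⟨L, hL⟩ := LocallyLipschitzOn.exists_lipschitzOnWith_of_compact hK
    hv.locallyLipschitzOn
  have hm : ∀ t ∈ Icc α β, γ t ∈ γ '' Icc α β ∪ γ' '' Icc α β := fun t ht =>
    Or.inl (mem_image_of_mem _ ht)
  have hm' : ∀ t ∈ Icc α β, γ' t ∈ γ '' Icc α β ∪ γ' '' Icc α β := fun t ht =>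
    Or.inr (mem_image_of_mem _ ht)
  have hl : Icc α t₀ ⊆ Icc α β := Icc_subset_Icc_right ht₀.2
  have hr : Icc t₀ β ⊆ Icc α β := Icc_subset_Icc_left ht₀.1
  have e1 : EqOn γ γ' (Icc α t₀) := by
    refine ODE_solution_unique_of_mem_Icc_left (v := fun _ => v)
      (s := fun _ => γ '' Icc α β ∪ γ' '' Icc α β) (fun _ _ => hL) (h.continuousOn.mono hl)
      (fun t ht => ?_) (fun t ht => hm t (hl ⟨ht.1.le, ht.2⟩)) (h'.continuousOn.mono hl)
      (fun t ht => ?_) (fun t ht => hm' t (hl ⟨ht.1.le, ht.2⟩)) he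
    · exact (h t (hl ⟨ht.1.le, ht.2⟩)).mono_of_mem_nhdsWithin
        (Icc_mem_nhdsLE_of_mem ⟨ht.1, ht.2.trans ht₀.2⟩)
    · exact (h' t (hl ⟨ht.1.le, ht.2⟩)).mono_of_mem_nhdsWithin
        (Icc_mem_nhdsLE_of_mem ⟨ht.1, ht.2.trans ht₀.2⟩)
  have e2 : EqOn γ γ' (Icc t₀ β) := by
    refine ODE_solution_unique_of_mem_Icc_right (v := fun _ => v)
      (s := fun _ => γ '' Icc α β ∪ γ' '' Icc α β) (fun _ _ => hL) (h.continuousOn.mono hr)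
      (fun t ht => ?_) (fun t ht => hm t (hr ⟨ht.1, ht.2.le⟩)) (h'.continuousOn.mono hr)
      (fun t ht => ?_) (fun t ht => hm' t (hr ⟨ht.1, ht.2.le⟩)) he
    · exact (h t (hr ⟨ht.1, ht.2.le⟩)).mono_of_mem_nhdsWithin
        (Icc_mem_nhdsGE_of_mem ⟨ht₀.1.trans ht.1, ht.2⟩)
    · exact (h' t (hr ⟨ht.1, ht.2.le⟩)).mono_of_mem_nhdsWithin
        (Icc_mem_nhdsGE_of_mem ⟨ht₀.1.trans ht.1, ht.2⟩)
  rw [← Icc_union_Icc_eq_Icc ht₀.1 ht₀.2]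
  exact e1.union e2

theorem hasDerivWithinAt_H {η : ℝ} {γ : ℝ → Phase} {s : Set ℝ} {t : ℝ}
    (h : HasDerivWithinAt γ (field η (γ t)) s t) :
    HasDerivWithinAt (fun u => H η (γ u)) 0 s t := by
  have hi := hasDerivWithinAt_pi.1 h
  have h0 := hi 0
  have h1 := hi 1
  have h2 := hi 2
  have h3 := hi 3
  simp only [field, Matrix.cons_val] at h0 h1 h2 h3
  have := (((((h0.pow 2).const_mul (1 / 2)).sub ((h0.pow 3).const_mul (1 / 3))).sub
    ((h1.pow 2).const_mul (η / 2))).add (h1.mul h3)).sub ((h2.pow 2).const_mul (1 / 2))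
  convert! this using 1
  norm_num
  ring

theorem continuous_H (η : ℝ) : Continuous (H η) := by
  unfold H
  fun_prop

theorem H_eq_of_curve {η : ℝ} {γ : ℝ → Phase} {α β : ℝ} (hαβ : α ≤ β)
    (h : IsIntegralCurveOn γ (fun _ => field η) (Icc α β)) : H η (γ α) = H η (γ β) := by
  have hd : ∀ t ∈ Icc α β, HasDerivWithinAt (fun u => H η (γ u)) 0 (Icc α β) t := fun t ht =>
    hasDerivWithinAt_H (h t ht)
  have := (convex_Icc α β).norm_image_sub_le_of_norm_hasDerivWithin_le (C := 0) hd
    (fun t _ => by simp) (left_mem_Icc.2 hαβ) (right_mem_Icc.2 hαβ)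
  rw [zero_mul, norm_le_zero_iff, sub_eq_zero] at this
  exact this.symm

/-- A complete flow that follows the vector field `field η` inside the ball of radius `R`. -/
structure CutoffFlow (η R : ℝ) (Φ : ℝ → Phase → Phase) : Prop where
  zero : ∀ x, Φ 0 x = x
  add : ∀ s t x, Φ (s + t) x = Φ s (Φ t x)
  continuous : Continuous fun z : ℝ × Phase => Φ z.1 z.2
  strict : ∀ t x, ∃ A : Phase →L[ℝ] Phase, HasStrictFDerivAt (Φ t) A x
  deriv : ∀ x t, Φ t x ∈ Metric.ball 0 R →
    HasDerivAt (fun s => Φ s x) (field η (Φ t x)) t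
  eq_of_curve_ball : ∀ (γ : ℝ → Phase) (α β t₀ : ℝ),
    IsIntegralCurveOn γ (fun _ => field η) (Icc α β) → t₀ ∈ Icc α β →
    (∀ t ∈ Icc α β, γ t ∈ Metric.ball 0 R) → ∀ t ∈ Icc α β, γ t = Φ (t - t₀) (γ t₀)

/-- Multiplying the polynomial field by a bump function equal to 1 on the ball gives a compactly
supported smooth field, hence bounded, Lipschitz, and with uniformly continuous derivative. -/
theorem exists_cutoffFlow (η : ℝ) {R : ℝ} (hR : 0 < R) : ∃ Φ, CutoffFlow η R Φ := by
  let χ : ContDiffBump (0 : Phase) := ⟨R, R + 1, hR, by linarith⟩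
  set F : Phase → Phase := fun x => χ x • field η x with hFdef
  have hF : ∀ n : ℕ, ContDiff ℝ n F := fun n =>
    (χ.contDiff (n := n)).smul (field_contDiff η)
  have hF1 : ContDiff ℝ 1 F := by simpa using hF 1
  have hc : HasCompactSupport F := χ.hasCompactSupport.smul_right
  obtain ⟨K, hK⟩ := hF1.lipschitzWith_of_hasCompactSupport hc one_ne_zero
  obtain ⟨M, hM⟩ := hc.exists_bound_of_continuous hF1.continuous
  have hu : UniformContinuous (fderiv ℝ F) :=
    (hc.fderiv (𝕜 := ℝ)).uniformContinuous_of_continuous (hF1.continuous_fderiv one_ne_zero)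
  have hFb : ∀ x ∈ Metric.ball (0 : Phase) R, F x = field η x := fun x hx => by
    have h1 : χ x = 1 := χ.one_of_mem_closedBall (Metric.ball_subset_closedBall hx)
    rw [hFdef]
    simp only [h1, one_smul]
  obtain ⟨Φ, hΦ⟩ := exists_isFlow (M := M.toNNReal) hK
    (fun x => (hM x).trans (Real.le_coe_toNNReal M))
  refine ⟨Φ, hΦ.zero, hΦ.add hK, hΦ.continuous hK, hΦ.exists_hasStrictFDerivAt hF1 hK hu, ?_, ?_⟩
  · intro x t hx
    simpa only [hFb _ hx] using hΦ.deriv x t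
  · intro γ α β t₀ hγ ht₀ hb t ht
    refine curve_unique hF1.locallyLipschitz (γ' := fun t => Φ (t - t₀) (γ t₀)) (fun u hu => ?_)
      (fun u hu => ?_) ht₀ (by simp [hΦ.zero]) ht
    · simpa only [hFb _ (hb u hu)] using hγ u hu
    · exact ((hΦ.deriv (γ t₀) (u - t₀)).comp_sub_const u t₀).hasDerivWithinAt

namespace CutoffFlow

variable {η R : ℝ} {Φ : ℝ → Phase → Phase}

theorem continuous_time (h : CutoffFlow η R Φ) (x : Phase) : Continuous fun t => Φ t x :=
  h.continuous.comp (continuous_id.prodMk continuous_const)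

theorem continuous_space (h : CutoffFlow η R Φ) (t : ℝ) : Continuous (Φ t) :=
  h.continuous.comp (continuous_const.prodMk continuous_id)

theorem neg_cancel (h : CutoffFlow η R Φ) (t : ℝ) (x : Phase) : Φ t (Φ (-t) x) = x := by
  rw [← h.add, add_neg_cancel, h.zero]

theorem cancel_neg (h : CutoffFlow η R Φ) (t : ℝ) (x : Phase) : Φ (-t) (Φ t x) = x := by
  rw [← h.add, neg_add_cancel, h.zero]

theorem isIntegralCurveOn (h : CutoffFlow η R Φ) {x : Phase} {s : Set ℝ} (c : ℝ)
    (hs : ∀ t ∈ s, Φ (t + c) x ∈ Metric.ball 0 R) :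
    IsIntegralCurveOn (fun t => Φ (t + c) x) (fun _ => field η) s := fun t ht =>
  ((h.deriv x (t + c) (hs t ht)).comp_add_const t c).hasDerivWithinAt

theorem eq_of_curve (h : CutoffFlow η R Φ) {γ : ℝ → Phase} {α β t₀ : ℝ}
    (hγ : IsIntegralCurveOn γ (fun _ => field η) (Icc α β)) (ht₀ : t₀ ∈ Icc α β)
    (hs : ∀ t ∈ Icc α β, Φ (t - t₀) (γ t₀) ∈ Metric.ball 0 R) :
    ∀ t ∈ Icc α β, γ t = Φ (t - t₀) (γ t₀) := by
  have h1 := h.isIntegralCurveOn (x := γ t₀) (s := Icc α β) (-t₀)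
    (fun t ht => by simpa [sub_eq_add_neg] using hs t ht)
  intro t ht
  simpa [sub_eq_add_neg] using curve_unique (field_contDiff η).locallyLipschitz hγ h1 ht₀ (by simp [h.zero]) ht

end CutoffFlow

end Curves

/-! ### Iterated Poincaré hits as numbers of crossings. -/

section Counting

/-- The reason for this form is that a count of zeros on one segment can be perturbed, whereas a
chain of first returns cannot conveniently be. The count omits both ends, so the hit with index `k +
1` has `k` predecessors. -/
theorem mem_iterHits_iff (η : ℝ) (D : Set Phase) (k : ℕ) (z : Phase) :
    z ∈ iterHits η D (k + 1) ↔ ∃ x ∈ D, ∃ t : ℝ, 0 < t ∧ ∃ γ : ℝ → Phase,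
      IsIntegralCurveOn γ (fun _ => field η) (Icc 0 t) ∧ γ 0 = x ∧ γ t = z ∧ z ∈ S ∧
      {s ∈ Ioo 0 t | γ s ∈ S}.encard = k := by
  induction k generalizing z with
  | zero =>
    constructor
    · rintro ⟨x, hx, t, ht, γ, hγ, h0, h1, hz, hn⟩
      refine ⟨x, hx, t, ht, γ, hγ, h0, h1, hz, ?_⟩
      simp only [Nat.cast_zero, encard_eq_zero]
      ext s
      simp only [mem_ofPred_eq, mem_empty_iff_false, iff_false]
      exact fun hs => hn s hs.1 hs.2
    · rintro ⟨x, hx, t, ht, γ, hγ, h0, h1, hz, hn⟩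
      refine ⟨x, hx, t, ht, γ, hγ, h0, h1, hz, fun s hs hS => ?_⟩
      simp only [Nat.cast_zero, encard_eq_zero] at hn
      have : s ∈ {s ∈ Ioo 0 t | γ s ∈ S} := ⟨hs, hS⟩
      rw [hn] at this
      exact this
  | succ k ih =>
    constructor
    · rintro ⟨y, hy, t₂, ht₂, γ₂, hγ₂, h0, h1, hz, hn⟩
      obtain ⟨x, hx, t₁, ht₁, γ₁, hγ₁, h0', h1', hyS, hcard⟩ := (ih y).1 hy
      refine ⟨x, hx, t₁ + t₂, by positivity,
        fun s => if s ≤ t₁ then γ₁ s else γ₂ (s + -t₁), ?_, ?_, ?_, hz, ?_⟩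
      · refine isIntegralCurveOn_glue (γ' := fun s => γ₂ (s + -t₁)) (hγ₁.mono ?_)
          (isIntegralCurveOn_shift (-t₁) hγ₂ ?_) ?_
        · exact fun s hs => ⟨hs.1.1, hs.2⟩
        · exact fun s hs => ⟨by linarith [mem_Ici.1 hs.2], by linarith [hs.1.2]⟩
        · simp [h0, h1']
      · simp [ht₁.le, h0']
      · simp [ht₂, h1]
      · have : {s ∈ Ioo 0 (t₁ + t₂) | (if s ≤ t₁ then γ₁ s else γ₂ (s + -t₁)) ∈ S} =
            insert t₁ {s ∈ Ioo 0 t₁ | γ₁ s ∈ S} := by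
          ext s
          simp only [mem_ofPred_eq, mem_insert_iff, mem_Ioo]
          rcases lt_trichotomy s t₁ with h | h | h
          · simp only [h.le, if_true, h.ne, false_or]
            constructor
            · exact fun hs => ⟨⟨hs.1.1, h⟩, hs.2⟩
            · exact fun hs => ⟨⟨hs.1.1, by linarith⟩, hs.2⟩
          · subst h
            simp [ht₁, ht₂, h1', hyS]
          · simp only [not_le.2 h, if_false, h.ne', false_or, not_lt.2 h.le, and_false, false_and,
              iff_false, not_and]
            exact fun hs => hn _ ⟨by linarith, by linarith [hs.2]⟩
        rw [this, encard_insert_of_notMem (by simp), hcard]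
        simp
    · rintro ⟨x, hx, t, ht, γ, hγ, h0, h1, hz, hcard⟩
      have hfin : {s ∈ Ioo 0 t | γ s ∈ S}.Finite := by
        rw [← encard_lt_top_iff, hcard]; exact ENat.natCast_lt_top _
      have hne : {s ∈ Ioo 0 t | γ s ∈ S}.Nonempty := by
        rw [← encard_ne_zero, hcard]; simp
      -- The last interior hit is the point to which the induction hypothesis applies; the final
      -- return starts from there.
      obtain ⟨t₁, ⟨ht₁, ht₁S⟩, hmax⟩ := Set.exists_max_image _ id hfin hne
      simp only [id] at hmax
      refine ⟨γ t₁, (ih _).2 ⟨x, hx, t₁, ht₁.1, γ, hγ.mono (Icc_subset_Icc_right ht₁.2.le), h0, rfl,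
        ht₁S, ?_⟩, t - t₁, by linarith [ht₁.2], fun s => γ (s + t₁),
        isIntegralCurveOn_shift t₁ hγ fun s hs => ⟨by linarith [hs.1, ht₁.1], by linarith [hs.2]⟩,
        by simp, by simp [h1], hz, fun s hs hS => ?_⟩
      · have : {s ∈ Ioo 0 t | γ s ∈ S} = insert t₁ {s ∈ Ioo 0 t₁ | γ s ∈ S} := by
          ext s
          simp only [mem_ofPred_eq, mem_insert_iff, mem_Ioo]
          constructor
          · intro hs
            rcases (hmax s hs).eq_or_lt with h | h
            · exact Or.inl h
            · exact Or.inr ⟨⟨hs.1.1, h⟩, hs.2⟩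
          · rintro (rfl | hs)
            · exact ⟨ht₁, ht₁S⟩
            · exact ⟨⟨hs.1.1, hs.1.2.trans ht₁.2⟩, hs.2⟩
        rw [this, encard_insert_of_notMem (by simp)] at hcard
        push_cast at hcard
        exact (ENat.add_left_injective_of_ne_top ENat.one_ne_top) hcard
      · have := hmax (s + t₁) ⟨⟨by linarith [hs.1, ht₁.1], by linarith [hs.2]⟩, hS⟩
        linarith [hs.1]

end Counting

/-! ### Zeros of concave functions and persistence of zeros under perturbation. -/

section Zeros

theorem neg_of_concave {h h' h'' : ℝ → ℝ} {ε : ℝ} (hd : ∀ s ∈ Icc 0 ε, HasDerivAt h (h' s) s)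
    (hd' : ∀ s ∈ Icc 0 ε, HasDerivAt h' (h'' s) s) (hneg : ∀ s ∈ Icc 0 ε, h'' s < 0)
    (h0 : h 0 = 0) (h0' : h' 0 ≤ 0) : ∀ s ∈ Ioc 0 ε, h s < 0 := by
  have ha : StrictAntiOn h' (Icc 0 ε) := by
    refine strictAntiOn_of_hasDerivWithinAt_neg (f' := h'') (convex_Icc _ _)
      (fun s hs => (hd' s hs).continuousAt.continuousWithinAt)
      (fun s hs => (hd' s (interior_subset hs)).hasDerivWithinAt)
      (fun s hs => hneg s (interior_subset hs))
  intro s hs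
  have hε : 0 ≤ ε := hs.1.le.trans hs.2
  have hb : StrictAntiOn h (Icc 0 ε) := by
    refine strictAntiOn_of_hasDerivWithinAt_neg (f' := h') (convex_Icc _ _)
      (fun s hs => (hd s hs).continuousAt.continuousWithinAt)
      (fun s hs => (hd s (interior_subset hs)).hasDerivWithinAt) (fun s hs => ?_)
    rw [interior_Icc] at hs
    exact (ha ⟨le_rfl, hε⟩ ⟨hs.1.le, hs.2.le⟩ hs.1).trans_le h0'
  rw [← h0]
  exact hb ⟨le_rfl, hε⟩ ⟨hs.1.le, hs.2⟩ hs.1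

/-- The positive initial slope makes `h` positive at first and the end value forces a return to
zero. Strict concavity fixes the sign on each side of the return, and Rolle's theorem with the
strict decrease of `h'` makes the slope there negative. -/
theorem exists_return_of_concave {h h' h'' : ℝ → ℝ} {ε : ℝ} (hε : 0 < ε)
    (hd : ∀ s ∈ Icc 0 ε, HasDerivAt h (h' s) s)
    (hd' : ∀ s ∈ Icc 0 ε, HasDerivAt h' (h'' s) s) (hneg : ∀ s ∈ Icc 0 ε, h'' s < 0)
    (h0 : h 0 = 0) (h0' : 0 < h' 0) (hend : h ε < 0) :
    ∃ τ ∈ Ioo 0 ε, h τ = 0 ∧ h' τ < 0 ∧ (∀ s ∈ Ioo 0 τ, 0 < h s) ∧ ∀ s ∈ Ioc τ ε, h s < 0 := by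
  have hc : ContinuousOn h (Icc 0 ε) := fun s hs => (hd s hs).continuousAt.continuousWithinAt
  have ha : StrictAntiOn h' (Icc 0 ε) :=
    strictAntiOn_of_hasDerivWithinAt_neg (f' := h'') (convex_Icc _ _)
      (fun s hs => (hd' s hs).continuousAt.continuousWithinAt)
      (fun s hs => (hd' s (interior_subset hs)).hasDerivWithinAt)
      (fun s hs => hneg s (interior_subset hs))
  have hconc : StrictConcaveOn ℝ (Icc 0 ε) h := by
    refine StrictAntiOn.strictConcaveOn_of_deriv (convex_Icc _ _) hc ?_
    intro x hx y hy hxy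
    rw [interior_Icc] at hx hy
    rw [(hd x (Ioo_subset_Icc_self hx)).deriv, (hd y (Ioo_subset_Icc_self hy)).deriv]
    exact ha (Ioo_subset_Icc_self hx) (Ioo_subset_Icc_self hy) hxy
  obtain ⟨s₀, hs₀, hs₀p⟩ : ∃ s ∈ Ioo 0 ε, 0 < h s := by
    have h1 := (hd 0 ⟨le_rfl, hε.le⟩).hasDerivWithinAt (s := Ioi 0)
    rw [hasDerivWithinAt_iff_tendsto_slope' (by simp)] at h1
    have h2 := h1.eventually (lt_mem_nhds h0')
    have h3 : ∀ᶠ s in 𝓝[>] (0 : ℝ), s ∈ Ioo 0 ε := Ioo_mem_nhdsGT hε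
    obtain ⟨s, hs, hs'⟩ := (h2.and h3).exists
    refine ⟨s, hs', ?_⟩
    rw [slope_def_field, h0, sub_zero, sub_zero] at hs
    exact (div_pos_iff_of_pos_right hs'.1).1 hs
  obtain ⟨τ, hτ, hτ0⟩ : ∃ τ ∈ Icc s₀ ε, h τ = 0 :=
    intermediate_value_Icc' hs₀.2.le (hc.mono (Icc_subset_Icc_left hs₀.1.le)) ⟨hend.le, hs₀p.le⟩
  have hτp : 0 < τ := hs₀.1.trans_le hτ.1
  have hτε : τ < ε := lt_of_le_of_ne hτ.2 (by rintro rfl; linarith)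
  refine ⟨τ, ⟨hτp, hτε⟩, hτ0, ?_, fun s hs => ?_, fun s hs => ?_⟩
  · obtain ⟨c, hc1, hc2⟩ := exists_hasDerivAt_eq_zero (f := h) (f' := h') hτp
      (hc.mono (Icc_subset_Icc_right hτε.le)) (by rw [h0, hτ0])
      (fun x hx => hd x ⟨hx.1.le, hx.2.le.trans hτε.le⟩)
    rw [← hc2]
    exact ha ⟨hc1.1.le, hc1.2.le.trans hτε.le⟩ ⟨hτp.le, hτε.le⟩ hc1.2
  · have := hconc.2 (left_mem_Icc.2 hε.le) ⟨hτp.le, hτε.le⟩ hτp.ne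
      (sub_pos.2 ((div_lt_one hτp).2 hs.2)) (div_pos hs.1 hτp) (sub_add_cancel _ _)
    simpa [h0, hτ0, hτp.ne'] using this
  · have hsp : 0 < s := hτp.trans hs.1
    have := hconc.2 (left_mem_Icc.2 hε.le) ⟨hsp.le, hs.2⟩ hsp.ne
      (sub_pos.2 ((div_lt_one hsp).2 hs.1)) (div_pos hτp hsp) (sub_add_cancel _ _)
    have h1 : τ / s * h s < 0 := by simpa [h0, hτ0, hsp.ne'] using this
    exact neg_of_mul_neg_right h1 (div_pos hτp hsp).le

variable {X : Type*} [TopologicalSpace X]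

theorem eventually_forall_ne_zero {G : X → ℝ → ℝ} (hG : Continuous fun z : X × ℝ => G z.1 z.2)
    {x₀ : X} {α β : ℝ} (h : ∀ t ∈ Icc α β, G x₀ t ≠ 0) :
    ∀ᶠ x in 𝓝 x₀, ∀ t ∈ Icc α β, G x t ≠ 0 :=
  isCompact_Icc.eventually_forall_of_forall_eventually fun t ht =>
    hG.continuousAt.eventually_ne (x := (x₀, t)) (h t ht)

/-- Where the time derivative keeps its sign near `(x₀, s)`, the functions `G x` are strictly
monotone on a common interval whose end values keep opposite signs. -/
theorem exists_unique_zero_near {G G' : X → ℝ → ℝ} (hG : Continuous fun z : X × ℝ => G z.1 z.2)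
    (hG' : Continuous fun z : X × ℝ => G' z.1 z.2) {x₀ : X} {α β s : ℝ}
    (hd : ∀ᶠ x in 𝓝 x₀, ∀ t ∈ Icc α β, HasDerivAt (G x) (G' x t) t) (hs : s ∈ Ioo α β)
    (h0 : G x₀ s = 0) (h1 : G' x₀ s ≠ 0) :
    ∃ ε > 0, Icc (s - ε) (s + ε) ⊆ Ioo α β ∧ G x₀ (s - ε) ≠ 0 ∧ G x₀ (s + ε) ≠ 0 ∧
      ∀ᶠ x in 𝓝 x₀, {t ∈ Ioo (s - ε) (s + ε) | G x t = 0}.encard = 1 := by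
  wlog hpos : 0 < G' x₀ s generalizing G G'
  · have := this (G := fun x t => -G x t) (G' := fun x t => -G' x t) hG.neg hG'.neg
      (hd.mono fun x hx t ht => (hx t ht).neg) (by simp [h0]) (by simpa using h1)
      (by
        rcases lt_or_gt_of_ne h1 with h | h
        · simpa using h
        · exact absurd h hpos)
    simpa using this
  have hev : ∀ᶠ z : X × ℝ in 𝓝 x₀ ×ˢ 𝓝 s, 0 < G' z.1 z.2 ∧ z.2 ∈ Ioo α β := by
    rw [← nhds_prod_eq]
    exact (hG'.continuousAt.eventually (lt_mem_nhds (a := 0) hpos)).and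
      (continuous_snd.continuousAt.eventually (Ioo_mem_nhds hs.1 hs.2))
  obtain ⟨P, hP, Q, hQ, hPQ⟩ := eventually_prod_iff.1 hev
  obtain ⟨δ, hδ, hδQ⟩ := Metric.eventually_nhds_iff.1 hQ
  have hε : ∀ t ∈ Icc (s - δ / 2) (s + δ / 2), Q t := fun t ht => hδQ (by
    rw [Real.dist_eq, abs_lt]; constructor <;> linarith [ht.1, ht.2])
  have hmono : ∀ x, P x → (∀ t ∈ Icc α β, HasDerivAt (G x) (G' x t) t) →
      StrictMonoOn (G x) (Icc (s - δ / 2) (s + δ / 2)) := by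
    intro x hx hdx
    have hsub : ∀ t ∈ Icc (s - δ / 2) (s + δ / 2), t ∈ Icc α β := fun t ht =>
      Ioo_subset_Icc_self (hPQ hx (hε t ht)).2
    exact strictMonoOn_of_hasDerivWithinAt_pos (f' := G' x) (convex_Icc _ _)
      (fun t ht => (hdx t (hsub t ht)).continuousAt.continuousWithinAt)
      (fun t ht => (hdx t (hsub t (interior_subset ht))).hasDerivWithinAt)
      (fun t ht => (hPQ hx (hε t (interior_subset ht))).1)
  have hm₀ := hmono x₀ hP.self_of_nhds hd.self_of_nhds
  have hs' : s ∈ Icc (s - δ / 2) (s + δ / 2) := ⟨by linarith, by linarith⟩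
  have hlneg : G x₀ (s - δ / 2) < 0 := by
    rw [← h0]; exact hm₀ ⟨le_rfl, by linarith⟩ hs' (by linarith)
  have hrpos : 0 < G x₀ (s + δ / 2) := by
    rw [← h0]; exact hm₀ hs' ⟨by linarith, le_rfl⟩ (by linarith)
  refine ⟨δ / 2, by positivity, fun t ht => (hPQ hP.self_of_nhds (hε t ht)).2, hlneg.ne, hrpos.ne',
    ?_⟩
  have hcx : ∀ t, Continuous fun x => G x t := fun t =>
    hG.comp (continuous_id.prodMk continuous_const)
  filter_upwards [hP, hd, (hcx (s - δ / 2)).continuousAt.eventually (gt_mem_nhds hlneg),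
    (hcx (s + δ / 2)).continuousAt.eventually (lt_mem_nhds hrpos)] with x hx hdx hl hr
  have hm := hmono x hx hdx
  have hct : Continuous (G x) := hG.comp (continuous_const.prodMk continuous_id)
  obtain ⟨t, ht, ht0⟩ := intermediate_value_Ioo (by linarith : s - δ / 2 ≤ s + δ / 2)
    hct.continuousOn ⟨hl, hr⟩
  rw [encard_eq_one]
  refine ⟨t, ?_⟩
  ext u
  simp only [mem_ofPred_eq, mem_singleton_iff]
  constructor
  · rintro ⟨hu, hu0⟩
    exact hm.injOn (Ioo_subset_Icc_self hu) (Ioo_subset_Icc_self ht) (hu0.trans ht0.symm)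
  · rintro rfl
    exact ⟨ht, ht0⟩

theorem encard_zeros_split {g : ℝ → ℝ} {α b c β : ℝ} (hb : α ≤ b) (hbc : b ≤ c) (hc : c ≤ β)
    (h1 : g b ≠ 0) (h2 : g c ≠ 0) :
    {t ∈ Ioo α β | g t = 0}.encard = {t ∈ Ioo α b | g t = 0}.encard +
      {t ∈ Ioo b c | g t = 0}.encard + {t ∈ Ioo c β | g t = 0}.encard := by
  rw [← encard_union_eq, ← encard_union_eq]
  · congr 1
    ext t
    simp only [mem_ofPred_eq, mem_union, mem_Ioo]
    constructor
    · rintro ⟨ht, h0⟩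
      rcases lt_trichotomy t b with h | h | h
      · exact Or.inl (Or.inl ⟨⟨ht.1, h⟩, h0⟩)
      · exact absurd (h ▸ h0) h1
      rcases lt_trichotomy t c with h' | h' | h'
      · exact Or.inl (Or.inr ⟨⟨h, h'⟩, h0⟩)
      · exact absurd (h' ▸ h0) h2
      · exact Or.inr ⟨⟨h', ht.2⟩, h0⟩
    · rintro ((⟨ht, h0⟩ | ⟨ht, h0⟩) | ⟨ht, h0⟩)
      · exact ⟨⟨ht.1, by linarith [ht.2]⟩, h0⟩
      · exact ⟨⟨by linarith [ht.1], by linarith [ht.2]⟩, h0⟩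
      · exact ⟨⟨by linarith [ht.1], ht.2⟩, h0⟩
  · rw [disjoint_left]
    rintro t (⟨ht, -⟩ | ⟨ht, -⟩) ⟨ht', -⟩ <;> linarith [ht.2, ht'.1]
  · rw [disjoint_left]
    rintro t ⟨ht, -⟩ ⟨ht', -⟩
    linarith [ht.2, ht'.1]

theorem eventually_encard_zeros_eq {G G' : X → ℝ → ℝ}
    (hG : Continuous fun z : X × ℝ => G z.1 z.2)
    (hG' : Continuous fun z : X × ℝ => G' z.1 z.2) {x₀ : X} {α β : ℝ} {n : ℕ}
    (hd : ∀ᶠ x in 𝓝 x₀, ∀ t ∈ Icc α β, HasDerivAt (G x) (G' x t) t) (hα : G x₀ α ≠ 0)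
    (hβ : G x₀ β ≠ 0) (htr : ∀ t ∈ Ioo α β, G x₀ t = 0 → G' x₀ t ≠ 0)
    (hn : {t ∈ Ioo α β | G x₀ t = 0}.encard = n) :
    ∀ᶠ x in 𝓝 x₀, {t ∈ Ioo α β | G x t = 0}.encard = n := by
  -- Isolating one transverse zero leaves two smaller counts, to the left and to the right of it,
  -- whose sizes are not known; hence strong induction.
  induction n using Nat.strong_induction_on generalizing α β with
  | _ n ih =>
    rcases n with _ | n
    · simp only [Nat.cast_zero, encard_eq_zero] at hn
      have hne : ∀ t ∈ Icc α β, G x₀ t ≠ 0 := by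
        intro t ht h0
        rcases ht.1.eq_or_lt with h | h
        · exact hα (h ▸ h0)
        rcases ht.2.eq_or_lt with h' | h'
        · exact hβ (h' ▸ h0)
        have : t ∈ {t ∈ Ioo α β | G x₀ t = 0} := ⟨⟨h, h'⟩, h0⟩
        rw [hn] at this
        exact this
      filter_upwards [eventually_forall_ne_zero hG hne] with x hx
      simp only [Nat.cast_zero, encard_eq_zero]
      ext t
      simp only [mem_ofPred_eq, mem_empty_iff_false, iff_false]
      exact fun ht => hx t (Ioo_subset_Icc_self ht.1) ht.2
    · obtain ⟨s, hs, hs0⟩ : {t ∈ Ioo α β | G x₀ t = 0}.Nonempty := by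
        rw [← encard_ne_zero, hn]; simp
      obtain ⟨ε, hε, hsub, hl, hr, hone⟩ :=
        exists_unique_zero_near hG hG' hd hs hs0 (htr s hs hs0)
      have hl' := hsub ⟨le_rfl, by linarith⟩
      have hr' := hsub ⟨by linarith, le_rfl⟩
      have hsplit := encard_zeros_split (g := G x₀) hl'.1.le (by linarith) hr'.2.le hl hr
      rw [hn, hone.self_of_nhds] at hsplit
      obtain ⟨m₁, hm₁⟩ : ∃ m : ℕ, {t ∈ Ioo α (s - ε) | G x₀ t = 0}.encard = m := by
        refine (ENat.ne_top_iff_exists.1 fun h => ?_).imp fun _ => Eq.symm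
        rw [h] at hsplit
        simp at hsplit
      obtain ⟨m₂, hm₂⟩ : ∃ m : ℕ, {t ∈ Ioo (s + ε) β | G x₀ t = 0}.encard = m := by
        refine (ENat.ne_top_iff_exists.1 fun h => ?_).imp fun _ => Eq.symm
        rw [h] at hsplit
        simp at hsplit
      rw [hm₁, hm₂] at hsplit
      have hsum : n + 1 = m₁ + 1 + m₂ := by exact_mod_cast hsplit
      have e1 := ih m₁ (by omega) (α := α) (β := s - ε)
        (hd.mono fun x hx t ht => hx t ⟨ht.1, ht.2.trans hl'.2.le⟩) hα hl
        (fun t ht => htr t ⟨ht.1, ht.2.trans hl'.2⟩) hm₁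
      have e2 := ih m₂ (by omega) (α := s + ε) (β := β)
        (hd.mono fun x hx t ht => hx t ⟨hr'.1.le.trans ht.1, ht.2⟩) hr hβ
        (fun t ht => htr t ⟨hr'.1.trans ht.1, ht.2⟩) hm₂
      have hcx : ∀ t, Continuous fun x => G x t := fun t =>
        hG.comp (continuous_id.prodMk continuous_const)
      filter_upwards [e1, e2, hone, (hcx (s - ε)).continuousAt.eventually_ne hl,
        (hcx (s + ε)).continuousAt.eventually_ne hr] with x h1 h2 h3 h4 h5
      rw [encard_zeros_split (g := G x) hl'.1.le (by linarith) hr'.2.le h4 h5, h1, h2, h3, hsum]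
      push_cast
      rfl

/-- A strict sign change between two times survives perturbation and forces a zero, so no
transversality is needed for this lower bound. -/
theorem eventually_le_encard_zeros {G : X → ℝ → ℝ} (hG : Continuous fun z : X × ℝ => G z.1 z.2)
    {x₀ : X} (hosc : ∀ A : ℝ, ∃ s t, A < s ∧ s < t ∧ G x₀ s * G x₀ t < 0) (n : ℕ) (α : ℝ) :
    ∃ β > α, ∀ᶠ x in 𝓝 x₀, (n : ℕ∞) ≤ {t ∈ Ioo α β | G x t = 0}.encard := by
  induction n with
  | zero => exact ⟨α + 1, by linarith, by simp⟩
  | succ n ih =>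
    obtain ⟨β, hβ, hev⟩ := ih
    obtain ⟨s, t, hs, hst, hneg⟩ := hosc β
    refine ⟨t, by linarith, ?_⟩
    have hcx : ∀ t, Continuous fun x => G x t := fun t =>
      hG.comp (continuous_id.prodMk continuous_const)
    filter_upwards [hev, ((hcx s).mul (hcx t)).continuousAt.eventually (gt_mem_nhds hneg)]
      with x hx hx'
    have hct : Continuous (G x) := hG.comp (continuous_const.prodMk continuous_id)
    obtain ⟨u, hu, hu0⟩ : ∃ u ∈ Ioo s t, G x u = 0 := by
      rcases mul_neg_iff.1 hx' with h | h
      · exact intermediate_value_Ioo' hst.le hct.continuousOn ⟨h.2, h.1⟩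
      · exact intermediate_value_Ioo hst.le hct.continuousOn h
    have hsub : insert u {t ∈ Ioo α β | G x t = 0} ⊆ {v ∈ Ioo α t | G x v = 0} := by
      rintro v (rfl | hv)
      · exact ⟨⟨by linarith [hu.1], hu.2⟩, hu0⟩
      · exact ⟨⟨hv.1.1, by linarith [hv.1.2]⟩, hv.2⟩
    refine le_trans ?_ (encard_le_encard hsub)
    rw [encard_insert_of_notMem fun h => by linarith [h.1.2, hu.1]]
    push_cast
    gcongr

end Zeros

/-! ### The local unstable manifold and its linear part. -/

section LocalUnstable

variable {η : ℝ} {U : Set Phase} {V : Set (ℝ × ℝ)} {a b : ℝ × ℝ → ℝ}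

theorem localUnstable_of_nonpos {γ : ℝ → Phase}
    (hγ : IsIntegralCurveOn γ (fun _ => field η) (Iic 0)) (hU : ∀ t ≤ 0, γ t ∈ U)
    (hlim : Tendsto γ atBot (𝓝 0)) {t : ℝ} (ht : t ≤ 0) : γ t ∈ localUnstable η U :=
  ⟨fun s => γ (s + t), isIntegralCurveOn_shift t hγ fun s hs => add_nonpos hs ht, by simp,
    fun s hs => hU _ (add_nonpos hs ht), hlim.comp (tendsto_atBot_add_const_right _ t tendsto_id)⟩

/-- Only the portion before time `-T` is known to stay in `U`; the remainder follows `γ`, which may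
leave `U`. -/
theorem localUnstable_extend {x : Phase} (hx : x ∈ localUnstable η U) {γ : ℝ → Phase} {T : ℝ}
    (hT : 0 ≤ T) (hγ : IsIntegralCurveOn γ (fun _ => field η) (Icc 0 T)) (h0 : γ 0 = x) :
    ∃ δ : ℝ → Phase, IsIntegralCurveOn δ (fun _ => field η) (Iic 0) ∧ δ 0 = γ T ∧
      Tendsto δ atBot (𝓝 0) ∧ (∀ t ≤ -T, δ t ∈ U) ∧ ∀ t ∈ Icc (-T) 0, δ t = γ (t + T) := by
  obtain ⟨β, hβ, hβ0, hβU, hβl⟩ := hx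
  have hglue : ∀ t ∈ Icc (-T) 0, (if t ≤ -T then β (t + T) else γ (t + T)) = γ (t + T) := by
    intro t ht
    rcases ht.1.eq_or_lt with h | h
    · simp [← h, hβ0, h0]
    · simp [not_le.2 h]
  refine ⟨fun t => if t ≤ -T then β (t + T) else γ (t + T), ?_, ?_, ?_, ?_, hglue⟩
  · refine isIntegralCurveOn_glue (γ := fun t => β (t + T)) (γ' := fun t => γ (t + T))
      (isIntegralCurveOn_shift T hβ fun t ht => ?_) (isIntegralCurveOn_shift T hγ fun t ht => ?_) ?_
    · have := mem_Iic.1 ht.2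
      exact mem_Iic.2 (by linarith)
    · have := mem_Ici.1 ht.2
      have := mem_Iic.1 ht.1
      exact ⟨by linarith, by linarith⟩
    · simp [hβ0, h0]
  · simpa using hglue 0 ⟨by linarith, le_rfl⟩
  · have h1 : Tendsto (fun t => β (t + T)) atBot (𝓝 0) :=
      hβl.comp (tendsto_atBot_add_const_right _ T tendsto_id)
    refine h1.congr' ?_
    filter_upwards [Iic_mem_atBot (-T)] with t ht
    exact (if_pos ht).symm
  · intro t ht
    simp only [ht, if_true]
    exact hβU _ (by linarith)

theorem localUnstable_forward {x : Phase} (hx : x ∈ localUnstable η U) {γ : ℝ → Phase} {T : ℝ}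
    (hT : 0 ≤ T) (hγ : IsIntegralCurveOn γ (fun _ => field η) (Icc 0 T)) (h0 : γ 0 = x)
    (hU : ∀ t ∈ Icc 0 T, γ t ∈ U) : γ T ∈ localUnstable η U := by
  obtain ⟨δ, hδ, hδ0, hl, hU1, hU2⟩ := localUnstable_extend hx hT hγ h0
  refine ⟨δ, hδ, hδ0, fun t ht => ?_, hl⟩
  rcases le_total t (-T) with h | h
  · exact hU1 t h
  · rw [hU2 t ⟨h, ht⟩]
    exact hU _ ⟨by linarith, by linarith⟩

theorem localUnstable_backward {x : Phase} (hx : x ∈ localUnstable η U) {γ : ℝ → Phase} {T : ℝ}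
    (hT : 0 ≤ T) (hγ : IsIntegralCurveOn γ (fun _ => field η) (Icc (-T) 0)) (h0 : γ 0 = x) :
    γ (-T) ∈ localUnstable η U := by
  obtain ⟨β, hβ, hβ0, hβU, hβl⟩ := hx
  have hT' : -T ≤ 0 := by linarith
  rw [curve_unique (field_contDiff η).locallyLipschitz hγ (hβ.mono Icc_subset_Iic_self)
    (right_mem_Icc.2 hT') (h0.trans hβ0.symm) (left_mem_Icc.2 hT')]
  exact localUnstable_of_nonpos hβ hβU hβl hT'

theorem H_eq_zero_of_tendsto {γ : ℝ → Phase}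
    (hγ : IsIntegralCurveOn γ (fun _ => field η) (Iic 0)) (hlim : Tendsto γ atBot (𝓝 0)) :
    H η (γ 0) = 0 := by
  have h1 : Tendsto (fun t => H η (γ t)) atBot (𝓝 (H η 0)) :=
    ((continuous_H η).tendsto 0).comp hlim
  have h2 : Tendsto (fun t => H η (γ t)) atBot (𝓝 (H η (γ 0))) := by
    refine tendsto_const_nhds.congr' ?_
    filter_upwards [Iic_mem_atBot 0] with t ht
    exact (H_eq_of_curve ht (hγ.mono Icc_subset_Iic_self)).symm
  rw [tendsto_nhds_unique h2 h1]
  simp [H]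

theorem field_zero : field η 0 = 0 := by
  ext i
  fin_cases i <;> simp [field]

theorem isIntegralCurveOn_zero (s : Set ℝ) :
    IsIntegralCurveOn (fun _ => (0 : Phase)) (fun _ => field η) s := fun t _ => by
  simpa only [field_zero] using hasDerivWithinAt_const t s (0 : Phase)

theorem IsLocalUnstableGraph.mem_iff (hW : IsLocalUnstableGraph η U V a b) {x : Phase} :
    x ∈ localUnstable η U ↔ (x 0, x 1) ∈ V ∧ x 2 = a (x 0, x 1) ∧ x 3 = b (x 0, x 1) := by
  rw [hW.eq_graph]
  rfl

theorem IsLocalUnstableGraph.graph_mem (hW : IsLocalUnstableGraph η U V a b) {z : ℝ × ℝ}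
    (hz : z ∈ V) : ![z.1, z.2, a z, b z] ∈ localUnstable η U := by
  rw [hW.mem_iff]
  simpa using hz

theorem IsLocalUnstableGraph.eq_graph_point (hW : IsLocalUnstableGraph η U V a b) {x : Phase}
    (hx : x ∈ localUnstable η U) : x = ![x 0, x 1, a (x 0, x 1), b (x 0, x 1)] := by
  obtain ⟨-, h2, h3⟩ := hW.mem_iff.1 hx
  ext i
  fin_cases i
  · rfl
  · rfl
  · exact h2
  · exact h3

theorem IsLocalUnstableGraph.map_zero (hW : IsLocalUnstableGraph η U V a b) :
    (0 : ℝ × ℝ) ∈ V ∧ a 0 = 0 ∧ b 0 = 0 := by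
  have : (0 : Phase) ∈ localUnstable η U :=
    ⟨fun _ => 0, isIntegralCurveOn_zero _, rfl, fun _ _ => hW.zero_mem_nhd, tendsto_const_nhds⟩
  obtain ⟨h1, h2, h3⟩ := hW.mem_iff.1 this
  exact ⟨h1, h2.symm, h3.symm⟩

/-- Through every point of the graph runs a backward solution inside the graph; the one-sided
derivatives of x₃ = a and x₄ = b at time 0 must agree with the field. -/
theorem IsLocalUnstableGraph.invariance (hW : IsLocalUnstableGraph η U V a b) {z : ℝ × ℝ}
    (hz : z ∈ V) : fderiv ℝ a z (z.2, a z) = b z ∧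
      fderiv ℝ b z (z.2, a z) = -z.1 + η * a z + z.1 ^ 2 := by
  obtain ⟨γ, hγ, h0, hU, hl⟩ := hW.graph_mem hz
  have hγW : ∀ t ∈ Iic (0 : ℝ), γ t ∈ localUnstable η U := fun t ht =>
    localUnstable_of_nonpos hγ hU hl ht
  have hd := hasDerivWithinAt_pi.1 (hγ 0 self_mem_Iic)
  have d0 := hd 0
  have d1 := hd 1
  have d2 := hd 2
  have d3 := hd 3
  simp only [field, h0, Matrix.cons_val] at d0 d1 d2 d3
  have hz0 : (γ 0 0, γ 0 1) = z := by simp [h0]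
  have key : ∀ f : ℝ × ℝ → ℝ, DifferentiableAt ℝ f z → ∀ i : Fin 4, ∀ c : ℝ,
      (∀ t ∈ Iic (0 : ℝ), γ t i = f (γ t 0, γ t 1)) →
      HasDerivWithinAt (fun t => γ t i) c (Iic 0) 0 → fderiv ℝ f z (z.2, a z) = c := by
    intro f hf i c hfi hc
    have h1 : HasDerivWithinAt (fun t => (γ t 0, γ t 1)) (z.2, a z) (Iic 0) 0 := d0.prodMk d1
    have h2 : HasDerivWithinAt (fun t => f (γ t 0, γ t 1)) (fderiv ℝ f z (z.2, a z)) (Iic 0) 0 :=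
      HasFDerivAt.comp_hasDerivWithinAt (f := fun t => (γ t 0, γ t 1)) 0
        (by rw [hz0]; exact hf.hasFDerivAt) h1
    have h3 := h2.congr_of_mem hfi self_mem_Iic
    exact (uniqueDiffWithinAt_Iic 0).eq_deriv _ h3 hc
  exact ⟨key a (hW.analytic_a z hz).differentiableAt 2 _
      (fun t ht => (hW.mem_iff.1 (hγW t ht)).2.1) d2,
    key b (hW.analytic_b z hz).differentiableAt 3 _
      (fun t ht => (hW.mem_iff.1 (hγW t ht)).2.2) d3⟩

/-- The linear part of the local unstable manifold. -/
theorem IsLocalUnstableGraph.exists_linear_part (hW : IsLocalUnstableGraph η U V a b)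
    (hη : -2 < η) (hη' : η < 2) : ∃ β : ℝ, β ^ 2 = η + 2 ∧ ∀ z : ℝ × ℝ, fderiv ℝ a 0 z = -z.1 + β * z.2 := by
  obtain ⟨h0, ha0, hb0⟩ := hW.map_zero
  have hVn : V ∈ 𝓝 (0 : ℝ × ℝ) := hW.isOpen_base.mem_nhds h0
  have ha := hW.analytic_a 0 h0
  have hb := hW.analytic_b 0 h0
  have hg : HasFDerivAt (fun z : ℝ × ℝ => (z.2, a z))
      ((ContinuousLinearMap.snd ℝ ℝ ℝ).prod (fderiv ℝ a 0)) 0 :=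
    hasFDerivAt_snd.prodMk ha.differentiableAt.hasFDerivAt
  have key : ∀ f : ℝ × ℝ → ℝ, AnalyticAt ℝ f 0 → ∀ z : ℝ × ℝ,
      fderiv ℝ (fun w : ℝ × ℝ => fderiv ℝ f w (w.2, a w)) 0 z =
        fderiv ℝ f 0 (z.2, fderiv ℝ a 0 z) := by
    intro f hf z
    have h1 := hf.fderiv.differentiableAt.hasFDerivAt.clm_apply hg
    rw [h1.fderiv]
    simp only [ha0, Prod.snd_zero, Prod.mk_zero_zero, _root_.map_zero, add_zero]
    rfl
  have e1 : ∀ z, fderiv ℝ a 0 (z.2, fderiv ℝ a 0 z) = fderiv ℝ b 0 z := by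
    intro z
    rw [← key a ha z]
    congr 1
    exact Filter.EventuallyEq.fderiv_eq
      (by filter_upwards [hVn] with w hw; exact (hW.invariance hw).1)
  have e2 : ∀ z : ℝ × ℝ, fderiv ℝ b 0 (z.2, fderiv ℝ a 0 z) = -z.1 + η * fderiv ℝ a 0 z := by
    intro z
    rw [← key b hb z]
    have h1 : (fun w : ℝ × ℝ => fderiv ℝ b w (w.2, a w)) =ᶠ[𝓝 0]
        fun w => -w.1 + η * a w + w.1 ^ 2 := by
      filter_upwards [hVn] with w hw
      exact (hW.invariance hw).2
    have h2 : HasFDerivAt (fun w : ℝ × ℝ => -w.1 + η * a w + w.1 ^ 2) _ 0 :=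
      ((hasFDerivAt_fst (𝕜 := ℝ) (p := (0 : ℝ × ℝ))).neg.add
        (ha.differentiableAt.hasFDerivAt.const_mul η)).add
        ((hasFDerivAt_fst (𝕜 := ℝ) (p := (0 : ℝ × ℝ))).pow 2)
    rw [h1.fderiv_eq, h2.fderiv]
    simp
  have hlin : ∀ (L : ℝ × ℝ →L[ℝ] ℝ) (z : ℝ × ℝ), L z = L (1, 0) * z.1 + L (0, 1) * z.2 := by
    intro L z
    have : z = z.1 • ((1 : ℝ), (0 : ℝ)) + z.2 • ((0 : ℝ), (1 : ℝ)) := by ext <;> simp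
    conv_lhs => rw [this, L.map_add, L.map_smul, L.map_smul]
    simp [mul_comm]
  obtain ⟨A, β, hA⟩ : ∃ A β : ℝ, ∀ z : ℝ × ℝ, fderiv ℝ a 0 z = A * z.1 + β * z.2 :=
    ⟨_, _, hlin _⟩
  obtain ⟨B, D, hB⟩ : ∃ B D : ℝ, ∀ z : ℝ × ℝ, fderiv ℝ b 0 z = B * z.1 + D * z.2 :=
    ⟨_, _, hlin _⟩
  simp only [hA, hB] at e1 e2
  have q1 : β * A = B := by linarith [e1 (1, 0)]
  have q2 : A + β * β = D := by linarith [e1 (0, 1)]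
  have q3 : D * A = -1 + η * A := by linarith [e2 (1, 0)]
  have q4 : B + D * β = η * β := by linarith [e2 (0, 1)]
  subst q1 q2
  have h1 : β * (2 * A + β ^ 2 - η) = 0 := by linear_combination q4
  -- The linearization has characteristic polynomial λ⁴ - ηλ² + 1 = (λ² - βλ + 1)(λ² + βλ + 1) with
  -- β² = η + 2. The remaining invariant planes would need a real root of A² - ηA + 1 or β² = η - 2,
  -- both excluded by |η| < 2.
  rcases mul_eq_zero.1 h1 with h | h
  · exfalso
    subst h
    have : A ^ 2 - η * A + 1 = 0 := by linear_combination q3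
    nlinarith [sq_nonneg (2 * A - η), mul_pos (sub_pos.2 hη') (by linarith : 0 < η + 2)]
  · have hA' : A = (η - β ^ 2) / 2 := by linarith
    have h2 : (β ^ 2 - η - 2) * (β ^ 2 - η + 2) = 0 := by
      rw [hA'] at q3
      linear_combination (-4) * q3
    rcases mul_eq_zero.1 h2 with h3 | h3
    · refine ⟨β, by linarith, fun z => ?_⟩
      rw [hA z, hA']
      linear_combination (-z.1 / 2) * h3
    · nlinarith [sq_nonneg β]

/-- Near the origin the flow on the local unstable manifold rotates and expands. -/
theorem IsLocalUnstableGraph.exists_focus (hW : IsLocalUnstableGraph η U V a b) (hη : -2 < η)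
    (hη' : η < 2) : ∃ β κ : ℝ, β ≠ 0 ∧ 0 < κ ∧
      (∀ z : ℝ × ℝ, κ * (z.1 ^ 2 + z.2 ^ 2) ≤ z.1 ^ 2 - β * z.1 * z.2 + z.2 ^ 2) ∧
      ∀ᶠ z in 𝓝 (0 : ℝ × ℝ), z.1 * a z - z.2 ^ 2 ≤ -κ * (z.1 ^ 2 + z.2 ^ 2) ∧
        0 ≤ β * (2 * z.1 * z.2 - β * (z.2 ^ 2 + z.1 * a z) + 2 * z.2 * a z) := by
  obtain ⟨β, hβ, hlin⟩ := hW.exists_linear_part hη hη'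
  obtain ⟨h0, ha0, -⟩ := hW.map_zero
  have hβ0 : β ≠ 0 := by rintro rfl; norm_num at hβ; linarith
  have hβp : 0 < |β| := abs_pos.2 hβ0
  have hβ2 : |β| < 2 := by
    rw [← sq_lt_sq₀ (abs_nonneg β) (by norm_num), sq_abs]; linarith
  have hquad : ∀ z : ℝ × ℝ,
      (1 - |β| / 2) * (z.1 ^ 2 + z.2 ^ 2) ≤ z.1 ^ 2 - β * z.1 * z.2 + z.2 ^ 2 := by
    intro z
    have : β * (z.1 * z.2) ≤ |β| * (|z.1| * |z.2|) := by
      rw [← abs_mul, ← abs_mul]; exact le_abs_self _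
    nlinarith [sq_nonneg (|z.1| - |z.2|), sq_abs z.1, sq_abs z.2]
  -- Half of the least eigenvalue of the quadratic form; the other half absorbs the nonlinear
  -- remainder of `a`.
  set κ := (1 - |β| / 2) / 2 with hκ
  have hκp : 0 < κ := by rw [hκ]; linarith
  refine ⟨β, κ, hβ0, hκp, fun z => ?_, ?_⟩
  · nlinarith [hquad z, sq_nonneg z.1, sq_nonneg z.2]
  set ε := min κ (|β| * κ / 4) with hε
  have hεp : 0 < ε := lt_min hκp (by positivity)
  have hd := (hW.analytic_a 0 h0).differentiableAt.hasFDerivAt.isLittleO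
  filter_upwards [Asymptotics.isLittleO_iff.1 hd hεp] with z hz
  simp only [ha0, sub_zero, hlin, Real.norm_eq_abs] at hz
  -- With `e = 0` the angular expression equals minus the quadratic form Q, and Q' = βQ along the
  -- flow; `e` enters both only as a small multiple of the squared radius.
  obtain ⟨e, he⟩ : ∃ e, a z = -z.1 + β * z.2 + e := ⟨a z - (-z.1 + β * z.2), by ring⟩
  rw [he] at hz ⊢
  have hz' : |e| ≤ ε * ‖z‖ := by simpa using hz
  have hn1 : |z.1| ≤ ‖z‖ := norm_fst_le z
  have hn2 : |z.2| ≤ ‖z‖ := norm_snd_le z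
  have hn : ‖z‖ ^ 2 ≤ z.1 ^ 2 + z.2 ^ 2 := by
    rw [Prod.norm_def]
    rcases max_choice ‖z.1‖ ‖z.2‖ with h | h <;> rw [h, Real.norm_eq_abs, sq_abs] <;>
      nlinarith [sq_nonneg z.1, sq_nonneg z.2]
  have hnn := norm_nonneg z
  have h1 : |e| * |z.1| ≤ ε * (z.1 ^ 2 + z.2 ^ 2) := by
    calc |e| * |z.1| ≤ (ε * ‖z‖) * ‖z‖ := by gcongr
      _ = ε * ‖z‖ ^ 2 := by ring
      _ ≤ _ := by gcongr
  have h2 : |e| * |z.2| ≤ ε * (z.1 ^ 2 + z.2 ^ 2) := by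
    calc |e| * |z.2| ≤ (ε * ‖z‖) * ‖z‖ := by gcongr
      _ = ε * ‖z‖ ^ 2 := by ring
      _ ≤ _ := by gcongr
  have hρ : 0 ≤ z.1 ^ 2 + z.2 ^ 2 := by positivity
  constructor
  · have h3 : e * z.1 ≤ |e| * |z.1| := by rw [← abs_mul]; exact le_abs_self _
    have h4 : ε * (z.1 ^ 2 + z.2 ^ 2) ≤ κ * (z.1 ^ 2 + z.2 ^ 2) := by
      gcongr; exact min_le_left _ _
    have := hquad z
    rw [hκ] at h4 ⊢
    nlinarith
  · have h3 : ε * (z.1 ^ 2 + z.2 ^ 2) ≤ |β| * κ / 4 * (z.1 ^ 2 + z.2 ^ 2) := by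
      gcongr; exact min_le_right _ _
    have h5 : |β * (e * (2 * z.2 - β * z.1))| ≤ β ^ 2 * κ * (z.1 ^ 2 + z.2 ^ 2) * 2 := by
      have h6 : |2 * z.2 - β * z.1| ≤ 2 * |z.2| + 2 * |z.1| := by
        calc |2 * z.2 - β * z.1| ≤ |2 * z.2| + |β * z.1| := abs_sub _ _
          _ = 2 * |z.2| + |β| * |z.1| := by rw [abs_mul, abs_mul, abs_two]
          _ ≤ _ := by gcongr
      have h7 : |e| * |2 * z.2 - β * z.1| ≤ |β| * κ * (z.1 ^ 2 + z.2 ^ 2) := by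
        calc |e| * |2 * z.2 - β * z.1| ≤ |e| * (2 * |z.2| + 2 * |z.1|) := by gcongr
          _ ≤ 4 * (|β| * κ / 4 * (z.1 ^ 2 + z.2 ^ 2)) := by linarith
          _ = _ := by ring
      rw [abs_mul, abs_mul]
      calc |β| * (|e| * |2 * z.2 - β * z.1|) ≤ |β| * (|β| * κ * (z.1 ^ 2 + z.2 ^ 2)) := by gcongr
        _ = β ^ 2 * κ * (z.1 ^ 2 + z.2 ^ 2) := by rw [← sq_abs β]; ring
        _ ≤ _ := by linarith [show 0 ≤ β ^ 2 * κ * (z.1 ^ 2 + z.2 ^ 2) by positivity]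
    have h8 := (abs_le.1 h5).1
    have h9 : β ^ 2 * (2 * κ * (z.1 ^ 2 + z.2 ^ 2)) ≤
        β ^ 2 * (z.1 ^ 2 - β * z.1 * z.2 + z.2 ^ 2) := by
      gcongr
      calc _ = (1 - |β| / 2) * (z.1 ^ 2 + z.2 ^ 2) := by rw [hκ]; ring
        _ ≤ _ := hquad z
    have e1 : β * (2 * z.1 * z.2 - β * (z.2 ^ 2 + z.1 * (-z.1 + β * z.2 + e)) +
        2 * z.2 * (-z.1 + β * z.2 + e)) = β ^ 2 * (z.1 ^ 2 - β * z.1 * z.2 + z.2 ^ 2) +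
        β * (e * (2 * z.2 - β * z.1)) := by ring
    rw [e1]
    linarith

end LocalUnstable

/-! ### Expansion and rotation on the local unstable manifold. -/

section Dynamics

variable {η : ℝ} {U : Set Phase} {V : Set (ℝ × ℝ)} {a b : ℝ × ℝ → ℝ}

theorem eq_zero_of_curve {γ : ℝ → Phase} {α β t₀ t : ℝ}
    (hγ : IsIntegralCurveOn γ (fun _ => field η) (Icc α β)) (ht₀ : t₀ ∈ Icc α β)
    (h0 : γ t₀ = 0) (ht : t ∈ Icc α β) : γ t = 0 :=
  curve_unique (field_contDiff η).locallyLipschitz hγ (isIntegralCurveOn_zero _) ht₀ h0 ht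

theorem IsLocalUnstableGraph.eq_zero (hW : IsLocalUnstableGraph η U V a b) {x : Phase}
    (hx : x ∈ localUnstable η U) (h0 : x 0 = 0) (h1 : x 1 = 0) : x = 0 := by
  obtain ⟨-, ha0, hb0⟩ := hW.map_zero
  rw [hW.eq_graph_point hx, h0, h1, show ((0 : ℝ), (0 : ℝ)) = 0 from rfl, ha0, hb0]
  ext i
  fin_cases i <;> rfl

/-- The quadratic form that grows along the flow on the local unstable manifold. -/
def quadForm (β : ℝ) (x : Phase) : ℝ := x 0 ^ 2 - β * x 0 * x 1 + x 1 ^ 2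

theorem continuous_quadForm (β : ℝ) : Continuous (quadForm β) := by
  unfold quadForm
  fun_prop

theorem IsLocalUnstableGraph.hasDerivWithinAt_quadForm (hW : IsLocalUnstableGraph η U V a b)
    (β : ℝ) {γ : ℝ → Phase} {s : Set ℝ} {t : ℝ} (h : HasDerivWithinAt γ (field η (γ t)) s t)
    (hx : γ t ∈ localUnstable η U) :
    HasDerivWithinAt (fun u => quadForm β (γ u)) (2 * γ t 0 * γ t 1 -
      β * (γ t 1 ^ 2 + γ t 0 * a (γ t 0, γ t 1)) + 2 * γ t 1 * a (γ t 0, γ t 1)) s t := by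
  have hi := hasDerivWithinAt_pi.1 h
  have h0 := hi 0
  have h1 := hi 1
  simp only [field, Matrix.cons_val] at h0 h1
  rw [(hW.mem_iff.1 hx).2.1] at h1
  have := ((h0.pow 2).sub ((h0.const_mul β).mul h1)).add (h1.pow 2)
  convert! this using 1
  norm_num
  ring

/-- Expansion on the local unstable manifold. -/
theorem IsLocalUnstableGraph.exists_expansion (hW : IsLocalUnstableGraph η U V a b)
    (hη : -2 < η) (hη' : η < 2) {x : Phase} (hx : x ∈ localUnstable η U) (hx0 : x ≠ 0) :
    ∃ β κ ε : ℝ, 0 < κ ∧ 0 < ε ∧ (∀ y, κ * (y 0 ^ 2 + y 1 ^ 2) ≤ quadForm β y) ∧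
      ∀ y ∈ localUnstable η U, quadForm β y < ε → 0 ≤ 2 * y 0 * y 1 -
      β * (y 1 ^ 2 + y 0 * a (y 0, y 1)) + 2 * y 1 * a (y 0, y 1) := by
  obtain ⟨β, κ, hβ, hκ, hquad, hev⟩ := hW.exists_focus hη hη'
  obtain ⟨δ, hδ, hδn⟩ := Metric.eventually_nhds_iff.1 hev
  have hsmall : ∀ y : Phase, quadForm β y < κ * δ ^ 2 → dist ((y 0, y 1) : ℝ × ℝ) 0 < δ := by
    intro y hy
    have h1 : y 0 ^ 2 + y 1 ^ 2 < δ ^ 2 :=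
      lt_of_mul_lt_mul_left ((hquad (y 0, y 1)).trans_lt hy) hκ.le
    rw [dist_zero_right, Prod.norm_def, max_lt_iff, Real.norm_eq_abs, Real.norm_eq_abs]
    constructor <;> apply abs_lt_of_sq_lt_sq _ hδ.le <;> nlinarith [sq_nonneg (y 0), sq_nonneg (y 1)]
  -- Invariance alone does not fix the sign of β, as the stable plane satisfies the same equations.
  -- If β < 0, the form would not increase along a backward orbit that tends to 0, so it would be
  -- nonpositive, and the orbit would be the equilibrium.
  have hpos : 0 < β := by
    by_contra hneg
    have hβ0 : β < 0 := lt_of_le_of_ne (not_lt.1 hneg) hβ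
    obtain ⟨γ, hγ, h0, hU, hl⟩ := hx
    have hγW : ∀ t ≤ 0, γ t ∈ localUnstable η U := fun t ht =>
      localUnstable_of_nonpos hγ hU hl ht
    have hQl : Tendsto (fun t => quadForm β (γ t)) atBot (𝓝 0) := by
      have := ((continuous_quadForm β).tendsto 0).comp hl
      simpa [quadForm, Function.comp_def] using this
    obtain ⟨T, hT⟩ := eventually_atBot.1
      ((hQl.eventually (gt_mem_nhds (show 0 < κ * δ ^ 2 by positivity))).and (Iic_mem_atBot 0))
    have hin : ∀ {t}, t ∈ interior (Iic T) → t ≤ T := fun ht => mem_Iic.1 (interior_subset ht)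
    have hanti : AntitoneOn (fun t => quadForm β (γ t)) (Iic T) := by
      refine antitoneOn_of_hasDerivWithinAt_nonpos (convex_Iic T) (fun t ht => ?_) (fun t ht =>
        hW.hasDerivWithinAt_quadForm β ((hγ t (hT t (hin ht)).2).mono ?_)
          (hγW t (hT t (hin ht)).2)) (fun t ht => ?_)
      · exact ((continuous_quadForm β).continuousAt.comp_continuousWithinAt
          (hγ t (hT t ht).2).continuousWithinAt).mono fun u hu => (hT u hu).2
      · exact fun u hu => (hT u (hin hu)).2
      · have := (hδn (hsmall (γ t) (hT t (hin ht)).1)).2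
        exact nonpos_of_mul_nonneg_right this hβ0
    have hle : quadForm β (γ T) ≤ 0 := by
      refine ge_of_tendsto hQl ?_
      filter_upwards [Iic_mem_atBot T] with t ht
      exact hanti ht self_mem_Iic ht
    have h2 := hquad (γ T 0, γ T 1)
    have h3 : γ T 0 ^ 2 + γ T 1 ^ 2 ≤ 0 := nonpos_of_mul_nonpos_right (h2.trans hle) hκ
    have hT0 : T ≤ 0 := (hT T le_rfl).2
    have h4 : γ T = 0 := hW.eq_zero (hγW T hT0)
      (by nlinarith [sq_nonneg (γ T 0), sq_nonneg (γ T 1)])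
      (by nlinarith [sq_nonneg (γ T 0), sq_nonneg (γ T 1)])
    exact hx0 (h0 ▸ eq_zero_of_curve (hγ.mono Icc_subset_Iic_self) (left_mem_Icc.2 hT0) h4
      (right_mem_Icc.2 hT0))
  refine ⟨β, κ, κ * δ ^ 2, hκ, by positivity, fun y => hquad (y 0, y 1), fun y _ hy => ?_⟩
  exact nonneg_of_mul_nonneg_right (hδn (hsmall y hy)).2 hpos

/-- A forward orbit cannot stay in a compact part of the local unstable manifold. -/
theorem IsLocalUnstableGraph.not_trapped (hW : IsLocalUnstableGraph η U V a b)
    (hη : -2 < η) (hη' : η < 2) {R : ℝ} {Φ : ℝ → Phase → Phase} (hΦ : CutoffFlow η R Φ)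
    {G : Set Phase} (hG : IsCompact G) (hGW : G ⊆ localUnstable η U)
    (hGR : G ⊆ Metric.ball 0 R) {x : Phase} (hx0 : x ≠ 0) (hx : ∀ t, 0 ≤ t → Φ t x ∈ G) :
    False := by
  have hxG : x ∈ G := by simpa [hΦ.zero] using hx 0 le_rfl
  obtain ⟨β, κ, ε, hκ, hε, hquad, hexp⟩ := hW.exists_expansion hη hη' (hGW hxG) hx0
  have hxp : 0 < quadForm β x := by
    refine lt_of_lt_of_le (mul_pos hκ ?_) (hquad x)
    by_contra hle
    exact hx0 (hW.eq_zero (hGW hxG) (by nlinarith [sq_nonneg (x 0), sq_nonneg (x 1)])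
      (by nlinarith [sq_nonneg (x 0), sq_nonneg (x 1)]))
  set m := min (quadForm β x) ε with hm
  have hmp : 0 < m := lt_min hxp hε
  have hQc : Continuous fun t => quadForm β (Φ t x) :=
    (continuous_quadForm β).comp (hΦ.continuous_time x)
  have hder : ∀ t, 0 ≤ t → HasDerivAt (fun s => Φ s x) (field η (Φ t x)) t := fun t ht =>
    hΦ.deriv x t (hGR (hx t ht))
  -- After the last time at which the form is at least `m` it lies below `ε`, where it cannot
  -- decrease.
  have hlow : ∀ t, 0 ≤ t → m ≤ quadForm β (Φ t x) := by
    intro t ht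
    by_contra hlt
    rw [not_le] at hlt
    set A := {s ∈ Icc 0 t | m ≤ quadForm β (Φ s x)} with hA
    have hAc : IsCompact A := isCompact_Icc.inter_right (isClosed_le continuous_const hQc)
    have hAne : A.Nonempty := ⟨0, ⟨le_rfl, ht⟩, by rw [hΦ.zero]; exact min_le_left _ _⟩
    obtain ⟨s, hs⟩ := hAc.exists_isGreatest hAne
    have hmono : MonotoneOn (fun u => quadForm β (Φ u x)) (Icc s t) := by
      refine monotoneOn_of_hasDerivWithinAt_nonneg (convex_Icc s t) hQc.continuousOn
        (fun u hu => hW.hasDerivWithinAt_quadForm β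
          (hder u (hs.1.1.1.trans (interior_subset hu).1)).hasDerivWithinAt
          (hGW (hx u (hs.1.1.1.trans (interior_subset hu).1)))) (fun u hu => ?_)
      rw [interior_Icc] at hu
      refine hexp _ (hGW (hx u (hs.1.1.1.trans hu.1.le))) ?_
      by_contra hge
      have : u ∈ A := ⟨⟨hs.1.1.1.trans hu.1.le, hu.2.le⟩, (min_le_right _ _).trans (not_lt.1 hge)⟩
      exact (hs.2 this).not_gt hu.1
    have := hmono (left_mem_Icc.2 hs.1.1.2) (right_mem_Icc.2 hs.1.1.2) hs.1.1.2
    exact absurd (hs.1.2.trans this) (not_le.2 hlt)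
  -- The entire orbit of an ω-limit point `y` stays in `G` with form at least `m`, but `y` is in the
  -- unstable manifold, so its backward orbit tends to 0.
  obtain ⟨y, hyG, φ, hφ, hlim⟩ := hG.tendsto_subseq (x := fun n : ℕ => Φ n x)
    (fun n => hx n n.cast_nonneg)
  have hback : ∀ s, Tendsto (fun n => Φ (s + φ n) x) atTop (𝓝 (Φ s y)) := by
    intro s
    have := ((hΦ.continuous_space s).tendsto y).comp hlim
    simpa [Function.comp_def, ← hΦ.add] using this
  have hev : ∀ s, ∀ᶠ n in atTop, 0 ≤ s + (φ n : ℝ) := fun s => by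
    have : Tendsto (fun n => s + (φ n : ℝ)) atTop atTop :=
      tendsto_atTop_add_const_left _ s (tendsto_natCast_atTop_atTop.comp hφ.tendsto_atTop)
    exact this.eventually_ge_atTop 0
  have hyb : ∀ s, Φ s y ∈ G := fun s =>
    hG.isClosed.mem_of_tendsto (hback s) ((hev s).mono fun n hn => hx _ hn)
  have hym : ∀ s, m ≤ quadForm β (Φ s y) := fun s =>
    ge_of_tendsto (((continuous_quadForm β).tendsto _).comp (hback s))
      ((hev s).mono fun n hn => hlow _ hn)
  obtain ⟨γ, hγ, h0, hU, hl⟩ := hGW hyG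
  have heq : ∀ t ≤ 0, γ t = Φ t y := by
    intro t ht
    have := hΦ.eq_of_curve (hγ.mono Icc_subset_Iic_self) (right_mem_Icc.2 ht)
      (fun s _ => hGR (h0 ▸ hyb _)) t (left_mem_Icc.2 ht)
    simpa [h0] using this
  have hQl : Tendsto (fun t => quadForm β (γ t)) atBot (𝓝 0) := by
    have := ((continuous_quadForm β).tendsto 0).comp hl
    simpa [quadForm, Function.comp_def] using this
  have : m ≤ 0 := by
    refine ge_of_tendsto hQl ?_
    filter_upwards [Iic_mem_atBot 0] with t ht
    rw [heq t ht]
    exact hym t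
  linarith

/-- Backward orbits in the local unstable manifold oscillate across `S`. -/
theorem IsLocalUnstableGraph.oscillation (hW : IsLocalUnstableGraph η U V a b)
    (hη : -2 < η) (hη' : η < 2) {γ : ℝ → Phase}
    (hγ : IsIntegralCurveOn γ (fun _ => field η) (Iic 0)) (hU : ∀ t ≤ 0, γ t ∈ U)
    (hl : Tendsto γ atBot (𝓝 0)) (hne : γ 0 ≠ 0) (A : ℝ) :
    ∃ s t, s < t ∧ t < A ∧ γ s 1 * γ t 1 < 0 := by
  obtain ⟨β, κ, -, hκ, -, hev⟩ := hW.exists_focus hη hη'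
  have hγW : ∀ t ≤ 0, γ t ∈ localUnstable η U := fun t ht =>
    localUnstable_of_nonpos hγ hU hl ht
  have hl2 : Tendsto (fun t => (γ t 0, γ t 1)) atBot (𝓝 ((0 : ℝ), (0 : ℝ))) :=
    (((continuous_apply 0).tendsto (0 : Phase)).comp hl).prodMk_nhds
      (((continuous_apply 1).tendsto (0 : Phase)).comp hl)
  obtain ⟨B, hB⟩ := eventually_atBot.1 (hl2.eventually hev)
  set C := min B (min A 0) - 1 with hC
  have hCB : C ≤ B := by linarith [min_le_left B (min A 0)]
  have hCA : C < A := by linarith [min_le_right B (min A 0), min_le_left A 0]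
  have hC0 : C < 0 := by linarith [min_le_right B (min A 0), min_le_right A 0]
  have hrot : ∀ t ≤ C, γ t 0 * γ t 2 - γ t 1 ^ 2 ≤ -κ * (γ t 0 ^ 2 + γ t 1 ^ 2) := by
    intro t ht
    have := (hB t (ht.trans hCB)).1
    rwa [(hW.mem_iff.1 (hγW t (by linarith))).2.1]
  have hd : ∀ t ≤ C, HasDerivAt γ (field η (γ t)) t := fun t ht =>
    (hγ t (ht.trans hC0.le)).hasDerivAt (Iic_mem_nhds (by linarith))
  have hd0 : ∀ t ≤ C, HasDerivAt (fun t => γ t 0) (γ t 1) t := fun t ht => by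
    simpa [field] using hasDerivAt_pi.1 (hd t ht) 0
  have hd1 : ∀ t ≤ C, HasDerivAt (fun t => γ t 1) (γ t 2) t := fun t ht => by
    simpa [field] using hasDerivAt_pi.1 (hd t ht) 1
  obtain ⟨t₀, ht₀, hz⟩ : ∃ t < C, γ t 1 = 0 := by
    by_contra! hnz
    -- While x₂ ≠ 0 the angle arctan(x₁/x₂) grows at rate at least κ, so over a time π/κ it would
    -- gain π, more than the range of arctan allows.
    set L := Real.pi / κ with hL
    have hLp : 0 < L := div_pos Real.pi_pos hκ
    have hmono : ∀ t ∈ Icc (C - 1 - L) (C - 1), HasDerivAt (fun t => Real.arctan (γ t 0 / γ t 1))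
        ((1 / (1 + (γ t 0 / γ t 1) ^ 2)) * ((γ t 1 * γ t 1 - γ t 0 * γ t 2) / γ t 1 ^ 2)) t := by
      intro t ht
      exact ((hd0 t (by linarith [ht.2])).div (hd1 t (by linarith [ht.2]))
        (hnz t (by linarith [ht.2]))).arctan
    have hge : ∀ t ∈ Icc (C - 1 - L) (C - 1), κ ≤
        (1 / (1 + (γ t 0 / γ t 1) ^ 2)) * ((γ t 1 * γ t 1 - γ t 0 * γ t 2) / γ t 1 ^ 2) := by
      intro t ht
      have hn := hnz t (by linarith [ht.2])
      have h1 : 0 < γ t 1 ^ 2 := by positivity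
      have e : (1 / (1 + (γ t 0 / γ t 1) ^ 2)) * ((γ t 1 * γ t 1 - γ t 0 * γ t 2) / γ t 1 ^ 2) =
          (γ t 1 * γ t 1 - γ t 0 * γ t 2) / (γ t 1 ^ 2 + γ t 0 ^ 2) := by
        field_simp
      rw [e, le_div_iff₀ (by positivity)]
      nlinarith [hrot t (by linarith [ht.2])]
    have := (convex_Icc (C - 1 - L) (C - 1)).mul_sub_le_image_sub_of_le_deriv
      (f := fun t => Real.arctan (γ t 0 / γ t 1)) (C := κ)
      (fun t ht => (hmono t ht).continuousAt.continuousWithinAt)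
      (fun t ht => (hmono t (interior_subset ht)).differentiableAt.differentiableWithinAt)
      (fun t ht => by
        rw [(hmono t (interior_subset ht)).deriv]; exact hge t (interior_subset ht))
      (C - 1 - L) ⟨le_rfl, by linarith⟩ (C - 1) ⟨by linarith, le_rfl⟩ (by linarith)
    have e : κ * (C - 1 - (C - 1 - L)) = Real.pi := by
      rw [hL]; field_simp; ring
    rw [e] at this
    linarith [Real.arctan_lt_pi_div_two (γ (C - 1) 0 / γ (C - 1) 1),
      Real.neg_pi_div_two_lt_arctan (γ (C - 1 - L) 0 / γ (C - 1 - L) 1)]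
  have hx0 : γ t₀ 0 ≠ 0 := by
    intro h0
    have h1 := hW.eq_zero (hγW t₀ (by linarith)) h0 hz
    exact hne (eq_zero_of_curve (hγ.mono Icc_subset_Iic_self)
      (left_mem_Icc.2 (by linarith : t₀ ≤ 0)) h1 (right_mem_Icc.2 (by linarith)))
  -- At x₂ = 0 the rotation inequality reads x₁x₃ ≤ -κx₁², so the crossing is transverse and x₂
  -- changes sign.
  have h2 : γ t₀ 2 ≠ 0 := by
    intro h0
    have := hrot t₀ ht₀.le
    rw [h0, hz] at this
    have : 0 < κ * γ t₀ 0 ^ 2 := by positivity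
    nlinarith
  have hslope := hasDerivAt_iff_tendsto_slope.1 (hd1 t₀ ht₀.le)
  have hpos : ∀ᶠ t in 𝓝[≠] t₀, 0 < slope (fun t => γ t 1) t₀ t * γ t₀ 2 :=
    (hslope.mul_const (γ t₀ 2)).eventually (lt_mem_nhds (mul_self_pos.2 h2))
  rw [eventually_nhdsWithin_iff, Metric.eventually_nhds_iff] at hpos
  obtain ⟨δ, hδ, hpos⟩ := hpos
  set e := min (δ / 2) ((C - t₀) / 2) with he
  have hep : 0 < e := lt_min (by positivity) (by linarith)
  have heδ : e < δ := by linarith [min_le_left (δ / 2) ((C - t₀) / 2)]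
  have heC : t₀ + e < C := by linarith [min_le_right (δ / 2) ((C - t₀) / 2)]
  have h3 := hpos (y := t₀ - e) (by rw [Real.dist_eq]; simpa [abs_of_pos hep] using heδ)
    (by simpa using hep.ne')
  have h4 := hpos (y := t₀ + e) (by rw [Real.dist_eq]; simpa [abs_of_pos hep] using heδ)
    (by simpa using hep.ne')
  refine ⟨t₀ - e, t₀ + e, by linarith, by linarith, ?_⟩
  rw [slope_def_field, hz] at h3 h4
  have e3 : γ (t₀ - e) 1 = -e * ((γ (t₀ - e) 1 - 0) / (t₀ - e - t₀)) := by
    rw [show t₀ - e - t₀ = -e by ring]; field_simp; ring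
  have e4 : γ (t₀ + e) 1 = e * ((γ (t₀ + e) 1 - 0) / (t₀ + e - t₀)) := by
    rw [show t₀ + e - t₀ = e by ring]; field_simp; ring
  rw [e3, e4]
  set p := (γ (t₀ - e) 1 - 0) / (t₀ - e - t₀)
  set q := (γ (t₀ + e) 1 - 0) / (t₀ + e - t₀)
  have h5 : 0 < p * q := by
    have : 0 < (p * q) * γ t₀ 2 ^ 2 := by nlinarith [mul_pos h3 h4]
    exact pos_of_mul_pos_left this (sq_nonneg _)
  nlinarith [mul_pos (mul_pos hep hep) h5]

end Dynamics

/-! ### The circle of initial points as a level set of `rho` in the local unstable manifold. -/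

section Circle

variable {η : ℝ} {U : Set Phase} {V : Set (ℝ × ℝ)} {a b : ℝ × ℝ → ℝ} {r : ℝ}

/-- The squared distance of the base point to the origin. -/
def rho (x : Phase) : ℝ := x 0 ^ 2 + x 1 ^ 2

theorem continuous_rho : Continuous rho := by
  unfold rho
  fun_prop

/-- The part of the local unstable manifold over the closed disc of radius `r`. -/
def discGraph (r : ℝ) (a b : ℝ × ℝ → ℝ) : Set Phase :=
  (fun z : ℝ × ℝ => ![z.1, z.2, a z, b z]) '' {z | z.1 ^ 2 + z.2 ^ 2 ≤ r ^ 2}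

theorem exists_polar (hr : 0 < r) {u v : ℝ} (h : u ^ 2 + v ^ 2 = r ^ 2) :
    ∃ θ ∈ Ioc 0 (2 * Real.pi), u = r * Real.cos θ ∧ v = r * Real.sin θ := by
  have hn : ‖(⟨u, v⟩ : ℂ)‖ = r := by
    rw [Complex.norm_def, Complex.normSq_mk, ← pow_two, ← pow_two, h, Real.sqrt_sq hr.le]
  have hc := Complex.norm_mul_cos_arg ⟨u, v⟩
  have hs := Complex.norm_mul_sin_arg ⟨u, v⟩
  rw [hn] at hc hs
  have h1 := Complex.neg_pi_lt_arg ⟨u, v⟩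
  have h2 := Complex.arg_le_pi ⟨u, v⟩
  rcases lt_or_ge 0 (Complex.arg ⟨u, v⟩) with h0 | h0
  · exact ⟨_, ⟨h0, by linarith [Real.pi_pos]⟩, hc.symm, hs.symm⟩
  · refine ⟨Complex.arg ⟨u, v⟩ + 2 * Real.pi, ⟨by linarith [Real.pi_pos], by linarith⟩, ?_, ?_⟩
    · rw [Real.cos_add_two_pi]; exact hc.symm
    · rw [Real.sin_add_two_pi]; exact hs.symm

variable (hW : IsLocalUnstableGraph η U V a b) (hr : 0 < r)
  (hrV : ∀ z : ℝ × ℝ, z.1 ^ 2 + z.2 ^ 2 ≤ r ^ 2 → z ∈ V)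

include hW hrV in
theorem mem_discGraph_iff {x : Phase} :
    x ∈ discGraph r a b ↔ x ∈ localUnstable η U ∧ rho x ≤ r ^ 2 := by
  constructor
  · rintro ⟨z, hz, rfl⟩
    exact ⟨hW.graph_mem (hrV z hz), by simpa [rho] using hz⟩
  · rintro ⟨hx, hρ⟩
    exact ⟨(x 0, x 1), hρ, (hW.eq_graph_point hx).symm⟩

include hW hr hrV in
theorem mem_Du_iff {x : Phase} : x ∈ Du r a b ↔ x ∈ localUnstable η U ∧ rho x = r ^ 2 := by
  have hcirc : ∀ θ : ℝ, (r * Real.cos θ) ^ 2 + (r * Real.sin θ) ^ 2 = r ^ 2 := fun θ => by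
    linear_combination r ^ 2 * Real.cos_sq_add_sin_sq θ
  constructor
  · have : ∀ θ : ℝ, sigma r a b θ ∈ localUnstable η U ∧ rho (sigma r a b θ) = r ^ 2 := fun θ =>
      ⟨hW.graph_mem (hrV (r * Real.cos θ, r * Real.sin θ) (hcirc θ).le),
        by simpa [rho, sigma] using hcirc θ⟩
    rintro (⟨θ, -, rfl⟩ | ⟨θ, -, rfl⟩) <;> exact this θ
  · rintro ⟨hx, hρ⟩
    obtain ⟨θ, hθ, h0, h1⟩ := exists_polar hr hρ
    have hxσ : sigma r a b θ = x := by
      conv_rhs => rw [hW.eq_graph_point hx, h0, h1]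
      rfl
    rcases le_or_gt θ Real.pi with h | h
    · exact Or.inl ⟨θ, ⟨hθ.1, h⟩, hxσ⟩
    · exact Or.inr ⟨θ, ⟨h, hθ.2⟩, hxσ⟩

include hW hrV in
theorem isCompact_discGraph (hr : 0 < r) : IsCompact (discGraph r a b) := by
  have hc : IsCompact {z : ℝ × ℝ | z.1 ^ 2 + z.2 ^ 2 ≤ r ^ 2} := by
    refine Metric.isCompact_of_isClosed_isBounded (isClosed_le (by fun_prop) continuous_const)
      ((Metric.isBounded_closedBall (x := (0 : ℝ × ℝ)) (r := r)).subset fun z hz => ?_)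
    rw [mem_closedBall_zero_iff, Prod.norm_def, max_le_iff, Real.norm_eq_abs, Real.norm_eq_abs]
    have hz' : z.1 ^ 2 + z.2 ^ 2 ≤ r ^ 2 := hz
    constructor <;> apply abs_le_of_sq_le_sq _ hr.le <;> nlinarith [sq_nonneg z.1, sq_nonneg z.2]
  refine hc.image_of_continuousOn (continuousOn_pi.2 fun i => ?_)
  have ha : ContinuousOn a {z : ℝ × ℝ | z.1 ^ 2 + z.2 ^ 2 ≤ r ^ 2} :=
    hW.analytic_a.continuousOn.mono hrV
  have hb : ContinuousOn b {z : ℝ × ℝ | z.1 ^ 2 + z.2 ^ 2 ≤ r ^ 2} :=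
    hW.analytic_b.continuousOn.mono hrV
  fin_cases i
  · exact continuousOn_fst
  · exact continuousOn_snd
  · exact ha
  · exact hb

include hW hr hrV in
theorem isCompact_Du : IsCompact (Du r a b) := by
  have : Du r a b = discGraph r a b ∩ {x | rho x = r ^ 2} := by
    ext x
    rw [mem_Du_iff hW hr hrV, mem_inter_iff, mem_discGraph_iff hW hrV]
    exact ⟨fun h => ⟨⟨h.1, h.2.le⟩, h.2⟩, fun h => ⟨h.1.1, h.2⟩⟩
  rw [this]
  exact (isCompact_discGraph hW hrV hr).inter_right
    (isClosed_eq continuous_rho continuous_const)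

end Circle

/-- The orbit of `q` on the global unstable manifold of the origin, followed by a complete flow. -/
structure OrbitSetup (η : ℝ) (U : Set Phase) (V : Set (ℝ × ℝ)) (a b : ℝ × ℝ → ℝ) (r R : ℝ)
    (Φ : ℝ → Phase → Phase) (T : ℝ) (q : Phase) : Prop where
  lower : -2 < η
  upper : η < 2
  graph : IsLocalUnstableGraph η U V a b
  radius_pos : 0 < r
  disc : ∀ z : ℝ × ℝ, z.1 ^ 2 + z.2 ^ 2 ≤ r ^ 2 → z ∈ V
  flow : CutoffFlow η R Φ
  mem_ball : ∀ t ≤ 0, Φ t q ∈ Metric.ball 0 R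
  disc_ball : discGraph r a b ⊆ Metric.ball 0 R
  tendsto : Tendsto (fun t => Φ t q) atBot (𝓝 0)
  mem_nhd : ∀ t ≤ -T, Φ t q ∈ U
  time_pos : 0 < T
  start_mem : Φ (-T) q ∈ Du r a b
  unique : ∀ p ∈ Du r a b, SameOrbit η p q → p = Φ (-T) q
  ne_zero : q ≠ 0

/-- The backward orbit of `q` tends to 0, hence is bounded; `R` is chosen so that the ball contains
it and the compact graph over the disc. There the cut-off flow is the true one. -/
theorem exists_orbitSetup {η : ℝ} {U : Set Phase} {V : Set (ℝ × ℝ)} {a b : ℝ × ℝ → ℝ} {r : ℝ}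
    {q : Phase} (hη : -2 < η) (hη' : η < 2) (hW : IsLocalUnstableGraph η U V a b) (hr : 0 < r)
    (hrV : ∀ z : ℝ × ℝ, z.1 ^ 2 + z.2 ^ 2 ≤ r ^ 2 → z ∈ V) (hq0 : q ≠ 0) (hqS : q ∈ S)
    (hclean : ReachedCleanly η (Du r a b) q) :
    ∃ R Φ T, OrbitSetup η U V a b r R Φ T q ∧ Φ (-T) q ∉ S ∧
      ∀ t ∈ Ioo 0 T, Φ (-t) q 1 = 0 → Φ (-t) q ∉ v1 ∪ v2 := by
  obtain ⟨p, hp, hpS, huniq, T, ⟨hT, γ, hγ, h0, h1⟩, htr⟩ := hclean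
  have hpW := ((mem_Du_iff hW hr hrV).1 hp).1
  have hTp : 0 < T := by
    refine lt_of_le_of_ne hT ?_
    rintro rfl
    exact hpS (by rw [← h0, h1]; exact hqS)
  obtain ⟨δ, hδ, hδ0, hl, hU, hδγ⟩ := localUnstable_extend hpW hT hγ h0
  obtain ⟨B, hB⟩ := eventually_atBot.1 (hl.eventually (Metric.ball_mem_nhds 0 one_pos))
  obtain ⟨R₁, hR₁⟩ := (isCompact_Icc.image_of_continuousOn
    (hδ.continuousOn.mono (Icc_subset_Iic_self (a := min B 0)))).isBounded.subset_ball 0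
  obtain ⟨R₂, hR₂⟩ := (isCompact_discGraph hW hrV hr).isBounded.subset_ball 0
  set R := max 1 (max R₁ R₂) with hR
  have hδR : ∀ t ≤ 0, δ t ∈ Metric.ball 0 R := by
    intro t ht
    rcases le_total t B with h | h
    · exact Metric.ball_subset_ball (le_max_left _ _) (hB t h)
    · exact Metric.ball_subset_ball ((le_max_left _ _).trans (le_max_right _ _))
        (hR₁ (mem_image_of_mem _ ⟨(min_le_left _ _).trans h, ht⟩))
  obtain ⟨Φ, hΦ⟩ := exists_cutoffFlow η (R := R) (lt_of_lt_of_le one_pos (le_max_left _ _))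
  have heq : ∀ t ≤ 0, δ t = Φ t q := by
    intro t ht
    have := hΦ.eq_of_curve_ball δ t 0 0 (hδ.mono Icc_subset_Iic_self) (right_mem_Icc.2 ht)
      (fun s hs => hδR s hs.2) t (left_mem_Icc.2 ht)
    simpa [hδ0, h1] using this
  have hp' : Φ (-T) q = p := by
    rw [← heq _ (by linarith), hδγ _ ⟨le_rfl, by linarith⟩]
    simpa using h0
  refine ⟨R, Φ, T, ⟨hη, hη', hW, hr, hrV, hΦ, fun t ht => heq t ht ▸ hδR t ht,
    hR₂.trans (Metric.ball_subset_ball ((le_max_right _ _).trans (le_max_right _ _))), ?_,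
    fun t ht => heq t (by linarith) ▸ hU t ht, hTp, hp' ▸ hp, hp' ▸ huniq, hq0⟩, hp' ▸ hpS, ?_⟩
  · refine hl.congr' ?_
    filter_upwards [Iic_mem_atBot 0] with t ht
    exact heq t ht
  · intro t ht ht0
    have e : Φ (-t) q = γ (-t + T) := by
      rw [← heq _ (by linarith [ht.1]), hδγ _ ⟨by linarith [ht.2], by linarith [ht.1]⟩]
    refine htr (-t + T) ⟨by linarith [ht.2], by linarith [ht.1]⟩ _ ht0 ⟨by linarith [ht.2], γ,
      hγ.mono (Icc_subset_Icc_right (by linarith [ht.1])), h0, e.symm⟩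

/-! ### How the orbit of `q` and its neighbours cross the circle. -/

namespace OrbitSetup

variable {η : ℝ} {U : Set Phase} {V : Set (ℝ × ℝ)} {a b : ℝ × ℝ → ℝ} {r R : ℝ}
  {Φ : ℝ → Phase → Phase} {T : ℝ} {q : Phase}

/-- A coincidence would make the orbit periodic, and a periodic orbit that tends to 0 in backward
time is the equilibrium. -/
theorem injective (h : OrbitSetup η U V a b r R Φ T q) : Function.Injective fun t => Φ t q := by
  have key : ∀ s t : ℝ, s < t → Φ s q ≠ Φ t q := by
    intro s t hst heq
    have hper : Φ (s - t) q = q := by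
      have := congrArg (Φ (-t)) heq
      rwa [← h.flow.add, h.flow.cancel_neg, neg_add_eq_sub] at this
    have hn : ∀ n : ℕ, Φ (n * (s - t)) q = q := by
      intro n
      induction n with
      | zero => simp [h.flow.zero]
      | succ n ih =>
        rw [show ((n + 1 : ℕ) : ℝ) * (s - t) = n * (s - t) + (s - t) by push_cast; ring,
          h.flow.add, hper, ih]
    have hlim : Tendsto (fun n : ℕ => (n : ℝ) * (s - t)) atTop atBot :=
      tendsto_natCast_atTop_atTop.atTop_mul_const_of_neg (by linarith)
    have h1 := h.tendsto.comp hlim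
    simp only [Function.comp_def, hn] at h1
    exact h.ne_zero (tendsto_nhds_unique tendsto_const_nhds h1)
  intro s t hst
  by_contra hne
  rcases lt_or_gt_of_ne hne with h' | h'
  · exact key s t h' hst
  · exact key t s h' hst.symm

theorem eventually_tube (h : OrbitSetup η U V a b r R Φ T q) {O : Set Phase} (hO : IsOpen O)
    {α β : ℝ} (hq : ∀ t ∈ Icc α β, Φ t q ∈ O) : ∀ᶠ z in 𝓝 q, ∀ t ∈ Icc α β, Φ t z ∈ O := by
  refine isCompact_Icc.eventually_forall_of_forall_eventually fun t ht => ?_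
  have hc : Continuous fun z : Phase × ℝ => Φ z.2 z.1 :=
    h.flow.continuous.comp continuous_swap
  exact hc.continuousAt.eventually (hO.mem_nhds (hq t ht))

theorem start_graph (h : OrbitSetup η U V a b r R Φ T q) : Φ (-T) q ∈ localUnstable η U :=
  ((mem_Du_iff h.graph h.radius_pos h.disc).1 h.start_mem).1

theorem rho_start (h : OrbitSetup η U V a b r R Φ T q) : rho (Φ (-T) q) = r ^ 2 :=
  ((mem_Du_iff h.graph h.radius_pos h.disc).1 h.start_mem).2

theorem mem_localUnstable_of_le (h : OrbitSetup η U V a b r R Φ T q) {s t : ℝ} {z : Phase}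
    (hz : Φ t z ∈ localUnstable η U) (hst : s ≤ t)
    (hb : ∀ u ∈ Icc s t, Φ u z ∈ Metric.ball 0 R) : Φ s z ∈ localUnstable η U := by
  have hc := h.flow.isIntegralCurveOn (x := z) (s := Icc (-(t - s)) 0) t
    (fun u hu => hb _ ⟨by linarith [hu.1], by linarith [hu.2]⟩)
  simpa using localUnstable_backward hz (by linarith) hc (by simp)

theorem mem_localUnstable_of_ge (h : OrbitSetup η U V a b r R Φ T q) {s t : ℝ} {z : Phase}
    (hz : Φ s z ∈ localUnstable η U) (hst : s ≤ t)
    (hb : ∀ u ∈ Icc s t, Φ u z ∈ Metric.ball 0 R) (hU : ∀ u ∈ Icc s t, Φ u z ∈ U) :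
    Φ t z ∈ localUnstable η U := by
  have hc := h.flow.isIntegralCurveOn (x := z) (s := Icc 0 (t - s)) s
    (fun u hu => hb _ ⟨by linarith [hu.1], by linarith [hu.2]⟩)
  simpa using localUnstable_forward hz (by linarith) hc (by simp)
    (fun u hu => hU _ ⟨by linarith [hu.1], by linarith [hu.2]⟩)

/-- The uniqueness assumption concerns true orbits; `hb` ensures that the cut-off flow is one for t
> 0, and is vacuous for t < 0. -/
theorem eq_of_mem_Du (h : OrbitSetup η U V a b r R Φ T q) {t : ℝ}
    (hb : ∀ s ∈ Icc 0 t, Φ s q ∈ Metric.ball 0 R) (ht : Φ t q ∈ Du r a b) : t = -T := by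
  apply h.injective
  refine h.unique _ ht ?_
  rcases le_total t 0 with h0 | h0
  · refine ⟨-t, Or.inl ⟨by linarith, fun s => Φ (s + t) q, h.flow.isIntegralCurveOn t fun s hs =>
      h.mem_ball _ (by linarith [hs.2]), by simp, by simp [h.flow.zero]⟩⟩
  · refine ⟨t, Or.inr ⟨h0, fun s => Φ (s + 0) q, h.flow.isIntegralCurveOn 0 fun s hs =>
      by simpa using hb s hs, by simp [h.flow.zero], by simp⟩⟩

/-- Otherwise, as `rho` tends to 0 at -∞, it would take the value r² before `-T`, a second meeting
with the circle. -/
theorem rho_lt (h : OrbitSetup η U V a b r R Φ T q) {t : ℝ} (ht : t < -T) :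
    rho (Φ t q) < r ^ 2 := by
  by_contra hge
  rw [not_lt] at hge
  have hc : Continuous fun t => rho (Φ t q) := continuous_rho.comp (h.flow.continuous_time q)
  have hl : Tendsto (fun t => rho (Φ t q)) atBot (𝓝 0) := by
    have := (continuous_rho.tendsto 0).comp h.tendsto
    simpa [rho, Function.comp_def] using this
  obtain ⟨s, hs, hst⟩ := ((hl.eventually (gt_mem_nhds (pow_pos h.radius_pos 2))).and
    (Iic_mem_atBot t)).exists
  obtain ⟨u, hu, hur⟩ := intermediate_value_Icc hst hc.continuousOn ⟨hs.le, hge⟩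
  have hT := h.time_pos
  have hu' : u < -T := hu.2.trans_lt ht
  have huD : Φ u q ∈ Du r a b := (mem_Du_iff h.graph h.radius_pos h.disc).2
    ⟨h.mem_localUnstable_of_le h.start_graph hu'.le
      fun v hv => h.mem_ball v (by linarith [hv.2]), hur⟩
  have := h.eq_of_mem_Du (fun s hs => absurd (hs.1.trans hs.2) (by linarith)) huD
  linarith

/-- An orbit that does not go outside soon after `-T` never leaves the compact graph over the disc:
it could leave only through the circle, which it does not meet again. This contradicts
`not_trapped`. -/
theorem exists_rho_gt (h : OrbitSetup η U V a b r R Φ T q) {ε : ℝ} (hε : 0 < ε) :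
    ∃ s ∈ Ioo 0 ε, r ^ 2 < rho (Φ (-T + s) q) := by
  by_contra! hle
  have hT := h.time_pos
  set x := Φ (-T) q with hx
  have hxadd : ∀ t, Φ t x = Φ (-T + t) q := fun t => by rw [hx, ← h.flow.add, add_comm]
  have hG := isCompact_discGraph h.graph h.disc h.radius_pos
  have hxc := h.flow.continuous_time x
  have hxG : x ∈ discGraph r a b :=
    (mem_discGraph_iff h.graph h.disc).2 ⟨h.start_graph, h.rho_start.le⟩
  have hx0 : x ≠ 0 := by
    intro h0
    have := h.rho_start
    rw [← hx, h0] at this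
    have hr := pow_pos h.radius_pos 2
    rw [← this] at hr
    simp [rho] at hr
  refine h.graph.not_trapped h.lower h.upper h.flow hG
    (fun y hy => ((mem_discGraph_iff h.graph h.disc).1 hy).1) h.disc_ball hx0 ?_
  by_contra! hbad
  obtain ⟨t₁, ht₁, ht₁G⟩ := hbad
  set B := {t : ℝ | 0 ≤ t ∧ Φ t x ∉ discGraph r a b} with hB
  have hBne : B.Nonempty := ⟨t₁, ht₁, ht₁G⟩
  have hBb : BddBelow B := ⟨0, fun t ht => ht.1⟩
  -- The supposed exit time: the orbit is still in the closed disc graph at `t₀`, and the argument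
  -- continues it inside for a while longer.
  set t₀ := sInf B with ht₀
  have ht₀0 : 0 ≤ t₀ := le_csInf hBne fun t ht => ht.1
  have hbefore : ∀ t, 0 ≤ t → t < t₀ → Φ t x ∈ discGraph r a b := by
    intro t ht htt
    by_contra hn
    exact (csInf_le hBb (show t ∈ B from ⟨ht, hn⟩)).not_gt htt
  have hatG : Φ t₀ x ∈ discGraph r a b := by
    rcases ht₀0.eq_or_lt with h0 | h0
    · rw [← h0, h.flow.zero]; exact hxG
    · refine hG.isClosed.mem_of_tendsto (b := 𝓝[<] t₀)
        (hxc.continuousAt.tendsto.mono_left nhdsWithin_le_nhds) ?_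
      filter_upwards [Ioo_mem_nhdsLT h0] with t ht
      exact hbefore t ht.1.le ht.2
  have hall : ∀ t ∈ Icc 0 t₀, Φ t x ∈ discGraph r a b := by
    intro t ht
    rcases ht.2.eq_or_lt with h1 | h1
    · rw [h1]; exact hatG
    · exact hbefore t ht.1 h1
  have hatW := ((mem_discGraph_iff h.graph h.disc).1 hatG)
  have hatU : Φ t₀ x ∈ U := by
    obtain ⟨γ, -, h0, hU, -⟩ := hatW.1
    rw [← h0]; exact hU 0 le_rfl
  have hρ : ∀ᶠ t in 𝓝[>] t₀, rho (Φ t x) ≤ r ^ 2 := by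
    rcases ht₀0.eq_or_lt with h0 | h0
    · filter_upwards [Ioo_mem_nhdsGT (show t₀ < t₀ + ε by linarith)] with t ht
      rw [hxadd]
      exact hle t ⟨by linarith [ht.1], by linarith [ht.2]⟩
    · have hlt : rho (Φ t₀ x) < r ^ 2 := by
        refine lt_of_le_of_ne hatW.2 fun heq => ?_
        have hD : Φ t₀ x ∈ Du r a b :=
          (mem_Du_iff h.graph h.radius_pos h.disc).2 ⟨hatW.1, heq⟩
        rw [hxadd] at hD
        have := h.eq_of_mem_Du (t := -T + t₀) (fun s hs => by
          have := h.disc_ball (hall (s + T) ⟨by linarith [hs.1], by linarith [hs.2]⟩)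
          rwa [hxadd, show -T + (s + T) = s by ring] at this) hD
        linarith
      have := (continuous_rho.comp hxc).continuousAt.eventually (gt_mem_nhds hlt)
      exact (this.filter_mono nhdsWithin_le_nhds).mono fun t ht => ht.le
  have hUb : ∀ᶠ t in 𝓝 t₀, Φ t x ∈ U ∩ Metric.ball 0 R :=
    hxc.continuousAt.eventually ((h.graph.isOpen_nhd.inter Metric.isOpen_ball).mem_nhds
      ⟨hatU, h.disc_ball hatG⟩)
  obtain ⟨δ₁, hδ₁, hδ₁'⟩ := Metric.eventually_nhds_iff.1 hUb
  obtain ⟨δ₂, hδ₂, hδ₂'⟩ := mem_nhdsGT_iff_exists_Ioo_subset.1 hρ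
  have hδ₂p : t₀ < δ₂ := hδ₂
  have hext : ∀ t, t₀ < t → t < t₀ + δ₁ → t < δ₂ → Φ t x ∈ discGraph r a b := by
    intro t h1 h2 h3
    have hin : ∀ u ∈ Icc t₀ t, Φ u x ∈ U ∩ Metric.ball 0 R := fun u hu => hδ₁' (by
      rw [Real.dist_eq, abs_lt]; constructor <;> linarith [hu.1, hu.2])
    exact (mem_discGraph_iff h.graph h.disc).2
      ⟨h.mem_localUnstable_of_ge hatW.1 h1.le (fun u hu => (hin u hu).2) (fun u hu => (hin u hu).1),
        hδ₂' ⟨h1, h3⟩⟩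
  obtain ⟨t, htB, ht⟩ := exists_lt_of_csInf_lt hBne
    (show sInf B < min (t₀ + δ₁) δ₂ from lt_min (by linarith) hδ₂p)
  rcases (csInf_le hBb htB).eq_or_lt with h1 | h1
  · exact htB.2 (h1 ▸ hatG)
  · exact htB.2 (hext t h1 (ht.trans_le (min_le_left _ _)) (ht.trans_le (min_le_right _ _)))

/-- Orbits near the one of `q` on the unstable manifold cross the circle of initial points. -/
theorem eventually_cross (h : OrbitSetup η U V a b r R Φ T q) {ε : ℝ} (hε : 0 < ε) (hεT : ε < T)
    (hU : ∀ t ∈ Icc (-T) (-T + ε), Φ t q ∈ U) :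
    ∀ᶠ z in 𝓝 q, Φ (-T) z ∈ localUnstable η U →
      ∃ t ∈ Ioo (T - ε) (T + ε), Φ (-t) z ∈ Du r a b := by
  -- The strict inequalities inside and outside persist for nearby orbits, and the intermediate
  -- value theorem gives a crossing without transversality.
  obtain ⟨s, hs, hsρ⟩ := h.exists_rho_gt hε
  have hin := h.rho_lt (t := -T - ε / 2) (by linarith)
  have hc : ∀ t, Continuous fun z => rho (Φ t z) := fun t =>
    continuous_rho.comp (h.flow.continuous_space t)
  filter_upwards [(hc _).continuousAt.eventually (lt_mem_nhds hsρ),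
    (hc _).continuousAt.eventually (gt_mem_nhds hin),
    h.eventually_tube h.graph.isOpen_nhd hU,
    h.eventually_tube (α := -T - ε) (β := 0) Metric.isOpen_ball fun t ht => h.mem_ball t ht.2]
    with z h1 h2 h3 h4 hz
  obtain ⟨t, ht, htρ⟩ := intermediate_value_Icc (by linarith [hs.1] : -T - ε / 2 ≤ -T + s)
    (continuous_rho.comp (h.flow.continuous_time z)).continuousOn ⟨h2.le, h1.le⟩
  refine ⟨-t, ⟨by linarith [ht.2, hs.2], by linarith [ht.1]⟩, ?_⟩
  rw [neg_neg]
  refine (mem_Du_iff h.graph h.radius_pos h.disc).2 ⟨?_, htρ⟩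
  rcases le_total t (-T) with h5 | h5
  · exact h.mem_localUnstable_of_le hz h5 fun u hu =>
      h4 u ⟨by linarith [ht.1, hu.1], by linarith [hu.2, h.time_pos]⟩
  · exact h.mem_localUnstable_of_ge hz h5
      (fun u hu => h4 u ⟨by linarith [hu.1], by linarith [hu.2, ht.2, hs.2]⟩)
      (fun u hu => h3 u ⟨hu.1, by linarith [hu.2, ht.2, hs.2]⟩)

/-- Near `q`, the orbits meet the circle of initial points only near the time `-T`. -/
theorem eventually_near_start (h : OrbitSetup η U V a b r R Φ T q) {ε : ℝ} (hε : 0 < ε) (A : ℝ) :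
    ∀ᶠ z in 𝓝 q, ∀ t ∈ Icc 0 A, Φ (-t) z ∈ Du r a b → t ∈ Ioo (T - ε) (T + ε) := by
  have hO : IsOpen (Du r a b)ᶜ := (isCompact_Du h.graph h.radius_pos h.disc).isClosed.isOpen_compl
  have hq : ∀ t ≤ 0, t ≠ -T → Φ t q ∈ (Du r a b)ᶜ := fun t ht hne hD =>
    hne (h.eq_of_mem_Du (fun s hs => by
      rw [show s = 0 by linarith [hs.1, hs.2]]; exact h.mem_ball 0 le_rfl) hD)
  have hT := h.time_pos
  filter_upwards [h.eventually_tube (α := -A) (β := -T - ε) hO fun t ht =>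
      hq t (by linarith [ht.2]) (by linarith [ht.2] : t < -T).ne,
    h.eventually_tube (α := -T + ε) (β := 0) hO fun t ht =>
      hq t ht.2 (by linarith [ht.1] : -T < t).ne'] with z h1 h2 t ht hD
  by_contra hn
  rcases le_or_gt t (T - ε) with h3 | h3
  · exact h2 (-t) ⟨by linarith, by linarith [ht.1]⟩ hD
  · refine h1 (-t) ⟨by linarith [ht.2], ?_⟩ hD
    by_contra h4
    exact hn ⟨h3, by linarith⟩

/-- Near `q`, the points reached from the local unstable manifold in bounded time are reached from
it in the time `T`. -/
theorem eventually_mem_localUnstable (h : OrbitSetup η U V a b r R Φ T q) (A : ℝ) :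
    ∀ᶠ z in 𝓝 q, ∀ t ∈ Icc 0 A, Φ (-t) z ∈ localUnstable η U →
      Φ (-T) z ∈ localUnstable η U := by
  have hT := h.time_pos
  filter_upwards [h.eventually_tube (α := -A) (β := -T) h.graph.isOpen_nhd
      fun t ht => h.mem_nhd t ht.2,
    h.eventually_tube (α := -(max A T)) (β := 0) Metric.isOpen_ball fun t ht => h.mem_ball t ht.2]
    with z h1 h2 t ht hz
  rcases le_total t T with h3 | h3
  · exact h.mem_localUnstable_of_le hz (by linarith) fun u hu =>
      h2 u ⟨by linarith [hu.1, le_max_right A T], by linarith [hu.2, ht.1]⟩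
  · exact h.mem_localUnstable_of_ge hz (by linarith)
      (fun u hu => h2 u ⟨by linarith [hu.1, ht.2, le_max_left A T], by linarith [hu.2]⟩)
      (fun u hu => h1 u ⟨by linarith [hu.1, ht.2], hu.2⟩)

/-- Curves that end at a point near `q` are followed by the complete flow. -/
theorem eventually_curve_eq (h : OrbitSetup η U V a b r R Φ T q) (A : ℝ) :
    ∀ᶠ z in 𝓝 q, ∀ (γ : ℝ → Phase) (t : ℝ), 0 ≤ t →
      IsIntegralCurveOn γ (fun _ => field η) (Icc 0 t) → γ t = z →
      ∀ s ∈ Icc 0 t, t - A ≤ s → γ s = Φ (s - t) z := by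
  filter_upwards [h.eventually_tube (α := -A) (β := 0) Metric.isOpen_ball
    fun t ht => h.mem_ball t ht.2] with z h1 γ t _ hγ hz s hs hsA
  have := h.flow.eq_of_curve (hγ.mono (Icc_subset_Icc_left hs.1)) (right_mem_Icc.2 hs.2)
    (fun u hu => by
      rw [hz]; exact h1 _ ⟨by linarith [hu.1], by linarith [hu.2]⟩) s (left_mem_Icc.2 hs.2)
  rwa [hz] at this

end OrbitSetup

theorem fderiv_H (η : ℝ) (q u : Phase) : fderiv ℝ (H η) q u = (q 0 - q 0 ^ 2) * u 0 +
    (q 3 - η * q 1) * u 1 - q 2 * u 2 + q 1 * u 3 := by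
  have hd : DifferentiableAt ℝ (H η) q := by
    unfold H
    fun_prop
  have hline : HasDerivAt (fun t : ℝ => q + t • u) u 0 := by
    simpa using ((hasDerivAt_id (0 : ℝ)).smul_const u).const_add q
  have h1 : HasDerivAt (fun t : ℝ => H η (q + t • u)) (fderiv ℝ (H η) q u) 0 :=
    HasFDerivAt.comp_hasDerivAt (f := fun t : ℝ => q + t • u) (l := H η) 0
      (by simpa using hd.hasFDerivAt) hline
  have hi := hasDerivAt_pi.1 hline
  have h2 := (((((hi 0).pow 2).const_mul (1 / 2)).sub (((hi 0).pow 3).const_mul (1 / 3))).sub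
    (((hi 1).pow 2).const_mul (η / 2))).add ((hi 1).mul (hi 3)) |>.sub
    (((hi 2).pow 2).const_mul (1 / 2))
  have h3 := h1.unique (f := fun t : ℝ => H η (q + t • u)) h2
  rw [h3]
  simp
  ring

/-! ### The curve W^u ∩ S near `q`. -/

namespace OrbitSetup

variable {η : ℝ} {U : Set Phase} {V : Set (ℝ × ℝ)} {a b : ℝ × ℝ → ℝ} {r R : ℝ}
  {Φ : ℝ → Phase → Phase} {T : ℝ} {q : Phase}

/-- Tangent vectors of the unstable manifold come from the chart of the local unstable manifold. -/
theorem tangent_mem_range (h : OrbitSetup η U V a b r R Φ T q) {g : ℝ × ℝ → Phase}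
    (hgdef : ∀ z, g z = ![z.1, z.2, a z, b z]) {g' : ℝ × ℝ →L[ℝ] Phase} {A : Phase →L[ℝ] Phase}
    (hg : HasStrictFDerivAt g g' (Φ (-T) q 0, Φ (-T) q 1))
    (hA : HasStrictFDerivAt (Φ T) A (Φ (-T) q)) {v : Phase}
    (hv : v ∈ tangentUnstable η U q) : ∃ w, v = A (g' w) := by
  obtain ⟨T', w, c, hev, hc0, hc⟩ := hv
  obtain ⟨B, hB⟩ := h.flow.strict (-T) q
  have hcl : Tendsto c (𝓝 0) (𝓝 q) := hc0 ▸ hc.continuousAt.tendsto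
  have hT' : 0 ≤ T' := hev.self_of_nhds.2.1
  have h1 : HasDerivAt (fun s => Φ (-T) (c s)) (B v) 0 :=
    HasFDerivAt.comp_hasDerivAt (f := c) 0 (by rw [hc0]; exact hB.hasFDerivAt) hc
  have h2 := hasDerivAt_pi.1 h1
  have h3 : HasDerivAt (fun s => (Φ (-T) (c s) 0, Φ (-T) (c s) 1)) (B v 0, B v 1) 0 :=
    (h2 0).prodMk (h2 1)
  have hgq : g (Φ (-T) q 0, Φ (-T) q 1) = Φ (-T) q := by
    rw [hgdef]; exact (h.graph.eq_graph_point h.start_graph).symm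
  have h4 : HasDerivAt (fun s => g (Φ (-T) (c s) 0, Φ (-T) (c s) 1)) (g' (B v 0, B v 1)) 0 :=
    HasFDerivAt.comp_hasDerivAt (f := fun s => (Φ (-T) (c s) 0, Φ (-T) (c s) 1)) 0
      (by rw [hc0]; exact hg.hasFDerivAt) h3
  have h5 : HasDerivAt (fun s => Φ T (g (Φ (-T) (c s) 0, Φ (-T) (c s) 1)))
      (A (g' (B v 0, B v 1))) 0 :=
    HasFDerivAt.comp_hasDerivAt (f := fun s => g (Φ (-T) (c s) 0, Φ (-T) (c s) 1)) 0
      (by rw [hc0, hgq]; exact hA.hasFDerivAt) h4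
  -- Whatever the time `T'` of the given curve, its points near `q` come from the local manifold in
  -- time `T`, so one chart serves all tangent vectors.
  have h6 : (fun s => Φ T (g (Φ (-T) (c s) 0, Φ (-T) (c s) 1))) =ᶠ[𝓝 0] c := by
    filter_upwards [hev, hcl.eventually (h.eventually_curve_eq T'),
      hcl.eventually (h.eventually_mem_localUnstable T')] with s hs hs1 hs2
    obtain ⟨hw, -, γ, hγ, hγ0, hγ1⟩ := hs
    have h7 := hs1 γ T' hT' hγ hγ1 0 ⟨le_rfl, hT'⟩ (by linarith)
    rw [hγ0, zero_sub] at h7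
    have h8 := hs2 T' ⟨hT', le_rfl⟩ (h7 ▸ hw)
    rw [hgdef, ← h.graph.eq_graph_point h8, h.flow.neg_cancel]
  exact ⟨_, hc.unique (h5.congr_of_eventuallyEq h6.symm)⟩

/-- Near `q` the unstable manifold meets `S` in a curve parametrized by `x₃`. -/
theorem exists_local_curve (h : OrbitSetup η U V a b r R Φ T q)
    (htrans : TransverseToVertical η U q) {q₄ : ℝ} (hq : q = ![3 / 2, 0, 0, q₄]) :
    ∃ f : ℝ → Phase, ∃ δ > 0, ContinuousOn f (Icc (-δ) δ) ∧ f 0 = q ∧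
      (∀ y ∈ Icc (-δ) δ, f y 1 = 0 ∧ f y 2 = y ∧ Φ (-T) (f y) ∈ localUnstable η U) ∧
      ∀ᶠ z in 𝓝 q, Φ (-T) z ∈ localUnstable η U → z 1 = 0 → z = f (z 2) := by
  set z₀ : ℝ × ℝ := (Φ (-T) q 0, Φ (-T) q 1) with hz₀
  have hz₀V : z₀ ∈ V := (h.graph.mem_iff.1 h.start_graph).1
  set g : ℝ × ℝ → Phase := fun z => ![z.1, z.2, a z, b z] with hg
  have hgc : ∀ z ∈ V, ContDiffAt ℝ 1 g z := fun z hz => by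
    rw [contDiffAt_pi]
    intro i
    fin_cases i
    · exact contDiffAt_fst
    · exact contDiffAt_snd
    · exact (h.graph.analytic_a z hz).contDiffAt
    · exact (h.graph.analytic_b z hz).contDiffAt
  have hgs := (hgc z₀ hz₀V).hasStrictFDerivAt one_ne_zero
  have hgq : g z₀ = Φ (-T) q := (h.graph.eq_graph_point h.start_graph).symm
  obtain ⟨A, hA⟩ := h.flow.strict T (Φ (-T) q)
  set P : Phase →L[ℝ] ℝ × ℝ := (ContinuousLinearMap.proj 1).prod (ContinuousLinearMap.proj 2)
    with hP
  have hPapply : ∀ x : Phase, P x = (x 1, x 2) := fun x => rfl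
  set L : ℝ × ℝ →L[ℝ] ℝ × ℝ := P.comp (A.comp (fderiv ℝ g z₀)) with hL
  have hstrict : HasStrictFDerivAt (fun z => P (Φ T (g z))) L z₀ :=
    P.hasStrictFDerivAt.comp z₀ ((hgq ▸ hA).comp z₀ hgs)
  have hsurj : Function.Surjective L := by
    intro w
    -- At `q` the differential of `H` is -¾u₁ + q₄u₂, so any prescribed (u₂, u₃) extends to a
    -- tangent vector of the level set. The vertical summand given by transversality has no x₂ or x₃
    -- component.
    have hker : fderiv ℝ (H η) q ![4 / 3 * q₄ * w.1, w.1, w.2, 0] = 0 := by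
      rw [fderiv_H, hq]
      simp
      ring
    obtain ⟨v, hv, c, hc⟩ := htrans _ hker
    obtain ⟨u, hu⟩ := h.tangent_mem_range (fun z => rfl) hgs hA hv
    refine ⟨u, ?_⟩
    have h1 := congrFun hc 1
    have h2 := congrFun hc 2
    simp at h1 h2
    rw [hL, ContinuousLinearMap.comp_apply, ContinuousLinearMap.comp_apply, ← hu, hPapply, ← h1,
      ← h2]
  have hinj : Function.Injective L :=
    (LinearMap.injective_iff_surjective (f := (L : ℝ × ℝ →ₗ[ℝ] ℝ × ℝ))).2 hsurj
  set Le : (ℝ × ℝ) ≃L[ℝ] ℝ × ℝ := ContinuousLinearEquiv.ofBijective L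
    (LinearMap.ker_eq_bot.2 hinj) (LinearMap.range_eq_top.2 hsurj) with hLe
  have hstrict' : HasStrictFDerivAt (fun z => P (Φ T (g z))) (Le : ℝ × ℝ →L[ℝ] ℝ × ℝ) z₀ := by
    rw [hLe, ContinuousLinearEquiv.coe_ofBijective]
    exact hstrict
  set e := hstrict'.toOpenPartialHomeomorph with he
  have hez : ∀ z, e z = P (Φ T (g z)) := fun z => rfl
  have hz₀e : z₀ ∈ e.source := hstrict'.mem_toOpenPartialHomeomorph_source
  have hez₀ : e z₀ = (0, 0) := by
    rw [hez, hgq, h.flow.neg_cancel, hPapply, hq]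
    rfl
  have h0t : ((0 : ℝ), (0 : ℝ)) ∈ e.target := hez₀ ▸ e.map_source hz₀e
  have hsymm0 : e.symm (0, 0) = z₀ := by rw [← hez₀, e.left_inv hz₀e]
  have hlinec : Continuous fun y : ℝ => ((0 : ℝ), y) := by fun_prop
  have hgood : ∀ᶠ y in 𝓝 (0 : ℝ), ((0 : ℝ), y) ∈ e.target ∧ e.symm (0, y) ∈ V := by
    have h1 : ∀ᶠ w in 𝓝 ((0 : ℝ), (0 : ℝ)), w ∈ e.target ∧ e.symm w ∈ V :=
      (show ∀ᶠ w in 𝓝 _, w ∈ e.target from e.open_target.mem_nhds h0t).and ((e.symm.continuousAt h0t).eventually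
        (by rw [hsymm0]; exact h.graph.isOpen_base.mem_nhds hz₀V))
    exact (hlinec.tendsto 0).eventually h1
  obtain ⟨δ, hδ, hδg⟩ := Metric.eventually_nhds_iff.1 hgood
  have hgood' : ∀ y ∈ Icc (-(δ / 2)) (δ / 2), ((0 : ℝ), y) ∈ e.target ∧ e.symm (0, y) ∈ V :=
    fun y hy => hδg (by
      rw [Real.dist_eq, sub_zero, abs_lt]; constructor <;> linarith [hy.1, hy.2])
  refine ⟨fun y => Φ T (g (e.symm (0, y))), δ / 2, by positivity, ?_, ?_, ?_, ?_⟩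
  · intro y hy
    obtain ⟨h1, h2⟩ := hgood' y hy
    have c1 : ContinuousAt (fun y : ℝ => e.symm (0, y)) y :=
      ContinuousAt.comp (f := fun y : ℝ => ((0 : ℝ), y)) (e.symm.continuousAt h1)
        hlinec.continuousAt
    have c2 : ContinuousAt (fun y : ℝ => g (e.symm (0, y))) y :=
      ContinuousAt.comp (f := fun y : ℝ => e.symm (0, y)) (hgc _ h2).continuousAt c1
    exact ((h.flow.continuous_space T).continuousAt.comp c2).continuousWithinAt
  · simp only [hsymm0, hgq, h.flow.neg_cancel]
  · intro y hy
    obtain ⟨h1, h2⟩ := hgood' y hy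
    have h3 := e.right_inv h1
    rw [hez, hPapply, Prod.mk.injEq] at h3
    refine ⟨h3.1, h3.2, ?_⟩
    rw [h.flow.cancel_neg]
    exact h.graph.graph_mem h2
  · have hc : Continuous fun z => (Φ (-T) z 0, Φ (-T) z 1) :=
      ((continuous_apply 0).comp (h.flow.continuous_space (-T))).prodMk
        ((continuous_apply 1).comp (h.flow.continuous_space (-T)))
    have hsrc : ∀ᶠ z in 𝓝 q, (Φ (-T) z 0, Φ (-T) z 1) ∈ e.source :=
      hc.continuousAt.eventually (e.open_source.mem_nhds hz₀e)
    filter_upwards [hsrc] with z hz hzW hz1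
    have h1 : Φ T (g (Φ (-T) z 0, Φ (-T) z 1)) = z := by
      rw [hg]
      simp only
      rw [← h.graph.eq_graph_point hzW, h.flow.neg_cancel]
    have h2 : e (Φ (-T) z 0, Φ (-T) z 1) = (0, z 2) := by
      rw [hez, h1, hPapply, hz1]
    rw [← h2, e.left_inv hz, h1]

end OrbitSetup

theorem mem_SigmaU_iff (η r : ℝ) (a b : ℝ × ℝ → ℝ) (k : ℕ) (z : Phase) :
    z ∈ SigmaU η r a b (k + 1) ↔ ∃ x ∈ Du r a b, ∃ t : ℝ, 0 < t ∧ ∃ γ : ℝ → Phase,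
      IsIntegralCurveOn γ (fun _ => field η) (Icc 0 t) ∧ γ 0 = x ∧ γ t = z ∧ z ∈ S ∧
      {s ∈ Ioo 0 t | γ s ∈ S}.encard = k := by
  rw [SigmaU, mem_union, mem_iterHits_iff, mem_iterHits_iff]
  constructor
  · rintro (⟨x, hx, hrest⟩ | ⟨x, hx, hrest⟩)
    · exact ⟨x, Or.inl hx, hrest⟩
    · exact ⟨x, Or.inr hx, hrest⟩
  · rintro ⟨x, hx | hx, hrest⟩
    · exact Or.inl ⟨x, hx, hrest⟩
    · exact Or.inr ⟨x, hx, hrest⟩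

theorem poincare_mem_SigmaU {η r : ℝ} {a b : ℝ × ℝ → ℝ} {k : ℕ} {x y : Phase}
    (hx : x ∈ SigmaU η r a b k) (hxy : Poincare η x y) : y ∈ SigmaU η r a b (k + 1) :=
  hx.imp (fun h => ⟨x, h, hxy⟩) fun h => ⟨x, h, hxy⟩

theorem encard_reverse (Φ : ℝ → Phase → Phase) (t : ℝ) (z : Phase) :
    {s ∈ Ioo 0 t | Φ (s - t) z ∈ S}.encard = {u ∈ Ioo 0 t | Φ (-u) z 1 = 0}.encard := by
  have : {s ∈ Ioo 0 t | Φ (s - t) z ∈ S} =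
      (fun u => t - u) '' {u ∈ Ioo 0 t | Φ (-u) z 1 = 0} := by
    ext s
    constructor
    · rintro ⟨hs, hS⟩
      refine ⟨t - s, ⟨⟨by linarith [hs.2], by linarith [hs.1]⟩, ?_⟩, by simp⟩
      simpa [S] using hS
    · rintro ⟨u, ⟨hu, h0⟩, rfl⟩
      exact ⟨⟨by linarith [hu.2], by linarith [hu.1]⟩, by simpa [S] using h0⟩
  rw [this, Function.Injective.encard_image fun x y hxy => by simpa using hxy]

/-- A time just before `τ` is marked by a positive sign and one just after by a negative sign; both
signs persist under perturbation and enclose the nearby values of `τ`. -/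
theorem continuousOn_of_sign {I : Set ℝ} {ε : ℝ} {τ : ℝ → ℝ} {G : ℝ → ℝ → ℝ}
    (hG : ∀ s, ContinuousOn (fun y => G y s) I) (hτ : ∀ y ∈ I, τ y ∈ Ico 0 ε)
    (hpos : ∀ y ∈ I, ∀ s ∈ Ioo 0 (τ y), 0 < G y s)
    (hneg : ∀ y ∈ I, ∀ s ∈ Ioc (τ y) ε, G y s < 0) : ContinuousOn τ I := by
  intro y₀ hy₀
  have h0 := hτ y₀ hy₀
  refine tendsto_order.2 ⟨fun l hl => ?_, fun u hu => ?_⟩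
  · rcases lt_or_ge l 0 with hl0 | hl0
    · filter_upwards [self_mem_nhdsWithin] with y hy
      exact hl0.trans_le (hτ y hy).1
    · obtain ⟨s, hs1, hs2⟩ := exists_between hl
      have hs0 : 0 < s := hl0.trans_lt hs1
      filter_upwards [self_mem_nhdsWithin,
        (hG s y₀ hy₀).eventually (lt_mem_nhds (hpos y₀ hy₀ s ⟨hs0, hs2⟩))] with y hy hys
      by_contra hn
      have := hneg y hy s ⟨(not_lt.1 hn).trans_lt hs1, hs2.le.trans h0.2.le⟩
      exact lt_asymm this hys
  · obtain ⟨s, hs1, hs2⟩ := exists_between (lt_min hu h0.2)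
    filter_upwards [self_mem_nhdsWithin, (hG s y₀ hy₀).eventually
      (gt_mem_nhds (hneg y₀ hy₀ s ⟨hs1, hs2.le.trans (min_le_right _ _)⟩))] with y hy hys
    by_contra hn
    have := hpos y hy s ⟨h0.1.trans_lt hs1, (hs2.trans_le (min_le_left _ _)).trans_le (not_lt.1 hn)⟩
    exact lt_asymm this hys

/-! ### Counting the hits of orbits near that of `q`. -/

namespace OrbitSetup

variable {η : ℝ} {U : Set Phase} {V : Set (ℝ × ℝ)} {a b : ℝ × ℝ → ℝ} {r R : ℝ}
  {Φ : ℝ → Phase → Phase} {T : ℝ} {q : Phase}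

theorem H_eq_zero (h : OrbitSetup η U V a b r R Φ T q) {z : Phase} {s t : ℝ}
    (hz : Φ s z ∈ localUnstable η U) (hst : s ≤ t)
    (hb : ∀ u ∈ Icc s t, Φ u z ∈ Metric.ball 0 R) : H η (Φ t z) = 0 := by
  obtain ⟨γ, hγ, h0, -, hl⟩ := hz
  have h1 := H_eq_zero_of_tendsto hγ hl
  have h2 := H_eq_of_curve hst (h.flow.isIntegralCurveOn (x := z) 0 fun u hu => by
    simpa using hb u hu)
  simp only [add_zero] at h2
  rw [← h2, ← h0, h1]

theorem continuous_coord_neg (h : OrbitSetup η U V a b r R Φ T q) (i : Fin 4) :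
    Continuous fun z : Phase × ℝ => Φ (-z.2) z.1 i :=
  (continuous_apply i).comp (h.flow.continuous.comp
    (continuous_snd.neg.prodMk continuous_fst))

theorem hasDerivAt_one (h : OrbitSetup η U V a b r R Φ T q) {t : ℝ} {z : Phase}
    (hb : Φ t z ∈ Metric.ball 0 R) : HasDerivAt (fun s => Φ s z 1) (Φ t z 2) t := by
  simpa [field] using hasDerivAt_pi.1 (h.flow.deriv z t hb) 1

theorem hasDerivAt_two (h : OrbitSetup η U V a b r R Φ T q) {t : ℝ} {z : Phase}
    (hb : Φ t z ∈ Metric.ball 0 R) : HasDerivAt (fun s => Φ s z 2) (Φ t z 3) t := by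
  simpa [field] using hasDerivAt_pi.1 (h.flow.deriv z t hb) 2

theorem hasDerivAt_neg_one (h : OrbitSetup η U V a b r R Φ T q) {t : ℝ} {z : Phase}
    (hb : Φ (-t) z ∈ Metric.ball 0 R) :
    HasDerivAt (fun u => Φ (-u) z 1) (-Φ (-t) z 2) t := by
  have := (h.hasDerivAt_one hb).scomp t (hasDerivAt_neg t)
  simpa [Function.comp_def] using this

theorem hasDerivAt_neg_two (h : OrbitSetup η U V a b r R Φ T q) {t : ℝ} {z : Phase}
    (hb : Φ (-t) z ∈ Metric.ball 0 R) :
    HasDerivAt (fun u => -Φ (-u) z 2) (Φ (-t) z 3) t := by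
  have := ((h.hasDerivAt_two hb).scomp t (hasDerivAt_neg t)).fun_neg
  simpa [Function.comp_def] using this

/-- Points of `Σ^u_k` near `q` are reached from the circle in a time near `T`. -/
theorem eventually_of_mem_SigmaU (h : OrbitSetup η U V a b r R Φ T q) {ε : ℝ} (hε : 0 < ε)
    (k : ℕ) : ∀ᶠ z in 𝓝 q, z ∈ SigmaU η r a b (k + 1) → z ∈ S ∧
      ∃ t ∈ Ioo (T - ε) (T + ε), Φ (-t) z ∈ Du r a b ∧
        {u ∈ Ioo 0 t | Φ (-u) z 1 = 0}.encard = k := by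
  have hcurve : IsIntegralCurveOn (fun t => Φ t q) (fun _ => field η) (Iic (-T)) := by
    simpa using h.flow.isIntegralCurveOn (x := q) (s := Iic (-T)) 0 fun t ht => by
      have := mem_Iic.1 ht
      simpa using h.mem_ball t (this.trans (by linarith [h.time_pos]))
  have hosc : ∀ A : ℝ, ∃ s t, A < s ∧ s < t ∧ Φ (-s) q 1 * Φ (-t) q 1 < 0 := by
    intro A
    have hT := h.time_pos
    have hne : Φ (0 + -T) q ≠ 0 := by
      intro h0
      rw [zero_add] at h0
      have hr := pow_pos h.radius_pos 2
      rw [← h.rho_start, h0] at hr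
      simp [rho] at hr
    obtain ⟨s, t, hst, htA, hneg⟩ := h.graph.oscillation h.lower h.upper
      (γ := fun t => Φ (t + -T) q)
      (isIntegralCurveOn_shift (-T) hcurve fun t ht => by
        have := mem_Iic.1 ht
        exact mem_Iic.2 (by linarith))
      (fun t ht => h.mem_nhd _ (by linarith))
      (h.tendsto.comp (tendsto_atBot_add_const_right _ (-T) tendsto_id)) hne (-A)
    refine ⟨-(t + -T), -(s + -T), by linarith, by linarith, ?_⟩
    rw [neg_neg, neg_neg, mul_comm]
    exact hneg
  -- Within the backward time `β` nearby orbits already have `k + 1` zeros, so a segment with only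
  -- `k` interior hits cannot last longer than `β`.
  obtain ⟨β, hβ, hmany⟩ := eventually_le_encard_zeros (G := fun z u => Φ (-u) z 1)
    (h.continuous_coord_neg 1) (x₀ := q) hosc (k + 1) 0
  filter_upwards [hmany, h.eventually_near_start hε β, h.eventually_curve_eq β] with z h1 h2 h3 hz
  obtain ⟨x, hx, t, ht, γ, hγ, hγ0, hγt, hS, hcard⟩ := (mem_SigmaU_iff _ _ _ _ _ _).1 hz
  refine ⟨hS, ?_⟩
  have h4 := h3 γ t ht.le hγ hγt
  rcases le_or_gt t β with hle | hgt
  · have h5 : ∀ s ∈ Icc 0 t, γ s = Φ (s - t) z := fun s hs => h4 s hs (by linarith [hs.1])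
    have h6 : Φ (-t) z ∈ Du r a b := by
      have := h5 0 ⟨le_rfl, ht.le⟩
      rw [zero_sub, hγ0] at this
      rwa [← this]
    refine ⟨t, h2 t ⟨ht.le, hle⟩ h6, h6, ?_⟩
    rw [← hcard, ← encard_reverse]
    congr 1
    ext s
    constructor
    · rintro ⟨hs, hsS⟩
      exact ⟨hs, by rwa [h5 s (Ioo_subset_Icc_self hs)]⟩
    · rintro ⟨hs, hsS⟩
      exact ⟨hs, by rwa [← h5 s (Ioo_subset_Icc_self hs)]⟩
  · exfalso
    have hsub : (fun u => t - u) '' {u ∈ Ioo 0 β | Φ (-u) z 1 = 0} ⊆ {s ∈ Ioo 0 t | γ s ∈ S} := by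
      rintro _ ⟨u, ⟨hu, hu0⟩, rfl⟩
      refine ⟨⟨by linarith [hu.2], by linarith [hu.1]⟩, ?_⟩
      rw [h4 (t - u) ⟨by linarith [hu.2], by linarith [hu.1]⟩ (by linarith [hu.2])]
      simpa [S] using hu0
    have := (encard_le_encard hsub).trans_eq hcard
    rw [Function.Injective.encard_image fun x y hxy => by simpa using hxy] at this
    have h7 : ((k + 1 : ℕ) : ℕ∞) ≤ k := h1.trans this
    have h8 : k + 1 ≤ k := by exact_mod_cast h7
    omega

theorem eventually_mem_SigmaU (h : OrbitSetup η U V a b r R Φ T q) {ε : ℝ} (hε : ε < T)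
    (k : ℕ) : ∀ᶠ z in 𝓝 q, ∀ t ∈ Ioo (T - ε) (T + ε), Φ (-t) z ∈ Du r a b →
      {u ∈ Ioo 0 t | Φ (-u) z 1 = 0}.encard = k → z ∈ S → z ∈ SigmaU η r a b (k + 1) := by
  filter_upwards [h.eventually_tube (α := -T - ε) (β := 0) Metric.isOpen_ball
    fun t ht => h.mem_ball t ht.2] with z h1 t ht hD hcard hS
  refine (mem_SigmaU_iff _ _ _ _ _ _).2 ⟨_, hD, t, by linarith [ht.1], fun s => Φ (s + -t) z,
    h.flow.isIntegralCurveOn (-t) fun s hs => h1 _ ⟨by linarith [hs.1, ht.2], by linarith [hs.2]⟩,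
    by simp, by simp [h.flow.zero], hS, ?_⟩
  rw [← hcard, ← encard_reverse]
  simp only [sub_eq_add_neg]

/-- A time scale on which the orbit of `q` behaves as its Taylor expansions at `q` and at the
initial point predict. -/
theorem exists_scale (h : OrbitSetup η U V a b r R Φ T q) {q₄ : ℝ} (hq₄ : q₄ < 0)
    (hq : q = ![3 / 2, 0, 0, q₄]) (hpS : Φ (-T) q ∉ S) : ∃ ε > 0, 2 * ε < T ∧
      (∀ t ∈ Icc (-ε) ε, Φ t q ∈ {x | x ∈ Metric.ball 0 R ∧ x 3 < 0 ∧ 0 < x 0}) ∧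
      ∀ t ∈ Icc (-T - ε) (-T + ε), Φ t q ∈ {x | x ∈ U ∧ x 1 ≠ 0} := by
  have hc := h.flow.continuous_time q
  have hci : ∀ i, Continuous fun t => Φ t q i := fun i => (continuous_apply i).comp hc
  have hq0 : Φ 0 q = q := h.flow.zero q
  have e1 : ∀ᶠ t in 𝓝 (0 : ℝ), Φ t q ∈ Metric.ball 0 R ∧ Φ t q 3 < 0 ∧ 0 < Φ t q 0 :=
    (hc.continuousAt.eventually (Metric.isOpen_ball.mem_nhds (h.mem_ball 0 le_rfl))).and
      (((hci 3).continuousAt.eventually (gt_mem_nhds (by beta_reduce; rw [hq0, hq]; simpa using hq₄))).and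
      ((hci 0).continuousAt.eventually (lt_mem_nhds (by beta_reduce; rw [hq0, hq]; norm_num))))
  have e2 : ∀ᶠ t in 𝓝 (-T), Φ t q ∈ U ∧ Φ t q 1 ≠ 0 :=
    (hc.continuousAt.eventually (h.graph.isOpen_nhd.mem_nhds (h.mem_nhd _ le_rfl))).and
      ((hci 1).continuousAt.eventually_ne hpS)
  obtain ⟨δ₁, hδ₁, h1⟩ := Metric.eventually_nhds_iff.1 e1
  obtain ⟨δ₂, hδ₂, h2⟩ := Metric.eventually_nhds_iff.1 e2
  have hT := h.time_pos
  obtain ⟨ε, hε, hεlt⟩ := exists_between (lt_min (lt_min hδ₁ hδ₂) (half_pos hT))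
  have hε1 : ε < δ₁ := hεlt.trans_le ((min_le_left _ _).trans (min_le_left _ _))
  have hε2 : ε < δ₂ := hεlt.trans_le ((min_le_left _ _).trans (min_le_right _ _))
  have hε3 : ε < T / 2 := hεlt.trans_le (min_le_right _ _)
  refine ⟨ε, hε, by linarith, fun t ht => h1 ?_, fun t ht => h2 ?_⟩
  · rw [Real.dist_eq, abs_lt]; constructor <;> linarith [ht.1, ht.2]
  · rw [Real.dist_eq, abs_lt]; constructor <;> linarith [ht.1, ht.2]

theorem isOpen_fold_region : IsOpen {x : Phase | x ∈ Metric.ball 0 R ∧ x 3 < 0 ∧ 0 < x 0} :=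
  Metric.isOpen_ball.inter ((isOpen_lt (continuous_apply 3) continuous_const).inter
    (isOpen_lt continuous_const (continuous_apply 0)))

/-- In this region x₂'' = x₄ < 0 along orbits, and concavity is preserved by reversing time; the
sign of x₃ tells on which side x₂ is negative at once. -/
theorem neg_of_fold (h : OrbitSetup η U V a b r R Φ T q) {ε : ℝ} {z : Phase}
    (hz : ∀ t ∈ Icc (-ε) ε, Φ t z ∈ {x | x ∈ Metric.ball 0 R ∧ x 3 < 0 ∧ 0 < x 0})
    (hz1 : z 1 = 0) :
    (0 ≤ z 2 → ∀ u ∈ Ioc 0 ε, Φ (-u) z 1 < 0) ∧ (z 2 ≤ 0 → ∀ u ∈ Ioc 0 ε, Φ u z 1 < 0) := by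
  constructor
  · intro hz2
    exact neg_of_concave (h := fun u => Φ (-u) z 1) (h' := fun u => -Φ (-u) z 2)
      (h'' := fun u => Φ (-u) z 3)
      (fun u hu => h.hasDerivAt_neg_one (hz (-u) ⟨by linarith [hu.2], by linarith [hu.1, hu.2]⟩).1)
      (fun u hu => h.hasDerivAt_neg_two (hz (-u) ⟨by linarith [hu.2], by linarith [hu.1, hu.2]⟩).1)
      (fun u hu => (hz (-u) ⟨by linarith [hu.2], by linarith [hu.1, hu.2]⟩).2.1)
      (by simpa [h.flow.zero] using hz1) (by simpa [h.flow.zero] using hz2)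
  · intro hz2
    exact neg_of_concave (h := fun u => Φ u z 1) (h' := fun u => Φ u z 2) (h'' := fun u => Φ u z 3)
      (fun u hu => h.hasDerivAt_one (hz u ⟨by linarith [hu.1, hu.2], hu.2⟩).1)
      (fun u hu => h.hasDerivAt_two (hz u ⟨by linarith [hu.1, hu.2], hu.2⟩).1)
      (fun u hu => (hz u ⟨by linarith [hu.1, hu.2], hu.2⟩).2.1)
      (by simpa [h.flow.zero] using hz1) (by simpa [h.flow.zero] using hz2)

/-- This is what excludes the half x₃ < 0 of the curve from Σ^u_k. -/
theorem exists_previous_hit (h : OrbitSetup η U V a b r R Φ T q) {ε : ℝ} (hε : 0 < ε) {z : Phase}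
    (hz : ∀ t ∈ Icc (-ε) ε, Φ t z ∈ {x | x ∈ Metric.ball 0 R ∧ x 3 < 0 ∧ 0 < x 0})
    (hz1 : z 1 = 0) (hz2 : z 2 < 0) (hend : Φ (-ε) z 1 < 0) : ∃ u ∈ Ioo 0 ε, Φ (-u) z 1 = 0 := by
  obtain ⟨τ, hτ, h0, -⟩ := exists_return_of_concave (h := fun u => Φ (-u) z 1)
    (h' := fun u => -Φ (-u) z 2) (h'' := fun u => Φ (-u) z 3) hε
    (fun u hu => h.hasDerivAt_neg_one (hz (-u) ⟨by linarith [hu.2], by linarith [hu.1, hu.2]⟩).1)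
    (fun u hu => h.hasDerivAt_neg_two (hz (-u) ⟨by linarith [hu.2], by linarith [hu.1, hu.2]⟩).1)
    (fun u hu => (hz (-u) ⟨by linarith [hu.2], by linarith [hu.1, hu.2]⟩).2.1)
    (by simpa [h.flow.zero] using hz1) (by simpa [h.flow.zero] using hz2) hend
  exact ⟨τ, hτ, h0⟩

theorem exists_next_hit (h : OrbitSetup η U V a b r R Φ T q) {ε : ℝ} (hε : 0 < ε) {z : Phase}
    (hz : ∀ t ∈ Icc (-ε) ε, Φ t z ∈ {x | x ∈ Metric.ball 0 R ∧ x 3 < 0 ∧ 0 < x 0})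
    (hz1 : z 1 = 0) (hz2 : 0 < z 2) (hend : Φ ε z 1 < 0) :
    ∃ τ ∈ Ioo 0 ε, Φ τ z 1 = 0 ∧ Φ τ z 2 < 0 ∧ (∀ s ∈ Ioo 0 τ, 0 < Φ s z 1) ∧
      ∀ s ∈ Ioc τ ε, Φ s z 1 < 0 :=
  exists_return_of_concave (h := fun u => Φ u z 1) (h' := fun u => Φ u z 2)
    (h'' := fun u => Φ u z 3) hε
    (fun u hu => h.hasDerivAt_one (hz u ⟨by linarith [hu.1, hu.2], hu.2⟩).1)
    (fun u hu => h.hasDerivAt_two (hz u ⟨by linarith [hu.1, hu.2], hu.2⟩).1)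
    (fun u hu => (hz u ⟨by linarith [hu.1, hu.2], hu.2⟩).2.1)
    (by simpa [h.flow.zero] using hz1) (by simpa [h.flow.zero] using hz2) hend

/-- On `S` with x₃ = 0 the equation H = 0 reduces to x₁²(3/2 - x₁) = 0, which leaves only `v1` and
`v2`. -/
theorem transversal_hits (h : OrbitSetup η U V a b r R Φ T q)
    (htr : ∀ t ∈ Ioo 0 T, Φ (-t) q 1 = 0 → Φ (-t) q ∉ v1 ∪ v2) :
    ∀ t ∈ Ioo 0 T, Φ (-t) q 1 = 0 → Φ (-t) q 2 ≠ 0 := by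
  intro t ht h1 h2
  have hH := h.H_eq_zero h.start_graph (t := -t) (by linarith [ht.2])
    fun u hu => h.mem_ball u (by linarith [hu.2, ht.1])
  have hno := htr t ht h1
  simp only [H, h1, h2] at hH
  have : Φ (-t) q 0 ^ 2 * (3 / 2 - Φ (-t) q 0) = 0 := by linear_combination 3 * hH
  rcases mul_eq_zero.1 this with h3 | h3
  · exact hno (Or.inl ⟨by simpa using h3, h1, h2⟩)
  · exact hno (Or.inr ⟨by linarith, h1, h2⟩)

/-- Near `q`, the number of hits since the circle only changes by the hits in a short time before. -/
theorem eventually_count (h : OrbitSetup η U V a b r R Φ T q) {k : ℕ} {ε : ℝ} (hε : 0 < ε)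
    (hεT : 2 * ε < T) (hq : ∀ u ∈ Ioc 0 ε, Φ (-u) q 1 < 0)
    (hp : ∀ t ∈ Icc (-T - ε) (-T + ε), Φ t q 1 ≠ 0)
    (htr : ∀ t ∈ Ioo 0 T, Φ (-t) q 1 = 0 → Φ (-t) q 2 ≠ 0)
    (hcard : {u ∈ Ioo 0 T | Φ (-u) q 1 = 0}.encard = k) :
    ∀ᶠ z in 𝓝 q, ∀ t ∈ Ioo (T - ε) (T + ε), {u ∈ Ioo 0 t | Φ (-u) z 1 = 0}.encard =
      {u ∈ Ioo 0 ε | Φ (-u) z 1 = 0}.encard + k := by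
  have hcont := h.continuous_coord_neg
  have hempty : ∀ (g : ℝ → ℝ) (α β : ℝ), (∀ u ∈ Ioo α β, g u ≠ 0) →
      {u ∈ Ioo α β | g u = 0}.encard = 0 := by
    intro g α β hg
    rw [encard_eq_zero]
    ext u
    simp only [mem_ofPred_eq, mem_empty_iff_false, iff_false]
    exact fun hu => hg u hu.1 hu.2
  have hqε : Φ (-ε) q 1 ≠ 0 := (hq ε ⟨hε, le_rfl⟩).ne
  have hqT : ∀ u ∈ Icc (T - ε) (T + ε), Φ (-u) q 1 ≠ 0 := fun u hu =>
    hp (-u) ⟨by linarith [hu.2], by linarith [hu.1]⟩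
  -- For `q` itself all hits lie in this middle interval: concavity excludes those near `q`, and the
  -- starting point off `S` excludes those near the circle.
  have hmid : {u ∈ Ioo ε (T - ε) | Φ (-u) q 1 = 0}.encard = k := by
    have := encard_zeros_split (g := fun u => Φ (-u) q 1) (α := 0) (b := ε) (c := T - ε) (β := T)
      hε.le (by linarith) (by linarith) hqε (hqT _ ⟨le_rfl, by linarith⟩)
    rw [hcard, hempty (fun u => Φ (-u) q 1) 0 ε fun u hu => (hq u ⟨hu.1, hu.2.le⟩).ne,
      hempty (fun u => Φ (-u) q 1) (T - ε) T fun u hu => hqT u ⟨hu.1.le, by linarith [hu.2]⟩,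
      zero_add, add_zero] at this
    exact this.symm
  have hstable := eventually_encard_zeros_eq (G := fun z u => Φ (-u) z 1)
    (G' := fun z u => -Φ (-u) z 2) (hcont 1) (hcont 2).neg (x₀ := q) (α := ε) (β := T - ε) (n := k)
    (by
      filter_upwards [h.eventually_tube (α := -T) (β := 0) Metric.isOpen_ball
        fun t ht => h.mem_ball t ht.2] with z hz t ht
      exact h.hasDerivAt_neg_one (hz _ ⟨by linarith [ht.2], by linarith [ht.1]⟩))
    hqε (hqT _ ⟨le_rfl, by linarith⟩)
    (fun t ht h0 => neg_ne_zero.2 (htr t ⟨by linarith [ht.1], by linarith [ht.2]⟩ h0)) hmid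
  have hcz : Continuous fun z => Φ (-ε) z 1 :=
    (continuous_apply 1).comp (h.flow.continuous_space (-ε))
  filter_upwards [hstable, hcz.continuousAt.eventually_ne hqε,
    eventually_forall_ne_zero (G := fun z u => Φ (-u) z 1) (hcont 1) hqT] with z h1 h2 h3 t ht
  rw [encard_zeros_split (g := fun u => Φ (-u) z 1) (b := ε) (c := T - ε) hε.le (by linarith)
    ht.1.le h2 (h3 _ ⟨le_rfl, by linarith⟩), h1,
    hempty (fun u => Φ (-u) z 1) (T - ε) t fun u hu => h3 u ⟨hu.1.le, by linarith [hu.2, ht.2]⟩,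
    add_zero]

end OrbitSetup

theorem isOpenArcFrom_of_continuousOn {f : ℝ → Phase} {δ : ℝ} (hδ : 0 < δ)
    (hf : ContinuousOn f (Icc 0 δ)) (hinj : InjOn f (Icc 0 δ)) :
    IsOpenArcFrom (f 0) (f '' Ioo 0 δ) := by
  have hm : MapsTo (fun s => δ * s) (Icc 0 1) (Icc 0 δ) := fun s hs =>
    ⟨mul_nonneg hδ.le hs.1, mul_le_of_le_one_right hδ.le hs.2⟩
  refine ⟨fun s => f (δ * s), hf.comp (by fun_prop) hm, fun s hs t ht hst => ?_, by simp, ?_⟩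
  · exact mul_left_cancel₀ hδ.ne' (hinj (hm hs) (hm ht) hst)
  · ext x
    constructor
    · rintro ⟨y, hy, rfl⟩
      refine ⟨y / δ, ⟨div_pos hy.1 hδ, (div_lt_one hδ).2 hy.2⟩, ?_⟩
      simp only
      rw [mul_div_cancel₀ _ hδ.ne']
    · rintro ⟨s, hs, rfl⟩
      exact ⟨δ * s, ⟨mul_pos hδ hs.1, mul_lt_of_lt_one_right hδ hs.2⟩, rfl⟩

theorem mem_C_of_H {η : ℝ} {x : Phase} (h1 : x 1 = 0) (hH : H η x = 0) : x ∈ C := by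
  refine ⟨h1, ?_⟩
  rw [H, h1] at hH
  linear_combination hH

/-! ### Local description of Σ^u_k and of the Poincaré map. -/

namespace OrbitSetup

variable {η : ℝ} {U : Set Phase} {V : Set (ℝ × ℝ)} {a b : ℝ × ℝ → ℝ} {r R : ℝ}
  {Φ : ℝ → Phase → Phase} {T : ℝ} {q : Phase}

/-- A first hit of the complete flow inside the ball is the value of the Poincaré map. -/
theorem poincare_iff (h : OrbitSetup η U V a b r R Φ T q) {z y : Phase} {τ : ℝ} (hτ : 0 < τ)
    (hb : ∀ t ∈ Icc 0 τ, Φ t z ∈ Metric.ball 0 R) (h0 : Φ τ z 1 = 0)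
    (hpos : ∀ s ∈ Ioo 0 τ, 0 < Φ s z 1) : Poincare η z y ↔ y = Φ τ z := by
  constructor
  · rintro ⟨t, ht, γ, hγ, hγ0, hγt, hyS, hno⟩
    have heq : ∀ s ∈ Icc 0 (min t τ), γ s = Φ s z := by
      intro s hs
      have := h.flow.eq_of_curve (hγ.mono (Icc_subset_Icc_right (min_le_left t τ)))
        (left_mem_Icc.2 (le_min ht.le hτ.le)) (fun u hu => by
          rw [hγ0, sub_zero]; exact hb u ⟨hu.1, hu.2.trans (min_le_right _ _)⟩) s hs
      rwa [hγ0, sub_zero] at this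
    rcases lt_trichotomy t τ with hlt | rfl | hlt
    · have h1 := heq t ⟨ht.le, (min_eq_left hlt.le).ge⟩
      have h2 := hpos t ⟨ht, hlt⟩
      rw [← h1, hγt] at h2
      exact absurd (show y 1 = 0 from hyS) h2.ne'
    · rw [← hγt, heq t ⟨ht.le, by simp⟩]
    · have h1 := heq τ ⟨hτ.le, (min_eq_right hlt.le).ge⟩
      exact absurd (show γ τ ∈ S by rw [h1]; exact h0) (hno τ ⟨hτ, hlt⟩)
  · rintro rfl
    refine ⟨τ, hτ, fun s => Φ (s + 0) z, h.flow.isIntegralCurveOn 0 fun s hs => ?_, ?_, ?_, h0,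
      fun s hs hS => ?_⟩
    · simpa using hb s hs
    · simp [h.flow.zero]
    · simp
    · exact (hpos s hs).ne' (by simpa [S] using hS)

/-- The description of `Σ^u_k` near `q`, and of the Poincaré map on it. -/
theorem exists_nhd (h : OrbitSetup η U V a b r R Φ T q) {q₄ : ℝ} (hq₄ : q₄ < 0)
    (hq : q = ![3 / 2, 0, 0, q₄]) (hpS : Φ (-T) q ∉ S)
    (htr : ∀ t ∈ Ioo 0 T, Φ (-t) q 1 = 0 → Φ (-t) q ∉ v1 ∪ v2) {k : ℕ}
    (hqk : q ∈ SigmaU η r a b (k + 1)) {f : ℝ → Phase} (hf0 : f 0 = q)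
    (hf : ∀ᶠ z in 𝓝 q, Φ (-T) z ∈ localUnstable η U → z 1 = 0 → z = f (z 2)) :
    ∃ ε > 0, ∀ᶠ z in 𝓝 q,
      (z ∈ SigmaU η r a b (k + 1) → z ≠ q → z 1 = 0 ∧ 0 < z 2 ∧ z = f (z 2)) ∧
      (Φ (-T) z ∈ localUnstable η U → z 1 = 0 → H η z = 0 ∧
        (0 < z 2 → z ∈ SigmaU η r a b (k + 1))) ∧
      (∀ t ∈ Icc (-ε) ε, Φ t z ∈ {x | x ∈ Metric.ball 0 R ∧ x 3 < 0 ∧ 0 < x 0}) ∧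
      Φ ε z 1 < 0 := by
  obtain ⟨ε, hε, hεT, hscale, hstart⟩ := h.exists_scale hq₄ hq hpS
  have hq1 : q 1 = 0 := by rw [hq]; rfl
  have hq2 : q 2 = 0 := by rw [hq]; rfl
  have hfold := h.neg_of_fold hscale hq1
  have hqb := hfold.1 hq2.ge
  have hqf := hfold.2 hq2.le
  -- The statement about nearby points, taken at `q` itself, yields the hit count of its own
  -- segment; uniqueness identifies the time with `T`.
  obtain ⟨-, t₀, ht₀, ht₀D, hcard⟩ :=
    (h.eventually_of_mem_SigmaU hε k).self_of_nhds hqk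
  have ht₀T : -t₀ = -T := h.eq_of_mem_Du (fun s hs => by
    have := hs.1.trans hs.2
    linarith [ht₀.1]) ht₀D
  rw [neg_inj] at ht₀T
  subst ht₀T
  have hcs : ∀ t, Continuous fun z => Φ t z 1 := fun t =>
    (continuous_apply 1).comp (h.flow.continuous_space t)
  refine ⟨ε, hε, ?_⟩
  filter_upwards [hf, h.eventually_of_mem_SigmaU hε k, h.eventually_mem_SigmaU (ε := ε) (by linarith) k,
    h.eventually_count hε hεT hqb (fun t ht => (hstart t ht).2) (h.transversal_hits htr) hcard,
    h.eventually_mem_localUnstable (t₀ + ε),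
    h.eventually_cross hε (by linarith)
      (fun t ht => (hstart t ⟨by linarith [ht.1], ht.2⟩).1),
    h.eventually_tube (α := -ε) (β := ε) isOpen_fold_region hscale,
    h.eventually_tube (α := -t₀) (β := 0) Metric.isOpen_ball fun t ht => h.mem_ball t ht.2,
    (hcs (-ε)).continuousAt.eventually (gt_mem_nhds (hqb ε ⟨hε, le_rfl⟩)),
    (hcs ε).continuousAt.eventually (gt_mem_nhds (hqf ε ⟨hε, le_rfl⟩))]
    with z c1 c2 c3 c4 c5 c6 c7 c8 c9 c10
  refine ⟨fun hz hne => ?_, fun hz hz1 => ⟨?_, fun hz2 => ?_⟩, c7, c10⟩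
  · obtain ⟨hz1, t, ht, htD, htc⟩ := c2 hz
    have hz1 : z 1 = 0 := hz1
    have hzW := c5 t ⟨by linarith [ht.1], ht.2.le⟩
      ((mem_Du_iff h.graph h.radius_pos h.disc).1 htD).1
    have hzf := c1 hzW hz1
    have h0 := c4 t ht
    rw [htc] at h0
    have h1 : {u ∈ Ioo 0 ε | Φ (-u) z 1 = 0}.encard = 0 := by
      have : (0 : ℕ∞) + k = {u ∈ Ioo 0 ε | Φ (-u) z 1 = 0}.encard + k := by rw [zero_add]; exact h0
      exact (ENat.add_left_injective_of_ne_top (ENat.natCast_ne_top k) this).symm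
    rw [encard_eq_zero] at h1
    refine ⟨hz1, ?_, hzf⟩
    -- A negative x₃ would produce a hit in (0, ε), contradicting the count, and x₃ = 0 would give z
    -- = f 0 = q.
    rcases lt_trichotomy (z 2) 0 with h2 | h2 | h2
    · obtain ⟨u, hu, hu0⟩ := h.exists_previous_hit hε c7 hz1 h2 c9
      have : u ∈ {u ∈ Ioo 0 ε | Φ (-u) z 1 = 0} := ⟨hu, hu0⟩
      rw [h1] at this
      exact absurd this (notMem_empty u)
    · rw [h2, hf0] at hzf
      exact absurd hzf hne
    · exact h2
  · have := h.H_eq_zero hz (t := 0) (by linarith) c8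
    rwa [h.flow.zero] at this
  · obtain ⟨t, ht, htD⟩ := c6 hz
    refine c3 t ht htD ?_ hz1
    rw [c4 t ht]
    have : {u ∈ Ioo 0 ε | Φ (-u) z 1 = 0} = ∅ := by
      ext u
      simp only [mem_ofPred_eq, mem_empty_iff_false, iff_false]
      exact fun hu => ((h.neg_of_fold c7 hz1).1 hz2.le u ⟨hu.1.1, hu.1.2.le⟩).ne hu.2
    rw [this, encard_empty, zero_add]

end OrbitSetup

end Bifocal

/-! ### Assembly of the two arcs. -/

open Bifocal Topology in
theorem mainTheorem6 (η : ℝ) (hη : -2 < η) (hη' : η < 2)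
    (U : Set Phase) (V : Set (ℝ × ℝ)) (a b : ℝ × ℝ → ℝ)
    (hW : IsLocalUnstableGraph η U V a b)
    (r : ℝ) (hr : 0 < r) (hrV : ∀ z : ℝ × ℝ, z.1 ^ 2 + z.2 ^ 2 ≤ r ^ 2 → z ∈ V)
    (k : ℕ) (hk : 1 ≤ k) (q₄ : ℝ) (hq₄ : q₄ < 0) (q : Phase) (hq : q = ![3 / 2, 0, 0, q₄])
    (hqk : q ∈ SigmaU η r a b k)
    (hclean : ReachedCleanly η (Du r a b) q)
    (htrans : TransverseToVertical η U q) :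
    ∀ N ∈ 𝓝 q, ∃ W : Set Phase, IsOpen W ∧ q ∈ W ∧ W ⊆ N ∧
      ∃ A₂ A₃ : Set Phase,
        IsOpenArcFrom q A₂ ∧ A₂ ⊆ C2 ∧ (SigmaU η r a b k \ {q}) ∩ W = A₂ ∧
        IsOpenArcFrom q A₃ ∧ A₃ ⊆ SigmaU η r a b (k + 1) ∩ C3 ∧
        (∀ x ∈ A₂, ∃ y, Poincare η x y) ∧ A₃ = poincareImage η A₂ := by
  intro N hN
  obtain ⟨k, rfl⟩ : ∃ m, k = m + 1 := ⟨k - 1, by omega⟩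
  have hq0 : q ≠ 0 := by
    intro h0
    have := congrFun h0 3
    rw [hq] at this
    exact hq₄.ne this
  have hq1 : q 1 = 0 := by rw [hq]; rfl
  have hq2 : q 2 = 0 := by rw [hq]; rfl
  obtain ⟨R, Φ, T, h, hpS, htr⟩ := exists_orbitSetup hη hη' hW hr hrV hq0 hq1 hclean
  obtain ⟨f, δ, hδ, hfc, hf0, hf, hfz⟩ := h.exists_local_curve htrans hq
  obtain ⟨ε, hε, hev⟩ := h.exists_nhd hq₄ hq hpS htr hqk hf0 hfz
  obtain ⟨W₀, hW₀, hW₀o, hqW₀⟩ := eventually_nhds_iff.1 (hev.and hN)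
  -- shrink the parameter interval so that the curve stays in the neighbourhood
  obtain ⟨δ₁, hδ₁, hδ₁δ, hfW⟩ : ∃ δ₁ > 0, δ₁ ≤ δ ∧ ∀ y ∈ Set.Icc 0 δ₁, f y ∈ W₀ := by
    have hc : ContinuousAt f 0 := (hfc 0 ⟨by linarith, hδ.le⟩).continuousAt
      (Icc_mem_nhds (by linarith) hδ)
    obtain ⟨d, hd, hd'⟩ := Metric.eventually_nhds_iff.1
      (hc.eventually (hW₀o.mem_nhds (by rw [hf0]; exact hqW₀)))
    refine ⟨min δ (d / 2), lt_min hδ (by positivity), min_le_left _ _, fun y hy => hd' ?_⟩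
    have := hy.2.trans (min_le_right _ _)
    rw [Real.dist_eq, sub_zero, abs_of_nonneg hy.1]
    linarith
  have hsub : Set.Icc 0 δ₁ ⊆ Set.Icc (-δ) δ := Set.Icc_subset_Icc (by linarith) hδ₁δ
  have hf1 : ∀ y ∈ Set.Icc 0 δ₁, f y 1 = 0 := fun y hy => (hf y (hsub hy)).1
  have hf2 : ∀ y ∈ Set.Icc 0 δ₁, f y 2 = y := fun y hy => (hf y (hsub hy)).2.1
  have hfold : ∀ y ∈ Set.Icc 0 δ₁, ∀ t ∈ Set.Icc (-ε) ε, Φ t (f y) ∈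
      {x | x ∈ Metric.ball 0 R ∧ x 3 < 0 ∧ 0 < x 0} := fun y hy =>
    (hW₀ _ (hfW y hy)).1.2.2.1
  have hfH : ∀ y ∈ Set.Icc 0 δ₁, H η (f y) = 0 := fun y hy =>
    ((hW₀ _ (hfW y hy)).1.2.1 (hf y (hsub hy)).2.2 (hf1 y hy)).1
  have hfS : ∀ y ∈ Set.Ioo 0 δ₁, f y ∈ SigmaU η r a b (k + 1) := fun y hy =>
    ((hW₀ _ (hfW y (Set.Ioo_subset_Icc_self hy))).1.2.1 (hf y (hsub (Set.Ioo_subset_Icc_self hy))).2.2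
      (hf1 y (Set.Ioo_subset_Icc_self hy))).2
      (by rw [hf2 y (Set.Ioo_subset_Icc_self hy)]; exact hy.1)
  have hmid : (0 : ℝ) ∈ Set.Icc (-ε) ε := ⟨by linarith, hε.le⟩
  -- the return times
  have hτ : ∀ y, ∃ τ, y ∈ Set.Icc 0 δ₁ → τ ∈ Set.Ico 0 ε ∧ Φ τ (f y) 1 = 0 ∧
      (∀ s ∈ Set.Ioo 0 τ, 0 < Φ s (f y) 1) ∧ (∀ s ∈ Set.Ioc τ ε, Φ s (f y) 1 < 0) ∧
      (y = 0 → τ = 0) ∧ (0 < y → 0 < τ ∧ Φ τ (f y) 2 < 0) := by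
    intro y
    by_cases hy : y ∈ Set.Icc 0 δ₁
    · rcases hy.1.eq_or_lt with h0 | h0
      · subst h0
        refine ⟨0, fun _ => ⟨⟨le_rfl, hε⟩, by rw [h.flow.zero]; exact hf1 0 hy,
          fun s hs => absurd (hs.1.trans hs.2) (lt_irrefl _), ?_, fun _ => rfl,
          fun hlt => absurd hlt (lt_irrefl _)⟩⟩
        exact (h.neg_of_fold (hfold 0 hy) (hf1 0 hy)).2 (hf2 0 hy).le
      · obtain ⟨τ, hτ, h1, h2, h3, h4⟩ := h.exists_next_hit hε (hfold y hy) (hf1 y hy)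
          (by rw [hf2 y hy]; exact h0) (hW₀ _ (hfW y hy)).1.2.2.2
        exact ⟨τ, fun _ => ⟨⟨hτ.1.le, hτ.2⟩, h1, h3, h4, fun h5 => absurd h5 h0.ne',
          fun _ => ⟨hτ.1, h2⟩⟩⟩
    · exact ⟨0, fun hy' => absurd hy' hy⟩
  choose τ hτ using hτ
  have hfc' : ContinuousOn f (Set.Icc 0 δ₁) := hfc.mono hsub
  have hτc : ContinuousOn τ (Set.Icc 0 δ₁) :=
    continuousOn_of_sign (ε := ε) (G := fun y s => Φ s (f y) 1)
      (fun s => (continuous_apply 1).comp_continuousOn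
        ((h.flow.continuous_space s).comp_continuousOn hfc'))
      (fun y hy => (hτ y hy).1) (fun y hy => (hτ y hy).2.2.1) (fun y hy => (hτ y hy).2.2.2.1)
  have hmem0 : (0 : ℝ) ∈ Set.Icc 0 δ₁ := ⟨le_rfl, hδ₁.le⟩
  have hτ0 : τ 0 = 0 := (hτ 0 hmem0).2.2.2.2.1 rfl
  have hgc : ContinuousOn (fun y => Φ (τ y) (f y)) (Set.Icc 0 δ₁) :=
    h.flow.continuous.comp_continuousOn (hτc.prodMk hfc')
  have hginj : Set.InjOn (fun y => Φ (τ y) (f y)) (Set.Icc 0 δ₁) := by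
    have key : ∀ y ∈ Set.Icc 0 δ₁, ∀ y' ∈ Set.Icc 0 δ₁, τ y ≤ τ y' →
        Φ (τ y) (f y) = Φ (τ y') (f y') → y = y' := by
      intro y hy y' hy' hle heq
      -- With distinct positive return times, `f y` would be a point of `S` on the orbit of `f y'`
      -- strictly before its first return. If τ y = 0, then y = 0 and x₃ = 0 at the image, whereas
      -- it is negative at the other one.
      have hback : f y = Φ (τ y' - τ y) (f y') := by
        rw [sub_eq_neg_add, h.flow.add, ← heq, h.flow.cancel_neg]
      rcases hle.eq_or_lt with h1 | h1
      · rw [h1, sub_self, h.flow.zero] at hback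
        rw [← hf2 y hy, ← hf2 y' hy', hback]
      · exfalso
        have hy'p : 0 < y' := by
          rcases hy'.1.eq_or_lt with h2 | h2
          · have := (hτ y' hy').2.2.2.2.1 h2.symm
            linarith [(hτ y hy).1.1]
          · exact h2
        rcases (hτ y hy).1.1.eq_or_lt with h2 | h2
        · have hy0 : y = 0 := by
            by_contra hne
            have := ((hτ y hy).2.2.2.2.2 (lt_of_le_of_ne hy.1 (Ne.symm hne))).1
            linarith
          have h3 := ((hτ y' hy').2.2.2.2.2 hy'p).2
          rw [← heq, ← h2, h.flow.zero, hf2 y hy, hy0] at h3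
          exact lt_irrefl _ h3
        · have h3 := (hτ y' hy').2.2.1 (τ y' - τ y) ⟨by linarith, by linarith⟩
          rw [← hback, hf1 y hy] at h3
          exact lt_irrefl _ h3
    intro y hy y' hy' heq
    rcases le_total (τ y) (τ y') with hle | hle
    · exact key y hy y' hy' hle heq
    · exact (key y' hy' y hy hle heq.symm).symm
  have hpoin : ∀ y ∈ Set.Ioo 0 δ₁, ∀ w, Poincare η (f y) w ↔ w = Φ (τ y) (f y) := by
    intro y hy w
    have hy' := Set.Ioo_subset_Icc_self hy
    have h1 := hτ y hy'
    exact h.poincare_iff (h1.2.2.2.2.2 hy.1).1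
      (fun t ht => (hfold y hy' t ⟨by linarith [ht.1], by linarith [ht.2, h1.1.2]⟩).1) h1.2.1
      h1.2.2.1
  -- The bound on x₃ removes points beyond the parameter interval, so that the intersection is
  -- exactly the image of (0, δ₁).
  refine ⟨W₀ ∩ {z | |z 2| < δ₁}, hW₀o.inter (isOpen_lt (continuous_apply 2).abs continuous_const),
    ⟨hqW₀, by simpa [hq2] using hδ₁⟩, fun z hz => (hW₀ z hz.1).2, f '' Set.Ioo 0 δ₁,
    (fun y => Φ (τ y) (f y)) '' Set.Ioo 0 δ₁, ?_, ?_, ?_, ?_, ?_, ?_, ?_⟩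
  · have := isOpenArcFrom_of_continuousOn hδ₁ hfc' (fun y hy y' hy' heq => by
      rw [← hf2 y hy, ← hf2 y' hy', heq])
    rwa [hf0] at this
  · rintro _ ⟨y, hy, rfl⟩
    have hy' := Set.Ioo_subset_Icc_self hy
    have := (hfold y hy' 0 hmid).2.2
    rw [h.flow.zero] at this
    exact ⟨mem_C_of_H (hf1 y hy') (hfH y hy'), this, by rw [hf2 y hy']; exact hy.1⟩
  · ext z
    constructor
    · rintro ⟨⟨hzS, hzq⟩, hzW, hzδ⟩
      obtain ⟨-, hz2, hzf⟩ := (hW₀ z hzW).1.1 hzS hzq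
      exact ⟨z 2, ⟨hz2, (abs_lt.1 hzδ).2⟩, hzf.symm⟩
    · rintro ⟨y, hy, rfl⟩
      have hy' := Set.Ioo_subset_Icc_self hy
      refine ⟨⟨hfS y hy, fun heq => ?_⟩, hfW y hy', ?_⟩
      · have := hf2 y hy'
        rw [Set.mem_singleton_iff.1 heq, hq2] at this
        exact hy.1.ne this
      · show |f y 2| < δ₁
        rw [hf2 y hy', abs_of_pos hy.1]
        exact hy.2
  · have := isOpenArcFrom_of_continuousOn hδ₁ hgc hginj
    simp only [hτ0, hf0, h.flow.zero] at this
    exact this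
  · rintro _ ⟨y, hy, rfl⟩
    have hy' := Set.Ioo_subset_Icc_self hy
    have h1 := hτ y hy'
    have hmemτ : ∀ t ∈ Set.Icc 0 (τ y), t ∈ Set.Icc (-ε) ε := fun t ht =>
      ⟨by linarith [ht.1], by linarith [ht.2, h1.1.2]⟩
    refine ⟨poincare_mem_SigmaU (hfS y hy) ((hpoin y hy _).2 rfl), mem_C_of_H (η := η) h1.2.1 ?_,
      (hfold y hy' _ (hmemτ _ ⟨h1.1.1, le_rfl⟩)).2.2, (h1.2.2.2.2.2 hy.1).2⟩
    have h2 := H_eq_of_curve h1.1.1 (h.flow.isIntegralCurveOn (x := f y) 0 fun t ht => by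
      simpa using (hfold y hy' t (hmemτ t ht)).1)
    simp only [add_zero, h.flow.zero] at h2
    rw [← h2, hfH y hy']
  · rintro _ ⟨y, hy, rfl⟩
    exact ⟨_, (hpoin y hy _).2 rfl⟩
  · ext w
    constructor
    · rintro ⟨y, hy, rfl⟩
      exact ⟨f y, ⟨y, hy, rfl⟩, (hpoin y hy _).2 rfl⟩
    · rintro ⟨_, ⟨y, hy, rfl⟩, hp⟩
      exact ⟨y, hy, ((hpoin y hy w).1 hp).symm⟩
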